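/- **Setting.** Consider $N$ qubits and a parametrized circuit $\mathbf U(\boldsymbol\theta)=B_{m}\cdots B_2B_1$, $\boldsymbol\theta\in\mathbb R^M$ random, composed of blocks; the block $B_k$ acts on a set $s(B_k)$ of qubits, and blocks with smaller index act earlier. No assumption is made on the number, sizes or arrangement of the blocks. Fix a parameter $\theta_\mu$ that occurs in exactly one gate $U_\mu=e^{-i\theta_\mu\Omega_\mu}$, located inside one block, $B_{k(\mu)}=R\,U_\mu L$, where $\Omega_\mu$ is a non-identity Pauli string supported in $s(B_{k(\mu)})$. The blocks $B_k$ ($k\ne k(\mu)$) and the sub-blocks $L$ and $R$ are random unitaries forming unitary $2$-designs on $s(B_k)$, respectively on $s(B_{k(\mu)})$ for $L,R$; all of these, together with $\theta_\mu$, are mutually independent. Let $H=\sum_j\lambda_jh_j$ with $\lambda_j\in\mathbb R$ and distinct Pauli strings $h_j$ whose supports $s(h_j)$ are contained in $\bigcup_k s(B_k)$, and let $C(\boldsymbol\theta)=\langle \mathbf 0|\mathbf U^\dagger H\mathbf U|\mathbf 0\rangle$. **Causal cone.** Recursively from the last block to the first, $B_k$ is in the causal cone of $h_j$ if $s(B_k)$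 meets $s(h_j)$ or meets $s(B_{k'})$ for some $k'>k$ with $B_{k'}$ in the cone. **Path sets.** For $k<k'$ let $s_c(B_k,B_{k'})=\bigl(s(B_k)\cap s(B_{k'})\bigr)\setminus\bigcup_{k<i<k'}s(B_i)$; the two blocks are connected if this set is non-empty. Let $s_f(B_k)=s(B_k)\setminus\bigcup_{i<k}s(B_i)$ and $s_b(B_k)=s(B_k)\setminus\bigcup_{i>k}s(B_i)$. A path is a non-empty sequence $B_{k_1},\dots,B_{k_r}$ with $k_1<\dots<k_r$, consecutive blocks connected, $s_f(B_{k_1})\neq\varnothing$ and $s_b(B_{k_r})\ne\varnothing$; its head is $B_{k_1}$ and its edges are $(\rho_0,B_{k_1}),(B_{k_1},B_{k_2}),\dots,(B_{k_{r-1}},B_{k_r})$, where $\rho_0=|\mathbf 0\rangle\langle\mathbf 0|$. Edge lengths are $$l(B_k,B_{k'})=\log_4\frac{4^{|s(B_{k'})|}-1}{4^{|s_c(B_k,B_{k'})|}-1},\qquad l(\rho_0,B_k)=\log_4\frac{4^{|s(B_k)|}-1}{4^{|s_f(B_k)|}-1}.$$ A path set $P$ is a collection of paths. Its length $l(P)$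 is the sum of the lengths of all edges of its paths, each distinct edge counted once. Its head width $w(P)$ is the sum over the distinct head blocks $B_k$ of its paths of $w(B_k)=\log_2\frac{4^{|s_f(B_k)|}-1}{2^{|s_f(B_k)|}-1}$. We say that $P$ goes through $B_{k(\mu)}$ and covers $h_j$ if $s(h_j)$ is contained in the union of the $s_b(B)$ over all blocks $B$ of paths of $P$, and some path of $P$ contains $B_{k(\mu)}$ and connects it to $h_j$, i.e. $s_b(B)\cap s(h_j)\neq\varnothing$ for $B=B_{k(\mu)}$ or for some later block $B$ of that path. **Theorem.** For every $h_j$ whose causal cone contains $B_{k(\mu)}$ there exists a path set that goes through $B_{k(\mu)}$ and covers $h_j$. For any choice of such path sets $P_j$, $$\operatorname{Var}[\partial_\mu C]\;\ge\;\sum_j\lambda_j^2\cdot 2^{\,1-2l(P_j)-w(P_j)},$$ where $j$ runs over the indices of those $h_j$ whose causal cone contains $B_{k(\mu)}$. -/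

import Mathlib

open MeasureTheory ProbabilityTheory

namespace PathBound

/-! ### Pauli strings on `N` qubits -/

/-- The four single-qubit Pauli labels. -/
inductive Pauli where
  | I | X | Y | Z

/-- The Pauli matrices. -/
noncomputable def Pauli.toMatrix : Pauli → Matrix (Fin 2) (Fin 2) ℂ
  | .I => 1
  | .X => !![0, 1; 1, 0]
  | .Y => !![0, -Complex.I; Complex.I, 0]
  | .Z => !![1, 0; 0, -1]

/-- Computational basis labels of a family of qubits. -/
abbrev Bits (Q : Type) : Type := Q → Fin 2

/-- Linear operators on `N` qubits, written in the computational basis. -/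
abbrev Op (N : ℕ) : Type := Matrix (Bits (Fin N)) (Bits (Fin N)) ℂ

/-- A Pauli string `σ₁ ⊗ ⋯ ⊗ σ_N`. -/
abbrev PauliString (N : ℕ) : Type := Fin N → Pauli

/-- The operator `σ₁ ⊗ ⋯ ⊗ σ_N`. -/
noncomputable def PauliString.toOp {N : ℕ} (h : PauliString N) : Op N :=
  Matrix.of fun x y => ∏ q, (h q).toMatrix (x q) (y q)

open Classical in
/-- The support `s(h)`: the qubits on which the string is not the identity. -/
noncomputable def PauliString.supp {N : ℕ} (h : PauliString N) : Finset (Fin N) :=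
  Finset.univ.filter fun q => h q ≠ Pauli.I

/-! ### The unitary group, Haar measure and unitary designs -/

section Haar

variable {n : Type} [Fintype n] [DecidableEq n]

noncomputable instance : MeasurableSpace (Matrix.unitaryGroup n ℂ) := borel _

instance : BorelSpace (Matrix.unitaryGroup n ℂ) := ⟨rfl⟩

instance : CompactSpace (Matrix.unitaryGroup n ℂ) := by
  have hsub : ((Matrix.unitaryGroup n ℂ : Submonoid (Matrix n n ℂ)) : Set (Matrix n n ℂ)) ⊆
      Set.pi Set.univ fun _ : n => Set.pi Set.univ fun _ : n => Metric.closedBall (0 : ℂ) 1 := by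
    intro U hU i _ j _
    simpa using entry_norm_bound_of_unitary hU i j
  have hcomp : IsCompact
      (Set.pi Set.univ fun _ : n => Set.pi Set.univ fun _ : n => Metric.closedBall (0 : ℂ) 1) :=
    isCompact_univ_pi fun _ => isCompact_univ_pi fun _ => isCompact_closedBall _ _
  have hclosed : IsClosed
      ((Matrix.unitaryGroup n ℂ : Submonoid (Matrix n n ℂ)) : Set (Matrix n n ℂ)) := by
    have : ((Matrix.unitaryGroup n ℂ : Submonoid (Matrix n n ℂ)) : Set (Matrix n n ℂ)) =
        {U : Matrix n n ℂ | U * star U = 1} := by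
      ext U
      exact Matrix.mem_unitaryGroup_iff
    rw [this]
    exact isClosed_eq (continuous_id.mul continuous_star) continuous_const
  exact isCompact_iff_compactSpace.mp (hcomp.of_isClosed_subset hclosed hsub)

/-- The Haar probability measure on the unitary group (total mass one). -/
noncomputable def haarUnitary (n : Type) [Fintype n] [DecidableEq n] :
    Measure (Matrix.unitaryGroup n ℂ) :=
  Measure.haarMeasure (⊤ : TopologicalSpace.PositiveCompacts (Matrix.unitaryGroup n ℂ))

/-- A probability measure on the unitary group is a unitary `t`-design if all its moments of
degree `t` in the entries of `U` and degree `t` in the entries of `U†` are those of Haar measure.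
These moments are the matrix entries of the `t`-fold twirling channel
`X ↦ ∫ (U†)^{⊗t} X U^{⊗t}`. -/
def IsUnitaryDesign (t : ℕ) (ν : Measure (Matrix.unitaryGroup n ℂ)) : Prop :=
  IsProbabilityMeasure ν ∧
    ∀ i j k l : Fin t → n,
      ∫ U, (∏ a, (U : Matrix n n ℂ) (i a) (j a)) *
          (∏ a, star ((U : Matrix n n ℂ) (k a) (l a))) ∂ν =
        ∫ U, (∏ a, (U : Matrix n n ℂ) (i a) (j a)) *
          (∏ a, star ((U : Matrix n n ℂ) (k a) (l a))) ∂(haarUnitary n)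

end Haar

/-- The unitaries acting on the qubits of `s`. -/
abbrev LocalUnitary {N : ℕ} (s : Finset (Fin N)) : Type :=
  Matrix.unitaryGroup (Bits s) ℂ

open Classical in
/-- The operator `A ⊗ I` on all `N` qubits, for an operator `A` on the qubits of `s`. -/
noncomputable def embed {N : ℕ} (s : Finset (Fin N)) (A : Matrix (Bits s) (Bits s) ℂ) : Op N :=
  Matrix.of fun x y =>
    if ∀ q, q ∉ s → x q = y q then A (fun q => x q) (fun q => y q) else 0

/-! ### Geometry of a circuit: `m` blocks, the block `k` acting on the qubits `s k`,
blocks with a smaller index acting earlier -/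

section Geometry

variable {N m : ℕ} (s : Fin m → Finset (Fin N))

/-- The connecting support `s_c(B_k, B_k')` for `k < k'`. -/
def connSupp (k k' : Fin m) : Finset (Fin N) :=
  (s k ∩ s k') \ (Finset.univ.filter fun i => k < i ∧ i < k').biUnion s

/-- The forward residual support `s_f(B_k)`: the qubits of `B_k` on which no earlier block acts. -/
def fwdSupp (k : Fin m) : Finset (Fin N) :=
  s k \ (Finset.univ.filter fun i => i < k).biUnion s

/-- The backward residual support `s_b(B_k)`: the qubits of `B_k` on which no later block acts. -/
def bwdSupp (k : Fin m) : Finset (Fin N) :=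
  s k \ (Finset.univ.filter fun i => k < i).biUnion s

/-- The blocks in the causal cone of an observable with support `S`: a block is in the cone if it
acts on a qubit of `S`, or shares a qubit with a later block of the cone. -/
inductive InCausalCone (S : Finset (Fin N)) : Fin m → Prop
  | base (k : Fin m) : (s k ∩ S).Nonempty → InCausalCone S k
  | step (k k' : Fin m) : k < k' → (s k ∩ s k').Nonempty → InCausalCone S k' → InCausalCone S k

/-- A path: a nonempty time-ordered sequence of blocks in which adjacent blocks are connected,
and which traverses the whole circuit. -/
structure CircuitPath where
  /-- the blocks, the earliest first -/
  nodes : List (Fin m)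
  ne_nil : nodes ≠ []
  chain : nodes.IsChain fun k k' => k < k' ∧ (connSupp s k k').Nonempty
  head_fwd : (fwdSupp s (nodes.head ne_nil)).Nonempty
  tail_bwd : (bwdSupp s (nodes.getLast ne_nil)).Nonempty

variable {s}

/-- The first block of a path. -/
def CircuitPath.head (p : CircuitPath s) : Fin m := p.nodes.head p.ne_nil

/-- The edges of a path; an edge `(none, k)` joins the initial state `ρ₀` to the head `B_k`, an
edge `(some k, k')` joins the adjacent blocks `B_k`, `B_k'`. -/
def CircuitPath.edges (p : CircuitPath s) : Finset (Option (Fin m) × Fin m) :=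
  insert (none, p.head) ((p.nodes.zip p.nodes.tail).map fun e => (some e.1, e.2)).toFinset

/-- The backward residual support of a path. -/
def CircuitPath.bwd (p : CircuitPath s) : Finset (Fin N) :=
  p.nodes.toFinset.biUnion (bwdSupp s)

variable (s) in
/-- The length of an edge. -/
noncomputable def edgeLength : Option (Fin m) × Fin m → ℝ
  | (none, k) => Real.logb 4 (((4 : ℝ) ^ (s k).card - 1) / ((4 : ℝ) ^ (fwdSupp s k).card - 1))
  | (some k, k') =>
      Real.logb 4 (((4 : ℝ) ^ (s k').card - 1) / ((4 : ℝ) ^ (connSupp s k k').card - 1))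

variable (s) in
/-- The forward width of a block. -/
noncomputable def fwdWidth (k : Fin m) : ℝ :=
  Real.logb 2 (((4 : ℝ) ^ (fwdSupp s k).card - 1) / ((2 : ℝ) ^ (fwdSupp s k).card - 1))

variable (s) in
/-- A path set is a collection of paths. -/
abbrev PathSet : Type := Finset (CircuitPath s)

/-- The length of a path set: the total length of its edges, each edge counted once. -/
noncomputable def PathSet.length (P : PathSet s) : ℝ :=
  ∑ e ∈ P.biUnion CircuitPath.edges, edgeLength s e

/-- The head width of a path set: the total forward width of its head blocks, each head block
counted once. -/
noncomputable def PathSet.headWidth (P : PathSet s) : ℝ :=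
  ∑ k ∈ P.image CircuitPath.head, fwdWidth s k

/-- `P` goes through the block `k` and covers the observable support `S`: the backward residual
support of `P` contains `S`, and some path of `P` contains the block `k` and connects it to the
observable, i.e. `k`, or a later block of that path, acts last on a qubit of `S`. -/
def PathSet.GoesThroughAndCovers (P : PathSet s) (k : Fin m) (S : Finset (Fin N)) : Prop :=
  (∃ p ∈ P, k ∈ p.nodes ∧ ∃ k' ∈ p.nodes, k ≤ k' ∧ (bwdSupp s k' ∩ S).Nonempty) ∧
    S ⊆ P.biUnion CircuitPath.bwd

open Classical in
variable (s) in
/-- The indices of those Pauli strings whose causal cone contains the block `k`. -/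
noncomputable def coneTerms {J : Type} [Fintype J] (h : J → PauliString N) (k : Fin m) :
    Finset J :=
  Finset.univ.filter fun j => InCausalCone s (h j).supp k

end Geometry

/-! ### Parametrized circuits -/

/-- A parametrized circuit on `N` qubits with `M` real parameters, composed of `m` blocks: the
block `k` is a parameter-dependent unitary acting on the qubits of `s k`. -/
structure Circuit (N m M : ℕ) where
  s : Fin m → Finset (Fin N)
  block : (k : Fin m) → (Fin M → ℝ) → LocalUnitary (s k)

namespace Circuit

variable {N m M : ℕ} (c : Circuit N m M)

/-- The support of the circuit. -/
def supp : Finset (Fin N) := Finset.univ.biUnion c.s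

/-- The circuit unitary, the block of index zero acting first (rightmost). -/
noncomputable def unitary (θ : Fin M → ℝ) : Op N :=
  ((List.finRange m).reverse.map fun k => embed (c.s k) (c.block k θ).1).prod

/-- The cost `C(θ) = tr(ρ₀ U(θ)† H U(θ))`, where `ρ₀ = |0⟩⟨0|`; it is a real number for
Hermitian `H`. -/
noncomputable def cost (H : Op N) (θ : Fin M → ℝ) : ℝ :=
  (Matrix.trace (Matrix.single 0 0 1 * (c.unitary θ).conjTranspose * H * c.unitary θ)).re

/-- The partial derivative of the cost with respect to the parameter `μ`. -/
noncomputable def costDeriv (H : Op N) (μ : Fin M) (θ : Fin M → ℝ) : ℝ :=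
  deriv (fun t : ℝ => c.cost H (Function.update θ μ t)) (θ μ)

end Circuit

/-- The rotation gate `exp(-i t Ω)` generated by a Pauli string. -/
noncomputable def rotation {N : ℕ} (Ω : PauliString N) (t : ℝ) : Op N :=
  NormedSpace.exp ((-(Complex.I * (t : ℂ))) • Ω.toOp)

/-- A function of the parameters that does not depend on the parameter `μ`. -/
def IndepOfParam {M : ℕ} {α : Type} (μ : Fin M) (f : (Fin M → ℝ) → α) : Prop :=
  ∀ θ t, f (Function.update θ μ t) = f θ

/-- The circuit `c`, with random parameters of law `π`, is composed of blocks forming independent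
local `2`-designs, and its block `kμ` is `R · exp(-i θ_μ Ω) · L` where the gate with the parameter
`θ_μ` is sandwiched by two independent `2`-designs `L` (acting before it) and `R` (acting after it)
on the support of the block; `Ω` is a non-identity Pauli string supported there, and the parameter
`θ_μ` occurs in no other gate and is independent of the random unitaries. -/
structure IsDesignCircuit {N m M : ℕ} (c : Circuit N m M) (π : Measure (Fin M → ℝ))
    (μ : Fin M) (kμ : Fin m) (Ω : PauliString N)
    (L R : (Fin M → ℝ) → LocalUnitary (c.s kμ)) : Prop where
  generator_nontrivial : Ω.supp.Nonempty
  generator_supp : Ω.supp ⊆ c.s kμ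
  block_eq : ∀ θ, embed (c.s kμ) (c.block kμ θ).1 =
    embed (c.s kμ) (R θ).1 * rotation Ω (θ μ) * embed (c.s kμ) (L θ).1
  block_param : ∀ k, k ≠ kμ → IndepOfParam μ (c.block k)
  left_param : IndepOfParam μ L
  right_param : IndepOfParam μ R
  block_measurable : ∀ k, k ≠ kμ → Measurable (c.block k)
  left_measurable : Measurable L
  right_measurable : Measurable R
  block_design : ∀ k, k ≠ kμ → IsUnitaryDesign 2 (π.map (c.block k))
  left_design : IsUnitaryDesign 2 (π.map L)
  right_design : IsUnitaryDesign 2 (π.map R)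
  /-- The blocks other than `kμ`, the two sub-blocks `L`, `R` and the parameter `θ_μ` are mutually
  independent. -/
  indep : iIndep (Sum.elim
    (fun k : {k : Fin m // k ≠ kμ} => MeasurableSpace.comap (c.block k) inferInstance)
    ![MeasurableSpace.comap L inferInstance, MeasurableSpace.comap R inferInstance,
      MeasurableSpace.comap (fun θ : Fin M → ℝ => θ μ) inferInstance]) π

end PathBound

namespace PathBound

/-! ### Pauli algebra -/

namespace Pauli

/-! Work in the Heisenberg picture, in Pauli coordinates. Conjugation by a unitary `E` acts on Pauli
strings through the real matrix `transfer E`. The derivative of the cost is `∑ j, λ_j V_m(h_j)`: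
here `V_0` lists the expectations of all strings in the initial state, each block multiplies by its
transfer matrix, and inside the block `kμ` the rotation is replaced by its derivative
(`IsDesignCircuit.costDeriv_eq`).

Only second moments are needed. In mean square, a 2-design on `s` spreads a string that is
nontrivial on `s` uniformly over the `4^|s| - 1` strings that agree with it outside `s` and are
nontrivial on `s`. It also decorrelates rows whose labels differ on `s`
(`integral_transfer_mul_of_nontrivial`, `integral_transfer_mul_of_left_ne`). Hence every `V_m(h_j)`
has mean zero, distinct `h_j` are uncorrelated, and the variance is `∑ j, λ_j² E[V_m(h_j)²]`
(`IsDesignCircuit.variance_eq`). The numbers `E[V_n(σ)²]` satisfy a recursion over the blocks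
(`IsDesignCircuit.sq_succ_of_nontrivial`). The differentiated block gains a factor of at least 2: a
row of the derivative has squared norm 4 on strings anticommuting with `Ω`, and `4^|s| / 2` of the
`4^|s| - 1` available strings do so (`sandwich_sq_ge`).

Unrolled, the recursion is a sum of nonnegative weights over histories of strings, from `h_j` back
to the initial state, so any family of histories gives a lower bound. Keep the histories that follow
the path set: nontrivial on each of its edges into an active block, trivial on all other edges, and
using only `I` and `Z` where they meet the initial state. The edges into a block have disjoint
supports, so the choices on them are independent and are counted by a product
(`prod_edgeCount_le_card`, `prod_blockWeight_le`).

Length and head width are logarithms of the same counts, with two losses: they charge the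
denominator `4^|s| - 1` once per incoming edge instead of once per block, and they also charge edges
into inactive blocks. Both losses only weaken the bound (`rpow_le_prod_blockWeight`). -/

instance : DecidableEq Pauli := fun a b => by
  cases a <;> cases b <;> first | exact isTrue rfl | exact isFalse nofun

instance : Fintype Pauli where
  elems := {.I, .X, .Y, .Z}
  complete := by intro x; cases x <;> decide

theorem univ_eq : (Finset.univ : Finset Pauli) = {.I, .X, .Y, .Z} := rfl

theorem card_eq : Fintype.card Pauli = 4 := rfl

/-- The commutation sign of two Pauli matrices. -/
def sgn (a b : Pauli) : ℤ :=
  if a = .I ∨ b = .I ∨ a = b then 1 else -1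

/-- The label of the product of two Pauli matrices. -/
def mul : Pauli → Pauli → Pauli
  | .I, b => b
  | a, .I => a
  | .X, .X => .I
  | .X, .Y => .Z
  | .X, .Z => .Y
  | .Y, .X => .Z
  | .Y, .Y => .I
  | .Y, .Z => .X
  | .Z, .X => .Y
  | .Z, .Y => .X
  | .Z, .Z => .I

/-- The scalar in the product of two Pauli matrices. -/
noncomputable def phase : Pauli → Pauli → ℂ
  | .X, .Y => Complex.I
  | .Y, .X => -Complex.I
  | .Y, .Z => Complex.I
  | .Z, .Y => -Complex.I
  | .Z, .X => Complex.I
  | .X, .Z => -Complex.I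
  | _, _ => 1

theorem toMatrix_mul (a b : Pauli) :
    a.toMatrix * b.toMatrix = phase a b • (mul a b).toMatrix := by
  cases a <;> cases b <;> ext i j <;> fin_cases i <;> fin_cases j <;>
    simp [toMatrix, phase, mul, Matrix.mul_apply, Fin.sum_univ_two]

theorem phase_comm (a b : Pauli) : phase a b = (sgn a b : ℂ) * phase b a := by
  cases a <;> cases b <;> simp [phase, sgn]

theorem phase_mul_star (a b : Pauli) : phase a b * star (phase a b) = 1 := by
  cases a <;> cases b <;> simp [phase]

theorem mul_comm' (a b : Pauli) : mul a b = mul b a := by cases a <;> cases b <;> rfl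

theorem mul_mul_self (a b : Pauli) : mul (mul a b) b = a := by cases a <;> cases b <;> rfl

theorem mul_I (a : Pauli) : mul a .I = a := by cases a <;> rfl

theorem mul_self (a : Pauli) : mul a a = .I := by cases a <;> rfl

theorem phase_self (a : Pauli) : phase a a = 1 := by cases a <;> rfl

theorem sgn_self (a : Pauli) : sgn a a = 1 := by cases a <;> rfl

theorem sgn_I_left (a : Pauli) : sgn .I a = 1 := by cases a <;> rfl

theorem sgn_I_right (a : Pauli) : sgn a .I = 1 := by cases a <;> rfl

theorem sgn_mul_left (a b c : Pauli) : sgn (mul a b) c = sgn a c * sgn b c := by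
  cases a <;> cases b <;> cases c <;> rfl

theorem sgn_comm (a b : Pauli) : sgn a b = sgn b a := by cases a <;> cases b <;> rfl

/-- Characters separate labels. Translating a Haar integral by this `p` flips the sign of the
integrand, which makes mixed moments vanish. -/
theorem exists_sgn_ne {a b : Pauli} (h : a ≠ b) : ∃ p, sgn p a * sgn p b = -1 := by
  revert a b; decide

/-- For distinct labels this is the third Pauli matrix; for equal ones either of the other two. -/
theorem exists_sgn_neg_neg {a b : Pauli} (ha : a ≠ .I) (hb : b ≠ .I) :
    ∃ p, sgn p a = -1 ∧ sgn p b = -1 := by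
  revert a b; decide

theorem conjTranspose_toMatrix (a : Pauli) : a.toMatrix.conjTranspose = a.toMatrix := by
  cases a <;> ext i j <;> fin_cases i <;> fin_cases j <;> simp [toMatrix]

theorem trace_toMatrix (a : Pauli) : a.toMatrix.trace = if a = .I then 2 else 0 := by
  cases a <;> simp [toMatrix, Matrix.trace_fin_two]

/-- Completeness of the Pauli basis: the sum of `σ ⊗ σ` is twice the swap. -/
theorem sum_toMatrix_mul_toMatrix (a b c d : Fin 2) :
    ∑ p : Pauli, p.toMatrix a b * p.toMatrix c d = if a = d ∧ b = c then 2 else 0 := by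
  rw [univ_eq]
  fin_cases a <;> fin_cases b <;> fin_cases c <;> fin_cases d <;>
    simp [toMatrix] <;> norm_num

end Pauli

namespace PauliString

variable {N : ℕ}

/-- The commutation sign of two Pauli strings. -/
def csign (σ τ : PauliString N) : ℤ := ∏ q, (σ q).sgn (τ q)

/-- The label of the product of two Pauli strings. -/
def mul (σ τ : PauliString N) : PauliString N := fun q => (σ q).mul (τ q)

/-- The scalar in the product of two Pauli strings. -/
noncomputable def phase (σ τ : PauliString N) : ℂ := ∏ q, (σ q).phase (τ q)

theorem toOp_apply (σ : PauliString N) (x y : Bits (Fin N)) :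
    σ.toOp x y = ∏ q, (σ q).toMatrix (x q) (y q) := rfl

theorem toOp_mul (σ τ : PauliString N) : σ.toOp * τ.toOp = phase σ τ • (mul σ τ).toOp := by
  ext x y
  simp only [Matrix.mul_apply, toOp_apply, Matrix.smul_apply, smul_eq_mul, phase, mul,
    ← Finset.prod_mul_distrib]
  rw [← Fintype.piFinset_univ, Finset.sum_prod_piFinset Finset.univ
    (fun q j => (σ q).toMatrix (x q) j * (τ q).toMatrix j (y q))]
  refine Finset.prod_congr rfl fun q _ => ?_
  have := congrFun (congrFun (Pauli.toMatrix_mul (σ q) (τ q)) (x q)) (y q)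
  simpa [Matrix.mul_apply] using this

theorem mul_comm' (σ τ : PauliString N) : mul σ τ = mul τ σ :=
  funext fun _ => Pauli.mul_comm' _ _

theorem mul_mul_self (σ τ : PauliString N) : mul (mul σ τ) τ = σ :=
  funext fun _ => Pauli.mul_mul_self _ _

theorem phase_mul_star (σ τ : PauliString N) : phase σ τ * star (phase σ τ) = 1 := by
  simp only [phase, star_prod, ← Finset.prod_mul_distrib, Pauli.phase_mul_star,
    Finset.prod_const_one]

theorem phase_comm (σ τ : PauliString N) : phase σ τ = (csign σ τ : ℂ) * phase τ σ := by
  simp only [phase, csign, Int.cast_prod, ← Finset.prod_mul_distrib]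
  exact Finset.prod_congr rfl fun q _ => Pauli.phase_comm _ _

theorem toOp_mul_comm (σ τ : PauliString N) :
    σ.toOp * τ.toOp = (csign σ τ : ℂ) • (τ.toOp * σ.toOp) := by
  rw [toOp_mul, toOp_mul, phase_comm, mul_comm', mul_smul]

theorem csign_comm (σ τ : PauliString N) : csign σ τ = csign τ σ :=
  Finset.prod_congr rfl fun _ _ => Pauli.sgn_comm _ _

theorem csign_mul_left (σ τ ρ : PauliString N) :
    csign (mul σ τ) ρ = csign σ ρ * csign τ ρ := by
  simp only [csign, mul, Pauli.sgn_mul_left, Finset.prod_mul_distrib]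

theorem csign_self (σ : PauliString N) : csign σ σ = 1 := by
  simp [csign, Pauli.sgn_self]

theorem csign_eq_one_or (σ τ : PauliString N) : csign σ τ = 1 ∨ csign σ τ = -1 := by
  refine Finset.prod_induction _ (fun z : ℤ => z = 1 ∨ z = -1) ?_ (Or.inl rfl) ?_
  · rintro a b (rfl | rfl) (rfl | rfl) <;> simp
  · intro q _
    unfold Pauli.sgn
    split_ifs <;> simp

theorem toOp_one : toOp (fun _ => Pauli.I : PauliString N) = 1 := by
  ext x y
  simp only [toOp_apply, Pauli.toMatrix, Matrix.one_apply]
  by_cases hxy : x = y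
  · simp [hxy]
  · obtain ⟨q, hq⟩ := Function.ne_iff.1 hxy
    rw [if_neg hxy]
    exact Finset.prod_eq_zero (Finset.mem_univ q) (by simp [hq])

theorem toOp_mul_self (σ : PauliString N) : σ.toOp * σ.toOp = 1 := by
  rw [toOp_mul]
  have h1 : phase σ σ = 1 := by simp [phase, Pauli.phase_self]
  have h2 : mul σ σ = fun _ => Pauli.I := funext fun _ => Pauli.mul_self _
  rw [h1, h2, one_smul, toOp_one]

theorem conjTranspose_toOp (σ : PauliString N) : σ.toOp.conjTranspose = σ.toOp := by
  ext x y
  simp only [Matrix.conjTranspose_apply, toOp_apply, star_prod]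
  refine Finset.prod_congr rfl fun q _ => ?_
  exact congrFun (congrFun (Pauli.conjTranspose_toMatrix (σ q)) (x q)) (y q)

theorem trace_toOp (σ : PauliString N) :
    σ.toOp.trace = if σ = (fun _ => Pauli.I) then (2 : ℂ) ^ N else 0 := by
  have : σ.toOp.trace = ∏ q, (σ q).toMatrix.trace := by
    simp only [Matrix.trace, Matrix.diag, toOp_apply]
    rw [← Fintype.piFinset_univ, Finset.sum_prod_piFinset Finset.univ
      (fun q j => (σ q).toMatrix j j)]
  rw [this]
  simp only [Pauli.trace_toMatrix]
  split_ifs with h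
  · simp [h]
  · obtain ⟨q, hq⟩ := Function.ne_iff.1 h
    exact Finset.prod_eq_zero (Finset.mem_univ q) (by simp [hq])

theorem mul_eq_I_iff {σ τ : PauliString N} : mul σ τ = (fun _ => Pauli.I) ↔ σ = τ := by
  constructor
  · intro h
    have := mul_mul_self σ τ
    rw [h] at this
    rw [← this]
    funext q
    simp [mul, Pauli.mul]
  · rintro rfl
    exact funext fun _ => Pauli.mul_self _

theorem trace_toOp_mul (σ τ : PauliString N) :
    (σ.toOp * τ.toOp).trace = if σ = τ then (2 : ℂ) ^ N else 0 := by
  rw [toOp_mul, Matrix.trace_smul, trace_toOp]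
  simp only [mul_eq_I_iff]
  split_ifs with h
  · subst h
    simp [phase, Pauli.phase_self]
  · simp

theorem sum_toOp_mul_toOp (a b c d : Bits (Fin N)) :
    ∑ σ : PauliString N, σ.toOp a b * σ.toOp c d = if a = d ∧ b = c then (2 : ℂ) ^ N else 0 := by
  simp only [toOp_apply, ← Finset.prod_mul_distrib]
  rw [← Fintype.piFinset_univ, Finset.sum_prod_piFinset Finset.univ
    (fun q (p : Pauli) => p.toMatrix (a q) (b q) * p.toMatrix (c q) (d q))]
  simp only [Pauli.sum_toMatrix_mul_toMatrix]
  split_ifs with h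
  · obtain ⟨rfl, rfl⟩ := h
    simp
  · rw [not_and_or] at h
    rcases h with h | h <;> obtain ⟨q, hq⟩ := Function.ne_iff.1 h <;>
      exact Finset.prod_eq_zero (Finset.mem_univ q) (by simp [hq])

end PauliString

/-! ### Pauli coefficients and Pauli transfer matrices -/

variable {N : ℕ}

/-- The coefficient of an operator along a Pauli string. -/
noncomputable def coeff (A : Op N) (τ : PauliString N) : ℂ :=
  ((2 : ℂ) ^ N)⁻¹ * (τ.toOp * A).trace

theorem sum_coeff_smul (A : Op N) : ∑ τ, coeff A τ • τ.toOp = A := by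
  ext x y
  simp only [coeff, Matrix.sum_apply, Matrix.smul_apply, smul_eq_mul, Matrix.trace, Matrix.diag,
    Matrix.mul_apply, mul_assoc, Finset.sum_mul, Finset.mul_sum]
  have : ∀ (τ : PauliString N) (u v : Bits (Fin N)),
      ((2 : ℂ) ^ N)⁻¹ * (τ.toOp u v * (A v u * τ.toOp x y)) =
        ((2 : ℂ) ^ N)⁻¹ * A v u * (τ.toOp u v * τ.toOp x y) := by intros; ring
  simp only [this]
  rw [Finset.sum_comm]
  have h2 : ∀ u : Bits (Fin N), ∑ τ : PauliString N, ∑ v : Bits (Fin N),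
      ((2 : ℂ) ^ N)⁻¹ * A v u * (τ.toOp u v * τ.toOp x y) =
      ∑ v : Bits (Fin N), ((2 : ℂ) ^ N)⁻¹ * A v u * if u = y ∧ v = x then (2 : ℂ) ^ N else 0 := by
    intro u
    rw [Finset.sum_comm]
    refine Finset.sum_congr rfl fun v _ => ?_
    rw [← Finset.mul_sum, PauliString.sum_toOp_mul_toOp]
  simp only [h2, ite_and]
  simp [Finset.sum_ite_eq']
  field_simp

theorem coeff_toOp (σ τ : PauliString N) : coeff σ.toOp τ = if σ = τ then 1 else 0 := by
  rw [coeff, PauliString.trace_toOp_mul]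
  by_cases h : σ = τ
  · simp [h]
  · simp [h, Ne.symm h]

theorem coeff_add (A B : Op N) (τ : PauliString N) : coeff (A + B) τ = coeff A τ + coeff B τ := by
  simp [coeff, mul_add, Matrix.trace_add]

theorem coeff_smul (a : ℂ) (A : Op N) (τ : PauliString N) : coeff (a • A) τ = a * coeff A τ := by
  simp [coeff]; ring

theorem coeff_sum {ι : Type*} (S : Finset ι) (A : ι → Op N) (τ : PauliString N) :
    coeff (∑ i ∈ S, A i) τ = ∑ i ∈ S, coeff (A i) τ := by
  simp [coeff, Finset.mul_sum, Matrix.trace_sum]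

/-- A bilinear Parseval identity. The absence of a complex conjugate is harmless where it is
applied, because Hermitian operators have real Pauli coefficients. -/
theorem sum_coeff_mul_coeff (A B : Op N) :
    ∑ τ, coeff A τ * coeff B τ = ((2 : ℂ) ^ N)⁻¹ * (A * B).trace := by
  conv_rhs => rw [← sum_coeff_smul A]
  simp only [Finset.sum_mul, Matrix.trace_sum, Finset.mul_sum, Matrix.smul_mul, Matrix.trace_smul]
  refine Finset.sum_congr rfl fun τ _ => ?_
  simp only [coeff, smul_eq_mul]; ring

theorem coeff_im_of_isHermitian {A : Op N} (hA : A.conjTranspose = A) (τ : PauliString N) :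
    (((coeff A τ).re : ℝ) : ℂ) = coeff A τ := by
  rw [← Complex.conj_eq_iff_re]
  have h : (starRingEnd ℂ) (τ.toOp * A).trace = (τ.toOp * A).trace := by
    rw [starRingEnd_apply, ← Matrix.trace_conjTranspose, Matrix.conjTranspose_mul, hA,
      PauliString.conjTranspose_toOp, Matrix.trace_mul_comm]
  simp only [coeff, map_mul, h, map_inv₀, map_pow, Complex.conj_ofNat]

/-- The Pauli transfer matrix of the conjugation `σ ↦ E† σ E`. -/
noncomputable def transfer (E : Op N) : Matrix (PauliString N) (PauliString N) ℝ :=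
  Matrix.of fun σ τ => (coeff (E.conjTranspose * σ.toOp * E) τ).re

theorem ofReal_transfer (E : Op N) (σ τ : PauliString N) :
    ((transfer E σ τ : ℝ) : ℂ) = coeff (E.conjTranspose * σ.toOp * E) τ := by
  refine coeff_im_of_isHermitian ?_ τ
  simp [Matrix.conjTranspose_mul, PauliString.conjTranspose_toOp, Matrix.mul_assoc]

theorem sum_transfer_smul (E : Op N) (σ : PauliString N) :
    ∑ τ, ((transfer E σ τ : ℝ) : ℂ) • τ.toOp = E.conjTranspose * σ.toOp * E := by
  simp only [ofReal_transfer, sum_coeff_smul]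

/-- Conjugating by `E * F` conjugates by `E` first, and the result is expanded in strings before
conjugating by `F`. The order of factors is kept, so a later block multiplies a vector of components
from the left. -/
theorem transfer_mul (E F : Op N) : transfer (E * F) = transfer E * transfer F := by
  ext σ τ
  apply Complex.ofReal_injective
  rw [ofReal_transfer, Matrix.mul_apply]
  push_cast
  have : (E * F).conjTranspose * σ.toOp * (E * F) =
      F.conjTranspose * (E.conjTranspose * σ.toOp * E) * F := by
    simp only [Matrix.conjTranspose_mul, Matrix.mul_assoc]
  rw [this, ← sum_transfer_smul, Finset.mul_sum, Finset.sum_mul, coeff_sum]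
  refine Finset.sum_congr rfl fun ρ _ => ?_
  rw [ofReal_transfer F, Matrix.mul_smul, Matrix.smul_mul, coeff_smul]

theorem transfer_one : transfer (1 : Op N) = 1 := by
  ext σ τ
  apply Complex.ofReal_injective
  rw [ofReal_transfer]
  simp [coeff_toOp, Matrix.one_apply]
  split_ifs <;> simp

/-- The conjugated string still squares to the identity, so Parseval makes each row a unit vector.
This normalises the Haar moments and bounds the entries. -/
theorem transfer_sq_sum {E : Op N} (hE : E * E.conjTranspose = 1) (σ : PauliString N) :
    ∑ τ, transfer E σ τ ^ 2 = 1 := by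
  apply Complex.ofReal_injective
  push_cast
  simp only [sq, ofReal_transfer, sum_coeff_mul_coeff]
  have : E.conjTranspose * σ.toOp * E * (E.conjTranspose * σ.toOp * E) =
      E.conjTranspose * E := by
    calc _ = E.conjTranspose * σ.toOp * (E * E.conjTranspose) * σ.toOp * E := by
          simp only [Matrix.mul_assoc]
      _ = E.conjTranspose * (σ.toOp * σ.toOp) * E := by
          rw [hE]; simp only [Matrix.mul_assoc, Matrix.one_mul]
      _ = _ := by rw [PauliString.toOp_mul_self, Matrix.mul_one]
  rw [this, Matrix.trace_mul_comm, hE, ← PauliString.toOp_one, PauliString.trace_toOp, if_pos rfl]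
  simp

theorem abs_transfer_le_one {E : Op N} (hE : E * E.conjTranspose = 1) (σ τ : PauliString N) :
    |transfer E σ τ| ≤ 1 := by
  rw [← sq_le_one_iff_abs_le_one, ← transfer_sq_sum hE σ]
  exact Finset.single_le_sum (f := fun τ => transfer E σ τ ^ 2) (fun _ _ => sq_nonneg _)
    (Finset.mem_univ τ)

/-! ### Local operators -/

section Embed

variable {N : ℕ} (s : Finset (Fin N))

/-- The splitting of the computational basis along a set of qubits. -/
def splitBits : Bits (Fin N) ≃ Bits s × ({q // q ∉ s} → Fin 2) :=
  Equiv.piEquivPiSubtypeProd (fun q => q ∈ s) fun _ => Fin 2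

open scoped Kronecker in
theorem embed_eq_kronecker (A : Matrix (Bits s) (Bits s) ℂ) :
    embed s A = (A ⊗ₖ (1 : Matrix ({q // q ∉ s} → Fin 2) ({q // q ∉ s} → Fin 2) ℂ)).submatrix
      (splitBits s) (splitBits s) := by
  ext x y
  simp only [embed, Matrix.of_apply, Matrix.submatrix_apply, Matrix.kroneckerMap_apply,
    Matrix.one_apply, splitBits, Equiv.piEquivPiSubtypeProd_apply, funext_iff, Subtype.forall,
    mul_ite, mul_one, mul_zero]

theorem embed_mul (A B : Matrix (Bits s) (Bits s) ℂ) :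
    embed s (A * B) = embed s A * embed s B := by
  simp only [embed_eq_kronecker, Matrix.submatrix_mul_equiv, ← Matrix.mul_kronecker_mul,
    Matrix.mul_one]

theorem embed_one : embed s (1 : Matrix (Bits s) (Bits s) ℂ) = 1 := by
  simp [embed_eq_kronecker]

theorem embed_conjTranspose (A : Matrix (Bits s) (Bits s) ℂ) :
    embed s A.conjTranspose = (embed s A).conjTranspose := by
  simp [embed_eq_kronecker, Matrix.conjTranspose_submatrix, Matrix.conjTranspose_kronecker]

theorem embed_add (A B : Matrix (Bits s) (Bits s) ℂ) :
    embed s (A + B) = embed s A + embed s B := by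
  simp only [embed_eq_kronecker, Matrix.add_kronecker, Matrix.submatrix_add, Pi.add_apply]

theorem embed_smul (a : ℂ) (A : Matrix (Bits s) (Bits s) ℂ) :
    embed s (a • A) = a • embed s A := by
  simp only [embed_eq_kronecker, Matrix.smul_kronecker, Matrix.submatrix_smul, Pi.smul_apply]

theorem embed_injective :
    Function.Injective (embed s : Matrix (Bits s) (Bits s) ℂ → Op N) := by
  intro A B h
  ext x y
  have := congrFun (congrFun h ((splitBits s).symm (x, 0))) ((splitBits s).symm (y, 0))
  simpa [embed_eq_kronecker] using this

/-- A tensor product of Pauli matrices on an arbitrary set of qubits. -/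
noncomputable def localPauli {Q : Type} [Fintype Q] (σ : Q → Pauli) : Matrix (Bits Q) (Bits Q) ℂ :=
  Matrix.of fun x y => ∏ q, (σ q).toMatrix (x q) (y q)

theorem localPauli_I {Q : Type} [Fintype Q] [DecidableEq Q] {σ : Q → Pauli}
    (h : ∀ q, σ q = Pauli.I) : localPauli σ = 1 := by
  ext x y
  simp only [localPauli, Matrix.of_apply, h, Pauli.toMatrix, Matrix.one_apply]
  by_cases hxy : x = y
  · simp [hxy]
  · obtain ⟨q, hq⟩ := Function.ne_iff.1 hxy
    rw [if_neg hxy]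
    exact Finset.prod_eq_zero (Finset.mem_univ q) (by simp [hq])

open scoped Kronecker in
theorem toOp_eq_kronecker (σ : PauliString N) :
    σ.toOp = (localPauli (fun q : s => σ q) ⊗ₖ
      localPauli (fun q : {q // q ∉ s} => σ q)).submatrix (splitBits s) (splitBits s) := by
  ext x y
  simp only [PauliString.toOp_apply, Matrix.submatrix_apply, Matrix.kroneckerMap_apply,
    localPauli, Matrix.of_apply, splitBits, Equiv.piEquivPiSubtypeProd_apply]
  convert! (Fintype.prod_subtype_mul_prod_subtype (fun q => q ∈ s)
    (fun q => (σ q).toMatrix (x q) (y q))).symm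

variable {s}

theorem exists_embed_eq_toOp {ω : PauliString N} (hω : ∀ q ∉ s, ω q = Pauli.I) :
    ∃ a, embed s a = ω.toOp := by
  refine ⟨localPauli fun q : s => ω q, ?_⟩
  rw [embed_eq_kronecker, toOp_eq_kronecker s ω, localPauli_I (σ := fun q : {q // q ∉ s} => ω q)]
  exact fun q => hω q q.2

theorem toOp_mul_embed_comm {τ : PauliString N} (hτ : ∀ q ∈ s, τ q = Pauli.I)
    (A : Matrix (Bits s) (Bits s) ℂ) : τ.toOp * embed s A = embed s A * τ.toOp := by
  rw [embed_eq_kronecker, toOp_eq_kronecker s τ, localPauli_I (σ := fun q : s => τ q)]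
  · simp only [Matrix.submatrix_mul_equiv, ← Matrix.mul_kronecker_mul, Matrix.mul_one,
      Matrix.one_mul]
  · exact fun q => hτ q q.2

/-- A unitary of the form `A ⊗ I` comes from a local unitary. -/
theorem exists_localUnitary {a : Matrix (Bits s) (Bits s) ℂ}
    (h : embed s a * (embed s a).conjTranspose = 1) :
    ∃ v : LocalUnitary s, embed s v.1 = embed s a := by
  refine ⟨⟨a, Matrix.mem_unitaryGroup_iff.2 (embed_injective s ?_)⟩, rfl⟩
  rw [embed_mul, Matrix.star_eq_conjTranspose, embed_conjTranspose, h, embed_one]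

theorem embed_mul_conjTranspose (u : LocalUnitary s) :
    embed s u.1 * (embed s u.1).conjTranspose = 1 := by
  rw [← embed_conjTranspose, ← embed_mul, ← Matrix.star_eq_conjTranspose,
    Matrix.mem_unitaryGroup_iff.1 u.2, embed_one]

theorem conjTranspose_mul_embed (u : LocalUnitary s) :
    (embed s u.1).conjTranspose * embed s u.1 = 1 := by
  rw [← embed_conjTranspose, ← embed_mul, ← Matrix.star_eq_conjTranspose,
    Matrix.mem_unitaryGroup_iff'.1 u.2, embed_one]

theorem continuous_embed : Continuous fun u : LocalUnitary s => embed s u.1 := by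
  refine continuous_matrix fun x y => ?_
  simp only [embed, Matrix.of_apply]
  split_ifs
  · exact continuous_subtype_val.matrix_elem _ _
  · exact continuous_const

theorem continuous_transfer_embed (σ τ : PauliString N) :
    Continuous fun u : LocalUnitary s => transfer (embed s u.1) σ τ := by
  have h := continuous_embed (s := s)
  simp only [transfer, coeff, Matrix.of_apply]
  fun_prop

/-- The Pauli string with a single non-identity site. -/
def single (q : Fin N) (p : Pauli) : PauliString N := Function.update (fun _ => Pauli.I) q p

theorem csign_single (q : Fin N) (p : Pauli) (σ : PauliString N) :
    PauliString.csign (single q p) σ = p.sgn (σ q) := by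
  rw [PauliString.csign, Finset.prod_eq_single q]
  · simp [single]
  · intro r _ hr
    simp [single, hr, Pauli.sgn_I_left]
  · simp

theorem single_of_ne {q r : Fin N} (h : r ≠ q) (p : Pauli) : single q p r = Pauli.I := by
  simp [single, h]

/-- Conjugation by a Pauli string multiplies a string by the commutation sign. -/
theorem toOp_conj (ω σ : PauliString N) :
    ω.toOp * σ.toOp * ω.toOp = (PauliString.csign ω σ : ℂ) • σ.toOp := by
  rw [PauliString.toOp_mul_comm, Matrix.smul_mul, Matrix.mul_assoc, PauliString.toOp_mul_self,
    Matrix.mul_one]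

/-- Left multiplication by a Pauli string in a transfer matrix. -/
theorem transfer_toOp_mul (ω : PauliString N) (E : Op N) (σ τ : PauliString N) :
    transfer (ω.toOp * E) σ τ = PauliString.csign ω σ * transfer E σ τ := by
  apply Complex.ofReal_injective
  push_cast
  rw [ofReal_transfer, ofReal_transfer, Matrix.conjTranspose_mul, PauliString.conjTranspose_toOp]
  have : E.conjTranspose * ω.toOp * σ.toOp * (ω.toOp * E) =
      E.conjTranspose * (ω.toOp * σ.toOp * ω.toOp) * E := by simp only [Matrix.mul_assoc]
  rw [this, toOp_conj, Matrix.mul_smul, Matrix.smul_mul, coeff_smul]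

/-- Right multiplication by a Pauli string in a transfer matrix. -/
theorem transfer_mul_toOp (ω : PauliString N) (E : Op N) (σ τ : PauliString N) :
    transfer (E * ω.toOp) σ τ = PauliString.csign ω τ * transfer E σ τ := by
  apply Complex.ofReal_injective
  push_cast
  rw [ofReal_transfer, ofReal_transfer, Matrix.conjTranspose_mul, PauliString.conjTranspose_toOp]
  simp only [coeff]
  have : (τ.toOp * (ω.toOp * E.conjTranspose * σ.toOp * (E * ω.toOp))).trace =
      ((ω.toOp * τ.toOp * ω.toOp) * (E.conjTranspose * σ.toOp * E)).trace := by
    rw [← Matrix.mul_assoc (ω.toOp * E.conjTranspose * σ.toOp), ← Matrix.mul_assoc τ.toOp,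
      Matrix.trace_mul_comm]
    simp only [Matrix.mul_assoc]
  rw [this, toOp_conj, Matrix.smul_mul, Matrix.trace_smul, smul_eq_mul]
  ring

/-- A local operator does not change a string outside its support. -/
theorem transfer_embed_eq_zero (u : LocalUnitary s) {σ τ : PauliString N} {q : Fin N} (hq : q ∉ s)
    (h : σ q ≠ τ q) : transfer (embed s u.1) σ τ = 0 := by
  obtain ⟨p, hp⟩ := Pauli.exists_sgn_ne h
  have hc : (single q p).toOp * embed s u.1 = embed s u.1 * (single q p).toOp :=
    toOp_mul_embed_comm (fun r hr => single_of_ne (by rintro rfl; exact hq hr) p) _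
  have h1 := transfer_toOp_mul (single q p) (embed s u.1) σ τ
  rw [hc, transfer_mul_toOp, csign_single, csign_single] at h1
  rcases Int.mul_eq_neg_one_iff_eq_one_or_neg_one.1 hp with ⟨h2, h3⟩ | ⟨h2, h3⟩ <;>
    rw [h2, h3] at h1 <;> push_cast at h1 <;> linarith

/-- A local operator does not change a string which is trivial on its support. -/
theorem transfer_embed_of_trivial (u : LocalUnitary s) {σ : PauliString N}
    (hσ : ∀ q ∈ s, σ q = Pauli.I) (τ : PauliString N) :
    transfer (embed s u.1) σ τ = if σ = τ then 1 else 0 := by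
  apply Complex.ofReal_injective
  rw [ofReal_transfer, Matrix.mul_assoc, toOp_mul_embed_comm hσ, ← Matrix.mul_assoc,
    conjTranspose_mul_embed, Matrix.one_mul, coeff_toOp]
  split_ifs <;> simp

/-- Here `τ` commutes with the local operator, which then cancels under the cyclic trace.
Consequently a string nontrivial on `s` never acquires a component trivial on `s`. -/
theorem transfer_embed_trivial_right (u : LocalUnitary s) {σ τ : PauliString N}
    (hτ : ∀ q ∈ s, τ q = Pauli.I) :
    transfer (embed s u.1) σ τ = if σ = τ then 1 else 0 := by
  apply Complex.ofReal_injective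
  have : (τ.toOp * ((embed s u.1).conjTranspose * σ.toOp * embed s u.1)).trace =
      (σ.toOp * τ.toOp).trace := by
    calc _ = ((embed s u.1).conjTranspose * σ.toOp * (embed s u.1 * τ.toOp)).trace := by
          rw [Matrix.trace_mul_comm]; simp only [Matrix.mul_assoc]
      _ = ((embed s u.1).conjTranspose * (σ.toOp * τ.toOp * embed s u.1)).trace := by
          rw [← toOp_mul_embed_comm hτ]; simp only [Matrix.mul_assoc]
      _ = _ := by
          rw [Matrix.trace_mul_comm, Matrix.mul_assoc, embed_mul_conjTranspose, Matrix.mul_one]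
  rw [ofReal_transfer, coeff, this, PauliString.trace_toOp_mul]
  split_ifs <;> simp

end Embed

/-! ### Moments of unitary designs in the Pauli basis -/

section Haar

variable {n : Type} [Fintype n] [DecidableEq n]

instance : IsProbabilityMeasure (haarUnitary n) :=
  ⟨by simpa [haarUnitary] using Measure.haarMeasure_self (K₀ := (⊤ : TopologicalSpace.PositiveCompacts
    (Matrix.unitaryGroup n ℂ)))⟩

instance : (haarUnitary n).IsHaarMeasure := by unfold haarUnitary; infer_instance

instance : (haarUnitary n).IsMulRightInvariant where
  map_mul_right_eq_self g := by
    have : IsProbabilityMeasure ((haarUnitary n).map (· * g)) :=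
      Measure.isProbabilityMeasure_map (measurable_mul_const g).aemeasurable
    exact Measure.isHaarMeasure_eq_of_isProbabilityMeasure _ _

theorem integrable_of_continuous {E : Type*} [NormedAddCommGroup E] [SecondCountableTopology E]
    (ν : Measure (Matrix.unitaryGroup n ℂ)) [IsProbabilityMeasure ν]
    {f : Matrix.unitaryGroup n ℂ → E} (hf : Continuous f) : Integrable f ν := by
  obtain ⟨C, hC⟩ := isCompact_univ.exists_bound_of_continuousOn hf.continuousOn
  exact Integrable.of_bound hf.aestronglyMeasurable C (Filter.Eventually.of_forall
    fun x => hC x (Set.mem_univ x))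

end Haar

/-! ### Reduction of design moments to Haar moments, and their evaluation. -/

section Design

variable {N : ℕ} {s : Finset (Fin N)}

open Classical in
theorem embed_apply_eq_mul (A : Matrix (Bits s) (Bits s) ℂ) (x y : Bits (Fin N)) :
    embed s A x y = (if ∀ q, q ∉ s → x q = y q then 1 else 0) *
      A (fun q => x q) (fun q => y q) := by
  simp only [embed, Matrix.of_apply]
  split_ifs <;> simp

/-- An entry of the transfer matrix is linear in the products of one entry of `E` with one
conjugated entry. A product of two such entries is then exactly what a 2-design controls. -/
theorem coeff_conj_eq_sum (E : Op N) (σ τ : PauliString N) :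
    coeff (E.conjTranspose * σ.toOp * E) τ =
      ∑ p : (Bits (Fin N) × Bits (Fin N)) × Bits (Fin N) × Bits (Fin N),
        ((2 : ℂ) ^ N)⁻¹ * τ.toOp p.1.1 p.1.2 * σ.toOp p.2.2 p.2.1 *
          (E p.2.1 p.1.1 * star (E p.2.2 p.1.2)) := by
  simp only [coeff, Matrix.trace, Matrix.diag, Matrix.mul_apply, Fintype.sum_prod_type,
    Matrix.conjTranspose_apply, Finset.mul_sum, Finset.sum_mul]
  refine Finset.sum_congr rfl fun _ _ => Finset.sum_congr rfl fun _ _ =>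
    Finset.sum_congr rfl fun _ _ => Finset.sum_congr rfl fun _ _ => ?_
  ring

theorem integral_eq_haar_of_design {n : Type} [Fintype n] [DecidableEq n]
    {ν : Measure (Matrix.unitaryGroup n ℂ)} (hν : IsUnitaryDesign 2 ν) {ι κ : Type*}
    (S : Finset ι) (S' : Finset κ) (a : ι → ℂ) (b : κ → ℂ) (i j k l : ι → n)
    (i' j' k' l' : κ → n) :
    ∫ U, (∑ p ∈ S, a p * ((U : Matrix n n ℂ) (i p) (j p) * star ((U : Matrix n n ℂ) (k p) (l p)))) *
        (∑ p ∈ S', b p *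
          ((U : Matrix n n ℂ) (i' p) (j' p) * star ((U : Matrix n n ℂ) (k' p) (l' p)))) ∂ν =
      ∫ U, (∑ p ∈ S, a p *
          ((U : Matrix n n ℂ) (i p) (j p) * star ((U : Matrix n n ℂ) (k p) (l p)))) *
        (∑ p ∈ S', b p *
          ((U : Matrix n n ℂ) (i' p) (j' p) * star ((U : Matrix n n ℂ) (k' p) (l' p))))
          ∂(haarUnitary n) := by
  have := hν.1
  have hcont : ∀ x y : n, Continuous fun U : Matrix.unitaryGroup n ℂ => (U : Matrix n n ℂ) x y :=
    fun x y => continuous_subtype_val.matrix_elem x y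
  have hmono : ∀ (c d : ℂ) (x y x' y' z w z' w' : n), Continuous
      fun U : Matrix.unitaryGroup n ℂ => c * ((U : Matrix n n ℂ) x y *
        star ((U : Matrix n n ℂ) x' y')) * (d * ((U : Matrix n n ℂ) z w *
          star ((U : Matrix n n ℂ) z' w'))) := fun c d x y x' y' z w z' w' =>
    (continuous_const.mul ((hcont x y).mul (hcont x' y').star)).mul
      (continuous_const.mul ((hcont z w).mul (hcont z' w').star))
  have key : ∀ (ρ : Measure (Matrix.unitaryGroup n ℂ)) [IsProbabilityMeasure ρ],
      ∫ U, (∑ p ∈ S, a p *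
          ((U : Matrix n n ℂ) (i p) (j p) * star ((U : Matrix n n ℂ) (k p) (l p)))) *
        (∑ p ∈ S', b p *
          ((U : Matrix n n ℂ) (i' p) (j' p) * star ((U : Matrix n n ℂ) (k' p) (l' p)))) ∂ρ =
      ∑ p ∈ S, ∑ p' ∈ S', a p * b p' *
        -- The index pairs of the two factors are packed into functions on `Fin 2`, to match the
        -- definition of a design.
        ∫ U, (∏ t, (U : Matrix n n ℂ) (![i p, i' p'] t) (![j p, j' p'] t)) *
          (∏ t, star ((U : Matrix n n ℂ) (![k p, k' p'] t) (![l p, l' p'] t))) ∂ρ := by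
    intro ρ _
    simp only [Finset.sum_mul_sum]
    rw [integral_finsetSum]
    · refine Finset.sum_congr rfl fun p _ => ?_
      rw [integral_finsetSum]
      · refine Finset.sum_congr rfl fun p' _ => ?_
        rw [← integral_const_mul]
        refine integral_congr_ae (Filter.Eventually.of_forall fun U => ?_)
        simp only [Fin.prod_univ_two, Matrix.cons_val_zero, Matrix.cons_val_one]
        ring
      · intro p' _
        apply integrable_of_continuous
        exact hmono _ _ _ _ _ _ _ _ _ _
    · intro p _
      apply integrable_of_continuous
      refine continuous_finsetSum _ fun p' _ => ?_
      exact hmono _ _ _ _ _ _ _ _ _ _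
  rw [key, key]
  refine Finset.sum_congr rfl fun p _ => Finset.sum_congr rfl fun p' _ => ?_
  rw [hν.2]

/-- The second moments of the transfer matrix of a `2`-design are those of Haar measure. -/
theorem integral_transfer_mul_transfer_eq_haar {ν : Measure (LocalUnitary s)}
    (hν : IsUnitaryDesign 2 ν) (σ τ σ' τ' : PauliString N) :
    ∫ u, transfer (embed s u.1) σ τ * transfer (embed s u.1) σ' τ' ∂ν =
      ∫ u, transfer (embed s u.1) σ τ * transfer (embed s u.1) σ' τ' ∂(haarUnitary (Bits s)) := by
  classical
  apply Complex.ofReal_injective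
  rw [← integral_complex_ofReal, ← integral_complex_ofReal]
  push_cast
  simp only [ofReal_transfer, coeff_conj_eq_sum, embed_apply_eq_mul, star_mul']
  have h : ∀ (c d e : ℂ) (x y x' y' : Bits (Fin N)) (u : LocalUnitary s),
      c * (d * u.1 (fun q => x q) (fun q => y q) * (e * star (u.1 (fun q => x' q)
        (fun q => y' q)))) = (c * d * e) * (u.1 (fun q => x q) (fun q => y q) *
          star (u.1 (fun q => x' q) (fun q => y' q))) := by intros; ring
  simp only [h]
  exact integral_eq_haar_of_design hν _ _ _ _ _ _ _ _ _ _ _ _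

variable (s) in
/-- The strings which agree with `σ` outside `s` and are nontrivial on `s`. -/
def nontrivialClass (σ : PauliString N) : Finset (PauliString N) :=
  Finset.univ.filter fun τ => (∀ q, q ∉ s → τ q = σ q) ∧ ∃ q ∈ s, τ q ≠ Pauli.I

theorem mem_nontrivialClass {σ τ : PauliString N} :
    τ ∈ nontrivialClass s σ ↔ (∀ q, q ∉ s → τ q = σ q) ∧ ∃ q ∈ s, τ q ≠ Pauli.I := by
  simp [nontrivialClass]

variable (s) in
theorem card_agree (σ : PauliString N) :
    (Finset.univ.filter fun τ : PauliString N => ∀ q, q ∉ s → τ q = σ q).card = 4 ^ s.card := by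
  have : (Finset.univ.filter fun τ : PauliString N => ∀ q, q ∉ s → τ q = σ q) =
      Fintype.piFinset fun q => if q ∈ s then Finset.univ else {σ q} := by
    ext τ
    simp only [Finset.mem_filter, Finset.mem_univ, true_and, Fintype.mem_piFinset]
    refine forall_congr' fun q => ?_
    split_ifs with h <;> simp [h]
  rw [this, Fintype.card_piFinset]
  have h2 : ∀ q, (if q ∈ s then Finset.univ else {σ q} : Finset Pauli).card =
      if q ∈ s then 4 else 1 := by
    intro q
    split_ifs <;> simp [Pauli.card_eq]
  simp [h2]

variable (s) in
theorem card_nontrivialClass (σ : PauliString N) :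
    (nontrivialClass s σ).card = 4 ^ s.card - 1 := by
  have : nontrivialClass s σ =
      (Finset.univ.filter fun τ : PauliString N => ∀ q, q ∉ s → τ q = σ q).erase
        (fun q => if q ∈ s then Pauli.I else σ q) := by
    ext τ
    simp only [mem_nontrivialClass, Finset.mem_erase, Finset.mem_filter, Finset.mem_univ,
      true_and]
    rw [and_comm, and_congr_left_iff]
    intro h
    rw [ne_eq, funext_iff, not_forall]
    constructor
    · rintro ⟨q, hq, hI⟩
      exact ⟨q, by simpa [hq] using hI⟩
    · rintro ⟨q, hq⟩
      by_cases hs : q ∈ s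
      · exact ⟨q, hs, by simpa [hs] using hq⟩
      · simp [hs, h q hs] at hq
  rw [this, Finset.card_erase_of_mem, card_agree]
  simp only [Finset.mem_filter, Finset.mem_univ, true_and]
  intro q hq
  simp [hq]

/-- Left translation by a Pauli matrix on `q` that anticommutes with exactly one of the two labels
there turns the integral into its negative. -/
theorem integral_mul_transfer_haar_of_left_ne {σ σ' : PauliString N} {q : Fin N} (hq : q ∈ s)
    (h : σ q ≠ σ' q) (τ τ' : PauliString N) :
    ∫ u, transfer (embed s u.1) σ τ * transfer (embed s u.1) σ' τ' ∂(haarUnitary (Bits s)) = 0 := by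
  obtain ⟨p, hp⟩ := Pauli.exists_sgn_ne h
  obtain ⟨a, ha⟩ := exists_embed_eq_toOp (s := s) (ω := single q p)
    fun r hr => single_of_ne (by rintro rfl; exact hr hq) p
  obtain ⟨v, hv⟩ := exists_localUnitary (a := a)
    (by rw [ha, PauliString.conjTranspose_toOp, PauliString.toOp_mul_self])
  rw [ha] at hv
  have h1 := integral_mul_left_eq_self (μ := haarUnitary (Bits s))
    (fun u : LocalUnitary s => transfer (embed s u.1) σ τ * transfer (embed s u.1) σ' τ') v
  have h2 : ∀ u : LocalUnitary s, transfer (embed s (v * u).1) σ τ *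
      transfer (embed s (v * u).1) σ' τ' =
      -(transfer (embed s u.1) σ τ * transfer (embed s u.1) σ' τ') := by
    intro u
    have : (v * u).1 = v.1 * u.1 := rfl
    have hp' : ((p.sgn (σ q) : ℝ)) * (p.sgn (σ' q) : ℝ) = -1 := by exact_mod_cast hp
    rw [this, embed_mul, hv, transfer_toOp_mul, transfer_toOp_mul, csign_single, csign_single,
      mul_mul_mul_comm, hp', neg_one_mul]
  simp only [h2, integral_neg] at h1
  linarith

/-- On a qubit of `s` the sign argument applies with right translation. Off `s`, one of `τ`, `τ'`
disagrees with `σ`, so the integrand already vanishes pointwise. -/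
theorem integral_mul_transfer_haar_of_right_ne {τ τ' : PauliString N} (h : τ ≠ τ')
    (σ : PauliString N) :
    ∫ u, transfer (embed s u.1) σ τ * transfer (embed s u.1) σ τ' ∂(haarUnitary (Bits s)) = 0 := by
  obtain ⟨q, h⟩ := Function.ne_iff.1 h
  by_cases hq : q ∈ s
  · obtain ⟨p, hp⟩ := Pauli.exists_sgn_ne h
    obtain ⟨a, ha⟩ := exists_embed_eq_toOp (s := s) (ω := single q p)
      fun r hr => single_of_ne (by rintro rfl; exact hr hq) p
    obtain ⟨v, hv⟩ := exists_localUnitary (a := a)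
      (by rw [ha, PauliString.conjTranspose_toOp, PauliString.toOp_mul_self])
    rw [ha] at hv
    have h1 := integral_mul_right_eq_self (μ := haarUnitary (Bits s))
      (fun u : LocalUnitary s => transfer (embed s u.1) σ τ * transfer (embed s u.1) σ τ') v
    have h2 : ∀ u : LocalUnitary s, transfer (embed s (u * v).1) σ τ *
        transfer (embed s (u * v).1) σ τ' =
        -(transfer (embed s u.1) σ τ * transfer (embed s u.1) σ τ') := by
      intro u
      have : (u * v).1 = u.1 * v.1 := rfl
      have hp' : ((p.sgn (τ q) : ℝ)) * (p.sgn (τ' q) : ℝ) = -1 := by exact_mod_cast hp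
      rw [this, embed_mul, hv, transfer_mul_toOp, transfer_mul_toOp, csign_single, csign_single,
        mul_mul_mul_comm, hp', neg_one_mul]
    simp only [h2, integral_neg] at h1
    linarith
  · have : ∀ u : LocalUnitary s,
        transfer (embed s u.1) σ τ * transfer (embed s u.1) σ τ' = 0 := by
      intro u
      by_cases h3 : σ q = τ q
      · rw [transfer_embed_eq_zero u hq (τ := τ') (by rw [h3]; exact h), mul_zero]
      · rw [transfer_embed_eq_zero u hq h3, zero_mul]
    simp [this]

/-- A unitary which rotates a Pauli string to an anticommuting one. -/
theorem exists_conj_eq_of_anticommute {τ τ' : PauliString N} (hoff : ∀ q, q ∉ s → τ q = τ' q)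
    (hc : PauliString.csign τ' τ = -1) :
    ∃ v : LocalUnitary s, embed s v.1 * τ.toOp * (embed s v.1).conjTranspose = τ'.toOp := by
  obtain ⟨a, ha⟩ := exists_embed_eq_toOp (s := s) (ω := PauliString.mul τ' τ) fun q hq => by
    simp [PauliString.mul, hoff q hq, Pauli.mul_self]
  -- The unitary is `(1 + τ'τ)/√2`. Anticommutation makes `τ'τ` anti-Hermitian with square `-1`. The
  -- phase enters because `a` embeds to the product label without its scalar.
  set c : ℂ := ((Real.sqrt 2 : ℝ) : ℂ)⁻¹ with hcdef
  have hc2 : c * c = 1 / 2 := by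
    rw [hcdef, ← mul_inv, ← Complex.ofReal_mul, Real.mul_self_sqrt (by norm_num)]; norm_num
  have hcstar : star c = c := by
    rw [hcdef, star_inv₀, Complex.star_def, Complex.conj_ofReal]
  have hemb : embed s (c • (1 + (PauliString.phase τ' τ) • a)) =
      c • (1 + τ'.toOp * τ.toOp) := by
    rw [embed_smul, embed_add, embed_one, embed_smul, ha, ← PauliString.toOp_mul]
  have hanti : τ.toOp * τ'.toOp = -(τ'.toOp * τ.toOp) := by
    rw [PauliString.toOp_mul_comm, PauliString.csign_comm, hc]; simp
  have hstar : (c • (1 + τ'.toOp * τ.toOp)).conjTranspose = c • (1 - τ'.toOp * τ.toOp) := by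
    rw [Matrix.conjTranspose_smul, hcstar, Matrix.conjTranspose_add, Matrix.conjTranspose_one,
      Matrix.conjTranspose_mul, PauliString.conjTranspose_toOp, PauliString.conjTranspose_toOp,
      hanti, sub_eq_add_neg]
  have hsq : τ.toOp * τ.toOp = 1 := PauliString.toOp_mul_self τ
  have hsq' : τ'.toOp * τ'.toOp = 1 := PauliString.toOp_mul_self τ'
  have hW : τ'.toOp * τ.toOp * (τ'.toOp * τ.toOp) = -1 := by
    rw [Matrix.mul_assoc, ← Matrix.mul_assoc τ.toOp, hanti, Matrix.neg_mul, Matrix.mul_assoc,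
      hsq, Matrix.mul_one, Matrix.mul_neg, hsq']
  obtain ⟨v, hv⟩ := exists_localUnitary
    (a := c • (1 + (PauliString.phase τ' τ) • a)) (by
      rw [hemb, hstar, Matrix.smul_mul, Matrix.mul_smul, smul_smul, hc2, Matrix.add_mul,
        Matrix.mul_sub, Matrix.one_mul, Matrix.one_mul, Matrix.mul_sub, hW, Matrix.mul_one]
      have : (1 - τ'.toOp * τ.toOp + (τ'.toOp * τ.toOp - -1) : Op N) = (2 : ℂ) • 1 := by
        rw [two_smul]; abel
      rw [this, smul_smul]; norm_num)
  refine ⟨v, ?_⟩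
  rw [hv, hemb, hstar, Matrix.smul_mul, Matrix.mul_smul, Matrix.smul_mul, smul_smul, hc2]
  have h1 : (1 + τ'.toOp * τ.toOp) * τ.toOp = τ.toOp + τ'.toOp := by
    rw [Matrix.add_mul, Matrix.one_mul, Matrix.mul_assoc, hsq, Matrix.mul_one]
  have h2 : τ.toOp * (τ'.toOp * τ.toOp) = -τ'.toOp := by
    rw [← Matrix.mul_assoc, hanti, Matrix.neg_mul, Matrix.mul_assoc, hsq, Matrix.mul_one]
  have h3 : τ'.toOp * (τ'.toOp * τ.toOp) = τ.toOp := by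
    rw [← Matrix.mul_assoc, hsq', Matrix.one_mul]
  rw [h1, Matrix.add_mul, Matrix.mul_sub, Matrix.mul_sub, h2, h3, Matrix.mul_one, Matrix.mul_one]
  have : τ.toOp - -τ'.toOp + (τ'.toOp - τ.toOp) = (2 : ℂ) • τ'.toOp := by
    rw [two_smul]; abel
  rw [this, smul_smul]; norm_num

/-- Right translation by the local unitary rotating `τ` to `τ'` exchanges the two columns. -/
theorem integral_transfer_sq_haar_eq_of_anticommute {τ τ' : PauliString N}
    (hoff : ∀ q, q ∉ s → τ q = τ' q) (hc : PauliString.csign τ' τ = -1) (σ : PauliString N) :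
    ∫ u, transfer (embed s u.1) σ τ ^ 2 ∂(haarUnitary (Bits s)) =
      ∫ u, transfer (embed s u.1) σ τ' ^ 2 ∂(haarUnitary (Bits s)) := by
  obtain ⟨v, hv⟩ := exists_conj_eq_of_anticommute hoff hc
  rw [← integral_mul_right_eq_self (μ := haarUnitary (Bits s))
    (fun u : LocalUnitary s => transfer (embed s u.1) σ τ ^ 2) v]
  refine integral_congr_ae (Filter.Eventually.of_forall fun u => ?_)
  have : (u * v).1 = u.1 * v.1 := rfl
  simp only [this, embed_mul]
  congr 1
  apply Complex.ofReal_injective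
  rw [ofReal_transfer, ofReal_transfer, coeff, coeff, ← hv, Matrix.conjTranspose_mul]
  congr 1
  calc _ = ((τ.toOp * (embed s v.1).conjTranspose * (embed s u.1).conjTranspose * σ.toOp *
        embed s u.1) * embed s v.1).trace := by simp only [Matrix.mul_assoc]
    _ = _ := by rw [Matrix.trace_mul_comm]; simp only [Matrix.mul_assoc]

/-- All three strings agree outside `s`, so only qubits of `s` contribute signs. One site suffices
if both strings are nontrivial there; otherwise a site of each is used, and the other string is
trivial on it. -/
theorem exists_anticommuting {σ τ τ' : PauliString N} (hτ : τ ∈ nontrivialClass s σ)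
    (hτ' : τ' ∈ nontrivialClass s σ) : ∃ ω : PauliString N, (∀ q, q ∉ s → ω q = σ q) ∧
      PauliString.csign ω τ = -1 ∧ PauliString.csign ω τ' = -1 := by
  rw [mem_nontrivialClass] at hτ hτ'
  have key : ∀ (ω : PauliString N) (ρ : PauliString N) (q : Fin N),
      (∀ r, r ∉ s → ρ r = σ r) → (∀ r, r ∉ s → ω r = σ r) → q ∈ s →
      (∀ r ∈ s, r ≠ q → (ω r).sgn (ρ r) = 1) → PauliString.csign ω ρ = (ω q).sgn (ρ q) := by
    intro ω ρ q h1 h2 hq h3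
    refine Finset.prod_eq_single q (fun r _ hr => ?_) (by simp)
    by_cases hrs : r ∈ s
    · exact h3 r hrs hr
    · rw [h1 r hrs, h2 r hrs, Pauli.sgn_self]
  set base : PauliString N := fun q => if q ∈ s then Pauli.I else σ q with hbase
  have hb : ∀ q ∈ s, base q = Pauli.I := fun q hq => by simp [hbase, hq]
  have hb' : ∀ q, q ∉ s → base q = σ q := fun q hq => by simp [hbase, hq]
  by_cases hcommon : ∃ q ∈ s, τ q ≠ Pauli.I ∧ τ' q ≠ Pauli.I
  · obtain ⟨q, hq, h1, h2⟩ := hcommon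
    obtain ⟨p, hp1, hp2⟩ := Pauli.exists_sgn_neg_neg h1 h2
    have hoff : ∀ r, r ∉ s → Function.update base q p r = σ r := fun r hr => by
      rw [Function.update_of_ne (by rintro rfl; exact hr hq), hb' r hr]
    have hon : ∀ (ρ : PauliString N), ∀ r ∈ s, r ≠ q →
        (Function.update base q p r).sgn (ρ r) = 1 := fun ρ r hr hrq => by
      rw [Function.update_of_ne hrq, hb r hr, Pauli.sgn_I_left]
    refine ⟨Function.update base q p, hoff, ?_, ?_⟩
    · rw [key _ τ q hτ.1 hoff hq (hon τ), Function.update_self, hp1]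
    · rw [key _ τ' q hτ'.1 hoff hq (hon τ'), Function.update_self, hp2]
  · push Not at hcommon
    obtain ⟨q, hq, h1⟩ := hτ.2
    obtain ⟨r, hr, h2⟩ := hτ'.2
    have h1' := hcommon q hq h1
    have h2' : τ r = Pauli.I := by
      by_contra h
      exact h2 (hcommon r hr h)
    have hqr : q ≠ r := by rintro rfl; exact h1 h2'
    obtain ⟨p, hp, -⟩ := Pauli.exists_sgn_neg_neg h1 h1
    obtain ⟨p', hp', -⟩ := Pauli.exists_sgn_neg_neg h2 h2
    set ω := Function.update (Function.update base q p) r p' with hω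
    have hωq : ω q = p := by rw [hω, Function.update_of_ne hqr, Function.update_self]
    have hωr : ω r = p' := by rw [hω, Function.update_self]
    have hωI : ∀ t ∈ s, t ≠ q → t ≠ r → ω t = Pauli.I := fun t ht h3 h4 => by
      rw [hω, Function.update_of_ne h4, Function.update_of_ne h3, hb t ht]
    have hoff : ∀ t, t ∉ s → ω t = σ t := fun t ht => by
      rw [hω, Function.update_of_ne (by rintro rfl; exact ht hr),
        Function.update_of_ne (by rintro rfl; exact ht hq), hb' t ht]
    refine ⟨ω, hoff, ?_, ?_⟩
    · rw [key ω τ q hτ.1 hoff hq, hωq, hp]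
      intro t ht htq
      by_cases htr : t = r
      · rw [htr, h2', Pauli.sgn_I_right]
      · rw [hωI t ht htq htr, Pauli.sgn_I_left]
    · rw [key ω τ' r hτ'.1 hoff hr, hωr, hp']
      intro t ht htr
      by_cases htq : t = q
      · rw [htq, h1', Pauli.sgn_I_right]
      · rw [hωI t ht htq htr, Pauli.sgn_I_left]

/-- Two members of the class may commute, so they are compared through a third string anticommuting
with both. -/
theorem integral_transfer_sq_haar_eq {σ τ τ' : PauliString N} (hτ : τ ∈ nontrivialClass s σ)
    (hτ' : τ' ∈ nontrivialClass s σ) :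
    ∫ u, transfer (embed s u.1) σ τ ^ 2 ∂(haarUnitary (Bits s)) =
      ∫ u, transfer (embed s u.1) σ τ' ^ 2 ∂(haarUnitary (Bits s)) := by
  obtain ⟨ω, h0, h1, h2⟩ := exists_anticommuting hτ hτ'
  rw [mem_nontrivialClass] at hτ hτ'
  rw [integral_transfer_sq_haar_eq_of_anticommute (τ' := ω)
      (fun q hq => by rw [h0 q hq, hτ.1 q hq]) h1,
    integral_transfer_sq_haar_eq_of_anticommute (τ' := ω) (τ := τ')
      (fun q hq => by rw [h0 q hq, hτ'.1 q hq]) h2]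

theorem transfer_embed_eq_zero_of_notMem (u : LocalUnitary s) {σ τ : PauliString N}
    (hσ : ∃ q ∈ s, σ q ≠ Pauli.I) (hτ : τ ∉ nontrivialClass s σ) :
    transfer (embed s u.1) σ τ = 0 := by
  rw [mem_nontrivialClass, not_and_or] at hτ
  rcases hτ with hτ | hτ
  · push Not at hτ
    obtain ⟨q, hq, h⟩ := hτ
    exact transfer_embed_eq_zero u hq (Ne.symm h)
  · push Not at hτ
    rw [transfer_embed_trivial_right u hτ, if_neg]
    rintro rfl
    obtain ⟨q, hq, h⟩ := hσ
    exact h (hτ q hq)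

/-- The row has unit norm and is supported on the class, where all mean squares coincide. The value
is therefore the inverse of the number of strings in the class. -/
theorem integral_transfer_sq_haar {σ τ : PauliString N} (hσ : ∃ q ∈ s, σ q ≠ Pauli.I)
    (hτ : τ ∈ nontrivialClass s σ) :
    ∫ u, transfer (embed s u.1) σ τ ^ 2 ∂(haarUnitary (Bits s)) = ((4 : ℝ) ^ s.card - 1)⁻¹ := by
  have hsum : ∑ ρ ∈ nontrivialClass s σ,
      ∫ u, transfer (embed s u.1) σ ρ ^ 2 ∂(haarUnitary (Bits s)) = 1 := by
    rw [← integral_finsetSum]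
    · have : ∀ u : LocalUnitary s,
          ∑ ρ ∈ nontrivialClass s σ, transfer (embed s u.1) σ ρ ^ 2 = 1 := by
        intro u
        rw [← transfer_sq_sum (embed_mul_conjTranspose u) σ]
        refine Finset.sum_subset (Finset.subset_univ _) fun ρ _ hρ => ?_
        rw [transfer_embed_eq_zero_of_notMem u hσ hρ]; norm_num
      simp [this]
    · exact fun ρ _ => integrable_of_continuous _ ((continuous_transfer_embed σ ρ).pow 2)
  rw [Finset.sum_congr rfl fun ρ hρ => integral_transfer_sq_haar_eq hρ hτ, Finset.sum_const,
    card_nontrivialClass, nsmul_eq_mul, Nat.cast_sub (Nat.one_le_pow _ _ (by norm_num))] at hsum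
  push_cast at hsum
  exact eq_inv_of_mul_eq_one_right hsum

/-! ### Random design layers -/

variable {X : Type*} [MeasurableSpace X] {π : Measure X}

theorem integral_transfer_mul_of_left_ne {u : X → LocalUnitary s} (hu : Measurable u)
    (hd : IsUnitaryDesign 2 (π.map u)) {σ σ' : PauliString N} {q : Fin N} (hq : q ∈ s)
    (h : σ q ≠ σ' q) (τ τ' : PauliString N) :
    ∫ x, transfer (embed s (u x).1) σ τ * transfer (embed s (u x).1) σ' τ' ∂π = 0 := by
  rw [← integral_mul_transfer_haar_of_left_ne hq h τ τ',
    ← integral_transfer_mul_transfer_eq_haar hd, integral_map hu.aemeasurable]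
  exact ((continuous_transfer_embed σ τ).mul
    (continuous_transfer_embed σ' τ')).aestronglyMeasurable

theorem integral_transfer_mul_of_nontrivial {u : X → LocalUnitary s} (hu : Measurable u)
    (hd : IsUnitaryDesign 2 (π.map u)) {σ : PauliString N} (hσ : ∃ q ∈ s, σ q ≠ Pauli.I)
    (τ τ' : PauliString N) :
    ∫ x, transfer (embed s (u x).1) σ τ * transfer (embed s (u x).1) σ τ' ∂π =
      if τ = τ' ∧ τ ∈ nontrivialClass s σ then ((4 : ℝ) ^ s.card - 1)⁻¹ else 0 := by
  have h1 : ∫ x, transfer (embed s (u x).1) σ τ * transfer (embed s (u x).1) σ τ' ∂π =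
      ∫ v, transfer (embed s v.1) σ τ * transfer (embed s v.1) σ τ' ∂(haarUnitary (Bits s)) := by
    rw [← integral_transfer_mul_transfer_eq_haar hd, integral_map hu.aemeasurable]
    exact ((continuous_transfer_embed σ τ).mul
      (continuous_transfer_embed σ τ')).aestronglyMeasurable
  rw [h1]
  split_ifs with h
  · obtain ⟨rfl, h⟩ := h
    rw [← integral_transfer_sq_haar hσ h]
    simp only [sq]
  · rw [not_and_or] at h
    rcases h with h | h
    · exact integral_mul_transfer_haar_of_right_ne h σ
    · simp [transfer_embed_eq_zero_of_notMem _ hσ h]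

/-- A first moment is a second moment whose other factor is the identity string, with constant entry
1. No separate 1-design property is needed. -/
theorem integral_transfer_of_nontrivial {u : X → LocalUnitary s} (hu : Measurable u)
    (hd : IsUnitaryDesign 2 (π.map u)) {σ : PauliString N} (hσ : ∃ q ∈ s, σ q ≠ Pauli.I)
    (τ : PauliString N) : ∫ x, transfer (embed s (u x).1) σ τ ∂π = 0 := by
  obtain ⟨q, hq, h⟩ := hσ
  rw [← integral_transfer_mul_of_left_ne hu hd hq (σ' := fun _ => Pauli.I) h τ
    (fun _ => Pauli.I)]
  simp [transfer_embed_of_trivial]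

end Design

/-! ### Exponentials of involutions, by the even and odd parts of the series. -/

theorem exp_smul_of_mul_self_eq_one {n : Type*} [Fintype n] [DecidableEq n] {x : Matrix n n ℂ}
    (hx : x * x = 1) (c : ℂ) :
    NormedSpace.exp (c • x) = Complex.cosh c • (1 : Matrix n n ℂ) + Complex.sinh c • x := by
  rw [NormedSpace.exp_eq_tsum ℂ]
  refine HasSum.tsum_eq (HasSum.even_add_odd ?_ ?_)
  · convert! (Complex.hasSum_cosh c).smul_const (1 : Matrix n n ℂ) using 2 with k
    rw [smul_pow, pow_mul x, sq x, hx, one_pow, smul_smul, div_eq_inv_mul]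
  · convert! (Complex.hasSum_sinh c).smul_const x using 2 with k
    rw [smul_pow, pow_succ x, pow_mul x, sq x, hx, one_pow, one_mul, smul_smul, div_eq_inv_mul]

/-! ### Transfer matrices of Pauli rotations -/

variable {N : ℕ}

theorem rotation_eq (Ω : PauliString N) (t : ℝ) :
    rotation Ω t = (Real.cos t : ℂ) • (1 : Op N) - (Complex.I * (Real.sin t : ℂ)) • Ω.toOp := by
  rw [rotation, exp_smul_of_mul_self_eq_one Ω.toOp_mul_self, Complex.cosh_neg, Complex.sinh_neg,
    mul_comm Complex.I, Complex.cosh_mul_I, Complex.sinh_mul_I, neg_smul, ← sub_eq_add_neg,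
    mul_comm Complex.I]
  push_cast; rfl

theorem Pauli.star_phase (a b : Pauli) : star (Pauli.phase a b) = Pauli.phase b a := by
  cases a <;> cases b <;> simp [Pauli.phase]

theorem PauliString.star_phase (σ τ : PauliString N) :
    star (PauliString.phase σ τ) = PauliString.phase τ σ := by
  simp only [PauliString.phase, star_prod, Pauli.star_phase]

/-- The sign `ε` in `-i σ Ω = ε • (σΩ)` for anticommuting strings. -/
noncomputable def rotSign (Ω σ : PauliString N) : ℝ := (-Complex.I * PauliString.phase σ Ω).re

theorem ofReal_rotSign {Ω σ : PauliString N} (h : PauliString.csign σ Ω = -1) :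
    (rotSign Ω σ : ℂ) = -Complex.I * PauliString.phase σ Ω := by
  rw [rotSign, ← Complex.conj_eq_iff_re]
  have : star (PauliString.phase σ Ω) = -PauliString.phase σ Ω := by
    rw [PauliString.star_phase, PauliString.phase_comm, PauliString.csign_comm, h]; simp
  rw [map_mul, map_neg, Complex.conj_I, starRingEnd_apply, this]
  ring

/-- For anticommuting strings the unit-modulus phase is purely imaginary, so multiplying it by `-i`
gives a real sign. -/
theorem rotSign_sq {Ω σ : PauliString N} (h : PauliString.csign σ Ω = -1) :
    rotSign Ω σ ^ 2 = 1 := by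
  apply Complex.ofReal_injective
  have h1 := PauliString.phase_mul_star σ Ω
  have : star (PauliString.phase σ Ω) = -PauliString.phase σ Ω := by
    rw [PauliString.star_phase, PauliString.phase_comm, PauliString.csign_comm, h]; simp
  rw [this] at h1
  push_cast
  rw [ofReal_rotSign h]
  calc _ = Complex.I ^ 2 * (PauliString.phase σ Ω) ^ 2 := by ring
    _ = _ := by rw [Complex.I_sq]; linear_combination h1

theorem conjTranspose_rotation (Ω : PauliString N) (t : ℝ) :
    (rotation Ω t).conjTranspose =
      (Real.cos t : ℂ) • (1 : Op N) + (Complex.I * (Real.sin t : ℂ)) • Ω.toOp := by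
  rw [rotation_eq, Matrix.conjTranspose_sub, Matrix.conjTranspose_smul, Matrix.conjTranspose_smul,
    Matrix.conjTranspose_one, PauliString.conjTranspose_toOp, star_mul', Complex.star_def,
    Complex.conj_I, Complex.conj_ofReal, Complex.conj_ofReal, neg_mul, neg_smul, sub_neg_eq_add]

theorem rotation_conj_of_commute {Ω σ : PauliString N} (h : PauliString.csign σ Ω = 1) (t : ℝ) :
    (rotation Ω t).conjTranspose * σ.toOp * rotation Ω t = σ.toOp := by
  have hc : Ω.toOp * σ.toOp = σ.toOp * Ω.toOp := by
    rw [PauliString.toOp_mul_comm, PauliString.csign_comm, h]; simp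
  have hu : (rotation Ω t).conjTranspose * rotation Ω t = 1 := by
    rw [conjTranspose_rotation, rotation_eq]
    simp only [Matrix.add_mul, Matrix.mul_sub, Matrix.smul_mul, Matrix.mul_smul, Matrix.one_mul,
      Matrix.mul_one, PauliString.toOp_mul_self]
    have h1 : (Real.cos t : ℂ) * Real.cos t + Real.sin t * Real.sin t = 1 := by
      have := Real.cos_sq_add_sin_sq t
      rw [sq, sq] at this
      exact_mod_cast this
    ext i j
    simp only [Matrix.add_apply, Matrix.sub_apply, Matrix.smul_apply, smul_eq_mul]
    linear_combination ((1 : Op N) i j) * h1 -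
      ((1 : Op N) i j) * Real.sin t * Real.sin t * Complex.I_mul_I
  have : (rotation Ω t).conjTranspose * σ.toOp = σ.toOp * (rotation Ω t).conjTranspose := by
    rw [conjTranspose_rotation, Matrix.add_mul, Matrix.mul_add, Matrix.smul_mul, Matrix.smul_mul,
      Matrix.mul_smul, Matrix.mul_smul, hc, Matrix.one_mul, Matrix.mul_one]
  rw [this, Matrix.mul_assoc, hu, Matrix.mul_one]

theorem rotation_conj_of_anticommute {Ω σ : PauliString N} (h : PauliString.csign σ Ω = -1)
    (t : ℝ) : (rotation Ω t).conjTranspose * σ.toOp * rotation Ω t =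
      (Real.cos (2 * t) : ℂ) • σ.toOp +
        ((Real.sin (2 * t) : ℂ) * (rotSign Ω σ : ℂ)) • (PauliString.mul σ Ω).toOp := by
  have hc : Ω.toOp * σ.toOp = -(σ.toOp * Ω.toOp) := by
    rw [PauliString.toOp_mul_comm, PauliString.csign_comm, h]; simp
  rw [ofReal_rotSign h, mul_comm (-Complex.I), ← mul_assoc, mul_right_comm, mul_smul _ _
    (PauliString.mul σ Ω).toOp, ← PauliString.toOp_mul, conjTranspose_rotation, rotation_eq]
  have h3 : σ.toOp * Ω.toOp * Ω.toOp = σ.toOp := by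
    rw [Matrix.mul_assoc, PauliString.toOp_mul_self, Matrix.mul_one]
  simp only [Matrix.add_mul, Matrix.mul_sub, Matrix.smul_mul, Matrix.mul_smul, Matrix.one_mul,
    Matrix.mul_one, hc, Matrix.neg_mul, h3, smul_neg]
  rw [Real.cos_two_mul', Real.sin_two_mul]
  push_cast
  ext i j
  simp only [Matrix.add_apply, Matrix.sub_apply, Matrix.smul_apply, smul_eq_mul, Matrix.neg_apply]
  linear_combination (σ.toOp i j) * Complex.sin t * Complex.sin t * Complex.I_mul_I

theorem transfer_rotation (Ω : PauliString N) (t : ℝ) (σ τ : PauliString N) :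
    transfer (rotation Ω t) σ τ =
      if PauliString.csign σ Ω = 1 then (if σ = τ then 1 else 0)
      else Real.cos (2 * t) * (if σ = τ then 1 else 0) +
        Real.sin (2 * t) * (rotSign Ω σ * if PauliString.mul σ Ω = τ then 1 else 0) := by
  apply Complex.ofReal_injective
  rw [ofReal_transfer]
  rcases PauliString.csign_eq_one_or σ Ω with h | h
  · rw [rotation_conj_of_commute h, coeff_toOp, if_pos h]
    split_ifs <;> simp
  · have hn : ¬ PauliString.csign σ Ω = 1 := by rw [h]; decide
    rw [rotation_conj_of_anticommute h, coeff_add, coeff_smul, coeff_smul, coeff_toOp, coeff_toOp,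
      if_neg hn]
    simp only [Complex.ofReal_add, Complex.ofReal_mul, apply_ite Complex.ofReal,
      Complex.ofReal_one, Complex.ofReal_zero]
    ring

/-- The derivative of the transfer matrix of a Pauli rotation. -/
noncomputable def rotDeriv (Ω : PauliString N) (t : ℝ) :
    Matrix (PauliString N) (PauliString N) ℝ :=
  Matrix.of fun σ τ =>
    if PauliString.csign σ Ω = 1 then 0
    else -2 * Real.sin (2 * t) * (if σ = τ then 1 else 0) +
      2 * Real.cos (2 * t) * (rotSign Ω σ * if PauliString.mul σ Ω = τ then 1 else 0)

theorem hasDerivAt_transfer_rotation (Ω : PauliString N) (t : ℝ) (σ τ : PauliString N) :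
    HasDerivAt (fun t => transfer (rotation Ω t) σ τ) (rotDeriv Ω t σ τ) t := by
  simp only [transfer_rotation, rotDeriv, Matrix.of_apply]
  split_ifs with h
  all_goals first
    | exact hasDerivAt_const _ _
    | skip
  all_goals
    have h2 : HasDerivAt (fun t : ℝ => 2 * t) 2 t := by
      simpa using (hasDerivAt_id t).const_mul 2
    convert! ((h2.cos).mul_const _).add ((h2.sin).mul_const _) using 1
    ring

theorem rotDeriv_of_commute {Ω σ : PauliString N} (h : PauliString.csign σ Ω = 1) (t : ℝ)
    (τ : PauliString N) : rotDeriv Ω t σ τ = 0 := by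
  simp [rotDeriv, h]

theorem rotDeriv_eq_zero {Ω σ τ : PauliString N} {q : Fin N} (hq : Ω q = Pauli.I)
    (h : τ q ≠ σ q) (t : ℝ) : rotDeriv Ω t σ τ = 0 := by
  have h1 : σ ≠ τ := by rintro rfl; exact h rfl
  have h2 : PauliString.mul σ Ω ≠ τ := by
    rintro rfl
    exact h (by simp [PauliString.mul, hq, Pauli.mul_I])
  simp [rotDeriv, h1, h2]

/-- A nonzero entry leads only to `σ` or `σΩ`, and multiplying by `Ω` does not change the
commutation sign with `Ω`. -/
theorem csign_eq_neg_one_of_rotDeriv_ne_zero {Ω σ τ : PauliString N} {t : ℝ}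
    (h : rotDeriv Ω t σ τ ≠ 0) : PauliString.csign τ Ω = -1 := by
  rcases PauliString.csign_eq_one_or σ Ω with hσ | hσ
  · exact absurd (rotDeriv_of_commute hσ t τ) h
  · by_cases h1 : σ = τ
    · rw [← h1, hσ]
    by_cases h2 : PauliString.mul σ Ω = τ
    · rw [← h2, PauliString.csign_mul_left, PauliString.csign_self, hσ, mul_one]
    · simp [rotDeriv, h1, h2] at h

/-- The two nonzero entries are `-2 sin 2t` and `±2 cos 2t`. Since the result does not depend on
`t`, the law of the angle never enters the bound. -/
theorem sum_rotDeriv_sq {Ω σ : PauliString N} (h : PauliString.csign σ Ω = -1) (t : ℝ) :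
    ∑ τ, rotDeriv Ω t σ τ ^ 2 = 4 := by
  have hne : PauliString.mul σ Ω ≠ σ := by
    intro h1
    have h2 : Ω = fun _ => Pauli.I := by
      rw [← PauliString.mul_mul_self Ω σ, PauliString.mul_comm' Ω σ, h1, PauliString.mul_eq_I_iff]
    have h3 : PauliString.csign σ Ω = 1 := by
      rw [h2]; simp [PauliString.csign, Pauli.sgn_I_right]
    rw [h] at h3
    exact absurd h3 (by decide)
  rw [← Finset.sum_subset (Finset.subset_univ {σ, PauliString.mul σ Ω})]
  · rw [Finset.sum_pair hne.symm]
    have h1 : ¬ ((-1 : ℤ) = 1) := by decide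
    simp only [rotDeriv, Matrix.of_apply, h, h1, if_false, if_true, hne, hne.symm]
    have := Real.sin_sq_add_cos_sq (2 * t)
    linear_combination 4 * this + 4 * Real.cos (2 * t) ^ 2 * rotSign_sq h
  · intro τ _ hτ
    simp only [Finset.mem_insert, Finset.mem_singleton, not_or] at hτ
    simp [rotDeriv, Ne.symm hτ.1, Ne.symm hτ.2]

theorem abs_rotDeriv_le (Ω : PauliString N) (t : ℝ) (σ τ : PauliString N) :
    |rotDeriv Ω t σ τ| ≤ 2 := by
  rcases PauliString.csign_eq_one_or σ Ω with h | h
  · simp [rotDeriv_of_commute h]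
  · refine abs_le_of_sq_le_sq ?_ (by norm_num)
    norm_num
    rw [← sum_rotDeriv_sq h t]
    exact Finset.single_le_sum (f := fun τ => rotDeriv Ω t σ τ ^ 2) (fun _ _ => sq_nonneg _)
      (Finset.mem_univ τ)

theorem measurable_rotDeriv (Ω : PauliString N) (σ τ : PauliString N) :
    Measurable fun t => rotDeriv Ω t σ τ := by
  simp only [rotDeriv, Matrix.of_apply]
  refine Measurable.ite (MeasurableSet.const _) measurable_const ?_
  fun_prop

/-- A nontrivial string supported in `s` anticommutes with half of the strings with prescribed
values outside `s`. -/
theorem sum_csign_agree {s : Finset (Fin N)} {Ω : PauliString N} (h0 : Ω.supp.Nonempty)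
    (hs : Ω.supp ⊆ s) (σ : PauliString N) :
    ∑ τ : PauliString N with ∀ q, q ∉ s → τ q = σ q, PauliString.csign τ Ω = 0 := by
  obtain ⟨q, hq⟩ := h0
  have hqs := hs hq
  have hqI : Ω q ≠ Pauli.I := by simpa [PauliString.supp] using hq
  obtain ⟨p, hp, -⟩ := Pauli.exists_sgn_neg_neg hqI hqI
  have hsign : ∀ τ : PauliString N,
      PauliString.csign (PauliString.mul τ (single q p)) Ω = -PauliString.csign τ Ω := by
    intro τ
    rw [PauliString.csign_mul_left, csign_single, hp]; ring
  -- Multiplication by a one-site Pauli matrix anticommuting with `Ω` pairs strings of opposite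
  -- sign.
  refine Finset.sum_involution (fun τ _ => PauliString.mul τ (single q p)) ?_ ?_ ?_ ?_
  · intro τ _
    rw [hsign]; ring
  · intro τ _ hne heq
    have := hsign τ
    rw [heq] at this
    omega
  · intro τ hτ
    simp only [Finset.mem_filter, Finset.mem_univ, true_and] at hτ ⊢
    intro r hr
    rw [PauliString.mul, single_of_ne (by rintro rfl; exact hr hqs), Pauli.mul_I, hτ r hr]
  · intro τ _
    exact PauliString.mul_mul_self _ _

/-- The signs sum to zero over all strings with the prescribed exterior, so half of them anticommute
with `Ω`. The one string trivial on `s` commutes with `Ω`, so excluding it loses nothing. -/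
theorem card_anticommuting {s : Finset (Fin N)} {Ω : PauliString N} (h0 : Ω.supp.Nonempty)
    (hs : Ω.supp ⊆ s) (σ : PauliString N) :
    2 * ((nontrivialClass s σ).filter fun τ => PauliString.csign τ Ω = -1).card =
      4 ^ s.card := by
  have hΩ : ∀ q, q ∉ s → Ω q = Pauli.I := by
    intro q hq
    by_contra h
    exact hq (hs (by simpa [PauliString.supp] using h))
  have h1 : (nontrivialClass s σ).filter (fun τ => PauliString.csign τ Ω = -1) =
      (Finset.univ.filter fun τ : PauliString N => ∀ q, q ∉ s → τ q = σ q).filter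
        fun τ => PauliString.csign τ Ω = -1 := by
    ext τ
    simp only [Finset.mem_filter, mem_nontrivialClass, Finset.mem_univ, true_and,
      and_congr_left_iff, and_iff_left_iff_imp]
    intro h _
    by_contra hc
    push Not at hc
    have : PauliString.csign τ Ω = 1 := by
      refine Finset.prod_eq_one fun q _ => ?_
      by_cases hq : q ∈ s
      · rw [hc q hq, Pauli.sgn_I_left]
      · rw [hΩ q hq, Pauli.sgn_I_right]
    omega
  have h2 := sum_csign_agree h0 hs σ
  rw [← Finset.sum_filter_add_sum_filter_not _ (fun τ => PauliString.csign τ Ω = -1),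
    Finset.sum_congr rfl (g := fun _ => (-1 : ℤ)) (fun τ hτ => (Finset.mem_filter.1 hτ).2),
    Finset.sum_congr (s₁ := Finset.filter (fun τ => ¬ PauliString.csign τ Ω = -1) _) rfl
      (g := fun _ => (1 : ℤ)) (fun τ hτ => (PauliString.csign_eq_one_or τ Ω).resolve_right
        (Finset.mem_filter.1 hτ).2)] at h2
  have h3 := Finset.card_filter_add_card_filter_not
    (s := Finset.univ.filter fun τ : PauliString N => ∀ q, q ∉ s → τ q = σ q)
    (fun τ => PauliString.csign τ Ω = -1)
  rw [card_agree] at h3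
  simp only [Finset.sum_const, nsmul_eq_mul] at h2
  rw [h1]
  omega

/-! ### Products of independent random matrices -/

section RandomMatrix

/-- The product of a list of matrices, applied to a vector. -/
def chain {X ι : Type*} [Fintype ι] {ι' : Type*} (T : ι' → X → Matrix ι ι ℝ) (z : ι → ℝ) : List ι' → X → ι → ℝ
  | [] => fun _ => z
  | i :: l => fun x => (T i x).mulVec (chain T z l x)

theorem measurable_mulVec {X ι : Type*} [Fintype ι] {_ : MeasurableSpace X} {T : X → Matrix ι ι ℝ}
    {V : X → ι → ℝ} (hT : ∀ i j, Measurable fun x => T x i j) (hV : Measurable V) :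
    Measurable fun x => (T x).mulVec (V x) :=
  measurable_pi_lambda _ fun i => Finset.measurable_sum _ fun j _ =>
    (hT i j).mul ((measurable_pi_apply j).comp hV)

variable {X : Type*} [MeasurableSpace X] {π : Measure X} {ι : Type*} [Fintype ι]

/-- A random vector with measurable and uniformly bounded entries. -/
structure IsBoundedRandom {κ : Type*} (V : X → κ → ℝ) : Prop where
  measurable : Measurable V
  bounded : ∃ C, ∀ x i, |V x i| ≤ C

/-- A random matrix and a random vector, independent, measurable and bounded. -/
structure IndepApply (π : Measure X) (T : X → Matrix ι ι ℝ) (V : X → ι → ℝ) : Prop where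
  mat : IsBoundedRandom fun x (p : ι × ι) => T x p.1 p.2
  vec : IsBoundedRandom V
  indep : IndepFun (fun x (p : ι × ι) => T x p.1 p.2) V π

theorem IsBoundedRandom.apply {κ : Type*} {V : X → κ → ℝ} (h : IsBoundedRandom V) (i : κ) :
    Measurable fun x => V x i := (measurable_pi_apply i).comp h.measurable

theorem IsBoundedRandom.memLp [IsFiniteMeasure π] {κ : Type*} {V : X → κ → ℝ}
    (h : IsBoundedRandom V) (i : κ) (p : ENNReal) : MemLp (fun x => V x i) p π := by
  obtain ⟨C, hC⟩ := h.bounded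
  exact MemLp.of_bound (h.apply i).aestronglyMeasurable C
    (Filter.Eventually.of_forall fun x => hC x i)

theorem IsBoundedRandom.integrable [IsFiniteMeasure π] {κ : Type*} {V : X → κ → ℝ}
    (h : IsBoundedRandom V) (i : κ) : Integrable (fun x => V x i) π :=
  memLp_one_iff_integrable.1 (h.memLp i 1)

theorem IsBoundedRandom.integrable_mul [IsFiniteMeasure π] {κ κ' : Type*} {V : X → κ → ℝ}
    {W : X → κ' → ℝ} (hV : IsBoundedRandom V) (hW : IsBoundedRandom W) (i : κ) (j : κ') :
    Integrable (fun x => V x i * W x j) π :=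
  (hV.memLp i 2).integrable_mul (hW.memLp j 2)

theorem IsBoundedRandom.mulVec {T : X → Matrix ι ι ℝ} {V : X → ι → ℝ}
    (hT : IsBoundedRandom fun x (p : ι × ι) => T x p.1 p.2) (hV : IsBoundedRandom V) :
    IsBoundedRandom fun x => (T x).mulVec (V x) where
  measurable := measurable_mulVec (fun i j => hT.apply (i, j)) hV.measurable
  bounded := by
    obtain ⟨C, hC⟩ := hT.bounded
    obtain ⟨D, hD⟩ := hV.bounded
    refine ⟨∑ _j : ι, C * D, fun x i => ?_⟩
    refine (Finset.abs_sum_le_sum_abs _ _).trans (Finset.sum_le_sum fun j _ => ?_)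
    rw [abs_mul]
    exact mul_le_mul (hC x (i, j)) (hD x j) (abs_nonneg _) ((abs_nonneg _).trans (hC x (i, j)))

theorem IndepApply.integral_mulVec [IsProbabilityMeasure π] {T : X → Matrix ι ι ℝ}
    {V : X → ι → ℝ} (h : IndepApply π T V) (i : ι) :
    ∫ x, (T x).mulVec (V x) i ∂π = ∑ j, (∫ x, T x i j ∂π) * ∫ x, V x j ∂π := by
  have hi : ∀ j, IndepFun (fun x => T x i j) (fun x => V x j) π := fun j =>
    h.indep.comp (measurable_pi_apply (i, j)) (measurable_pi_apply j)
  simp only [Matrix.mulVec, dotProduct]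
  rw [integral_finsetSum _ fun j _ => h.mat.integrable_mul h.vec (i, j) j]
  refine Finset.sum_congr rfl fun j _ => ?_
  exact (hi j).integral_fun_mul_eq_mul_integral (h.mat.apply (i, j)).aestronglyMeasurable
    (h.vec.apply j).aestronglyMeasurable

/-- Independence factorises every term of the expanded product, so a layer acts linearly on the
matrix of second moments of the vector. -/
theorem IndepApply.integral_mulVec_mul_mulVec [IsProbabilityMeasure π] {T : X → Matrix ι ι ℝ}
    {V : X → ι → ℝ} (h : IndepApply π T V) (i i' : ι) :
    ∫ x, (T x).mulVec (V x) i * (T x).mulVec (V x) i' ∂π =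
      ∑ j, ∑ j', (∫ x, T x i j * T x i' j' ∂π) * ∫ x, V x j * V x j' ∂π := by
  have hi : ∀ j j', IndepFun (fun x => T x i j * T x i' j') (fun x => V x j * V x j') π :=
    fun j j' => h.indep.comp
      (φ := fun f : ι × ι → ℝ => f (i, j) * f (i', j')) (ψ := fun g : ι → ℝ => g j * g j')
      (by fun_prop) (by fun_prop)
  have hm : ∀ j j', AEStronglyMeasurable (fun x => T x i j * T x i' j') π := fun j j' =>
    ((h.mat.apply (i, j)).mul (h.mat.apply (i', j'))).aestronglyMeasurable
  have hm' : ∀ j j', AEStronglyMeasurable (fun x => V x j * V x j') π := fun j j' =>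
    ((h.vec.apply j).mul (h.vec.apply j')).aestronglyMeasurable
  have hint : ∀ j j', Integrable (fun x => T x i j * T x i' j' * (V x j * V x j')) π :=
    fun j j' => (hi j j').integrable_mul (h.mat.integrable_mul h.mat (i, j) (i', j'))
      (h.vec.integrable_mul h.vec j j')
  have heq : ∀ x, (T x).mulVec (V x) i * (T x).mulVec (V x) i' =
      ∑ j, ∑ j', T x i j * T x i' j' * (V x j * V x j') := by
    intro x
    simp only [Matrix.mulVec, dotProduct, Finset.sum_mul_sum]
    exact Finset.sum_congr rfl fun j _ => Finset.sum_congr rfl fun j' _ => by ring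
  simp only [heq]
  rw [integral_finsetSum _ fun j _ => integrable_finsetSum _ fun j' _ => hint j j']
  refine Finset.sum_congr rfl fun j _ => ?_
  rw [integral_finsetSum _ fun j' _ => hint j j']
  exact Finset.sum_congr rfl fun j' _ =>
    (hi j j').integral_fun_mul_eq_mul_integral (hm j j') (hm' j j')

theorem isBoundedRandom_chain {ι' : Type*} [Finite ι] {T : ι' → X → Matrix ι ι ℝ}
    (hT : ∀ i, IsBoundedRandom fun x (p : ι × ι) => T i x p.1 p.2) (z : ι → ℝ) (l : List ι') :
    IsBoundedRandom (chain T z l) := by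
  induction l with
  | nil =>
    refine ⟨measurable_const, ∑ j, |z j|, fun _ i => ?_⟩
    exact Finset.single_le_sum (f := fun j => |z j|) (fun _ _ => abs_nonneg _) (Finset.mem_univ i)
  | cons i l ih => exact (hT i).mulVec ih

/-- The σ-algebra generated by the listed layers alone is kept, so that independence of a layer
outside the list can be deduced. -/
theorem measurable_chain {X ι : Type*} [Fintype ι] {ι' : Type*} {mι : ι' → MeasurableSpace X} {T : ι' → X → Matrix ι ι ℝ}
    (hm : ∀ i j k, Measurable[mι i] fun x => T i x j k) (z : ι → ℝ) (l : List ι') :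
    Measurable[⨆ i ∈ {i | i ∈ l}, mι i] (chain T z l) := by
  induction l with
  | nil => exact measurable_const
  | cons i l ih =>
    have h1 : mι i ≤ ⨆ i' ∈ {i' | i' ∈ i :: l}, mι i' :=
      le_biSup mι (show i ∈ {i' | i' ∈ i :: l} by simp)
    have h2 : (⨆ i' ∈ {i' | i' ∈ l}, mι i') ≤ ⨆ i' ∈ {i' | i' ∈ i :: l}, mι i' :=
      biSup_mono fun j hj => List.mem_cons_of_mem _ hj
    exact measurable_mulVec (fun j k => (hm i j k).mono h1 le_rfl) (ih.mono h2 le_rfl)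

/-- The matrix and the chain are measurable for σ-algebras generated by disjoint subfamilies of an
independent family. -/
theorem indepApply_chain {ι' : Type*} {mι : ι' → MeasurableSpace X}
    (hle : ∀ i, mι i ≤ ‹MeasurableSpace X›) (hind : iIndep mι π) {T : ι' → X → Matrix ι ι ℝ}
    (hm : ∀ i j k, Measurable[mι i] fun x => T i x j k) (hb : ∀ i, ∃ C, ∀ x j k, |T i x j k| ≤ C)
    (z : ι → ℝ) {i : ι'} {l : List ι'} (hi : i ∉ l) : IndepApply π (T i) (chain T z l) := by
  have hT : ∀ i, IsBoundedRandom fun x (p : ι × ι) => T i x p.1 p.2 := fun i =>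
    ⟨measurable_pi_lambda _ fun p => (hm i p.1 p.2).mono (hle i) le_rfl, by
      obtain ⟨C, hC⟩ := hb i
      exact ⟨C, fun x p => hC x p.1 p.2⟩⟩
  refine ⟨hT i, isBoundedRandom_chain hT z l, ?_⟩
  have h1 : Indep (⨆ i' ∈ ({i} : Set ι'), mι i') (⨆ i' ∈ {i' | i' ∈ l}, mι i') π :=
    indep_iSup_of_disjoint hle hind (by simpa using hi)
  rw [IndepFun_iff_Indep]
  refine indep_of_indep_of_le_left (indep_of_indep_of_le_right h1 ?_) ?_
  · exact (measurable_chain hm z l).comap_le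
  · have : Measurable[mι i] fun x (p : ι × ι) => T i x p.1 p.2 :=
      @measurable_pi_lambda X (ι × ι) _ (mι i) _ _ fun p => hm i p.1 p.2
    simpa using this.comap_le

end RandomMatrix

/-! ### Layers acting on second moments -/

section Layers

theorem transfer_embed_mulVec_of_trivial {N : ℕ} {s : Finset (Fin N)} (u : LocalUnitary s)
    (v : PauliString N → ℝ) {σ : PauliString N} (hσ : ∀ q ∈ s, σ q = Pauli.I):
    (transfer (embed s u.1)).mulVec v σ = v σ := by
  simp [Matrix.mulVec, dotProduct, transfer_embed_of_trivial u hσ]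

variable {N : ℕ} {X : Type*} [MeasurableSpace X] {π : Measure X} [IsProbabilityMeasure π]
  {V : X → PauliString N → ℝ} {s : Finset (Fin N)}

/-- Components along strings which differ on a qubit of `S` are uncorrelated. -/
def UncorrelatedOn (π : Measure X) (V : X → PauliString N → ℝ) (S : Finset (Fin N)) : Prop :=
  ∀ σ σ' : PauliString N, ∀ q ∈ S, σ q ≠ σ' q → ∫ x, V x σ * V x σ' ∂π = 0

/-- Two mechanisms: on `S'` the moments of the layer itself vanish, while on `S` outside `S'` the
layer preserves labels and the earlier decorrelation is inherited. -/
theorem uncorrelatedOn_mulVec {T : X → Matrix (PauliString N) (PauliString N) ℝ}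
    (h : IndepApply π T V) {S S' : Finset (Fin N)} (hV : UncorrelatedOn π V S)
    (hzero : ∀ x, ∀ q ∈ S, q ∉ S' → ∀ σ τ : PauliString N, τ q ≠ σ q → T x σ τ = 0)
    (hun : ∀ q ∈ S', ∀ σ σ' : PauliString N, σ q ≠ σ' q →
      ∀ τ τ', ∫ x, T x σ τ * T x σ' τ' ∂π = 0) :
    UncorrelatedOn π (fun x => (T x).mulVec (V x)) (S ∪ S') := by
  intro σ σ' q hq hne
  rw [h.integral_mulVec_mul_mulVec]
  refine Finset.sum_eq_zero fun τ _ => Finset.sum_eq_zero fun τ' _ => ?_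
  by_cases hq' : q ∈ S'
  · rw [hun q hq' σ σ' hne, zero_mul]
  have hqS : q ∈ S := (Finset.mem_union.1 hq).resolve_right hq'
  by_cases h1 : τ q = σ q
  · by_cases h2 : τ' q = σ' q
    · rw [hV τ τ' q hqS (by rw [h1, h2]; exact hne), mul_zero]
    · simp [fun x => hzero x q hqS hq' σ' τ' h2]
  · simp [fun x => hzero x q hqS hq' σ τ h1]

section DesignLayer

variable {u : X → LocalUnitary s}

theorem design_uncorrelatedOn (hu : Measurable u) (hd : IsUnitaryDesign 2 (π.map u))
    (h : IndepApply π (fun x => transfer (embed s (u x).1)) V) {S : Finset (Fin N)}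
    (hV : UncorrelatedOn π V S) :
    UncorrelatedOn π (fun x => (transfer (embed s (u x).1)).mulVec (V x)) (S ∪ s) :=
  uncorrelatedOn_mulVec h hV
    (fun x _ _ hq _ _ hne => transfer_embed_eq_zero (u x) hq (Ne.symm hne))
    (fun _ hq _ _ hne => integral_transfer_mul_of_left_ne hu hd hq hne)

/-- The moments of the design are already diagonal in the source strings, so correlations among the
components of `V` do not enter. -/
theorem design_sq_of_nontrivial (hu : Measurable u) (hd : IsUnitaryDesign 2 (π.map u))
    (h : IndepApply π (fun x => transfer (embed s (u x).1)) V) {σ : PauliString N}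
    (hσ : ∃ q ∈ s, σ q ≠ Pauli.I) :
    ∫ x, (transfer (embed s (u x).1)).mulVec (V x) σ ^ 2 ∂π =
      ((4 : ℝ) ^ s.card - 1)⁻¹ * ∑ τ ∈ nontrivialClass s σ, ∫ x, V x τ ^ 2 ∂π := by
  simp only [sq]
  rw [h.integral_mulVec_mul_mulVec]
  simp only [integral_transfer_mul_of_nontrivial hu hd hσ, ite_and, ite_mul, zero_mul]
  simp only [Finset.sum_ite_eq, Finset.mem_univ, if_true]
  rw [← Finset.sum_filter, Finset.filter_mem_eq_inter, Finset.univ_inter, Finset.mul_sum]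

theorem design_mean_zero (h : IndepApply π (fun x => transfer (embed s (u x).1)) V)
    (hV : ∀ τ, ∫ x, V x τ ∂π = 0) (σ : PauliString N) :
    ∫ x, (transfer (embed s (u x).1)).mulVec (V x) σ ∂π = 0 := by
  rw [h.integral_mulVec]
  simp [hV]

/-- The design averages every row nontrivial on `s` to zero and leaves the trivial rows unchanged,
so only the latter need an assumption on `V`. -/
theorem design_mean_zero_of_trivial (hu : Measurable u) (hd : IsUnitaryDesign 2 (π.map u))
    (h : IndepApply π (fun x => transfer (embed s (u x).1)) V)
    (hV : ∀ τ : PauliString N, (∀ q ∈ s, τ q = Pauli.I) → ∫ x, V x τ ∂π = 0)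
    (σ : PauliString N) : ∫ x, (transfer (embed s (u x).1)).mulVec (V x) σ ∂π = 0 := by
  by_cases hσ : ∃ q ∈ s, σ q ≠ Pauli.I
  · rw [h.integral_mulVec]
    simp [integral_transfer_of_nontrivial hu hd hσ]
  · push Not at hσ
    simp only [transfer_embed_mulVec_of_trivial _ _ hσ, hV σ hσ]

end DesignLayer

section RotationLayer

variable {Ω : PauliString N} {t : X → ℝ}

theorem csign_eq_one_of_trivial (hs : Ω.supp ⊆ s) {σ : PauliString N}
    (hσ : ∀ q ∈ s, σ q = Pauli.I) : PauliString.csign σ Ω = 1 := by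
  refine Finset.prod_eq_one fun q _ => ?_
  by_cases hq : q ∈ s
  · rw [hσ q hq, Pauli.sgn_I_left]
  · have : Ω q = Pauli.I := by
      by_contra h
      exact hq (hs (by simpa [PauliString.supp] using h))
    rw [this, Pauli.sgn_I_right]

theorem eq_I_of_notMem (hs : Ω.supp ⊆ s) {q : Fin N} (hq : q ∉ s) : Ω q = Pauli.I := by
  by_contra h
  exact hq (hs (by simpa [PauliString.supp] using h))

theorem rotDeriv_mem_nontrivialClass (hs : Ω.supp ⊆ s) {σ τ : PauliString N} {r : ℝ}
    (h : rotDeriv Ω r σ τ ≠ 0) : τ ∈ nontrivialClass s σ := by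
  rw [mem_nontrivialClass]
  constructor
  · intro q hq
    by_contra hne
    exact h (rotDeriv_eq_zero (eq_I_of_notMem hs hq) hne r)
  · by_contra hc
    push Not at hc
    have h1 := csign_eq_one_of_trivial hs hc
    have h2 := csign_eq_neg_one_of_rotDeriv_ne_zero h
    omega

theorem nontrivialClass_congr {σ τ : PauliString N} (h : ∀ q, q ∉ s → τ q = σ q) :
    nontrivialClass s τ = nontrivialClass s σ := by
  ext ρ
  rw [mem_nontrivialClass, mem_nontrivialClass]
  refine and_congr_left fun _ => forall_congr' fun q => ?_
  refine forall_congr' fun hq => ?_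
  rw [h q hq]

/-- The mean square after the derivative of a rotation, for a vector which is uncorrelated and
uniform on `s`. -/
theorem rotDeriv_sq (hs : Ω.supp ⊆ s) (h : IndepApply π (fun x => rotDeriv Ω (t x)) V)
    (hV : UncorrelatedOn π V s) {σ : PauliString N} (hσ : PauliString.csign σ Ω = -1) {g : ℝ}
    (hg : ∀ τ ∈ nontrivialClass s σ, ∫ x, V x τ ^ 2 ∂π = g) :
    ∫ x, (rotDeriv Ω (t x)).mulVec (V x) σ ^ 2 ∂π = 4 * g := by
  simp only [sq]
  rw [h.integral_mulVec_mul_mulVec]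
  have hdiag : ∀ τ, ∑ τ', (∫ x, rotDeriv Ω (t x) σ τ * rotDeriv Ω (t x) σ τ' ∂π) *
      ∫ x, V x τ * V x τ' ∂π = (∫ x, rotDeriv Ω (t x) σ τ ^ 2 ∂π) * g := by
    intro τ
    rw [Finset.sum_eq_single τ]
    · by_cases hτ : τ ∈ nontrivialClass s σ
      · rw [← hg τ hτ]; simp only [sq]
      · have : ∀ x, rotDeriv Ω (t x) σ τ = 0 := fun x => by
          by_contra hne
          exact hτ (rotDeriv_mem_nontrivialClass hs hne)
        simp [this]
    -- Nonzero entries lead to strings agreeing with `σ` outside `s`. Two distinct such strings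
    -- differ on `s`, where `V` is uncorrelated.
    · intro τ' _ hne
      obtain ⟨q, hq⟩ := Function.ne_iff.1 hne
      by_cases hqs : q ∈ s
      · rw [hV τ τ' q hqs (Ne.symm hq), mul_zero]
      · have hΩ := eq_I_of_notMem hs hqs
        by_cases h1 : τ q = σ q
        · rw [h1] at hq
          simp [fun x => rotDeriv_eq_zero hΩ hq (t x)]
        · simp [fun x => rotDeriv_eq_zero hΩ h1 (t x)]
    · simp
  simp only [hdiag]
  rw [← Finset.sum_mul, ← integral_finsetSum]
  · simp [sum_rotDeriv_sq hσ]
  · intro τ _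
    simpa only [sq] using h.mat.integrable_mul h.mat (σ, τ) (σ, τ)

end RotationLayer

end Layers

/-! ### The block which contains the differentiated gate -/

section Sandwich

variable {N : ℕ} {X : Type*} [MeasurableSpace X] {π : Measure X}
  {V : X → PauliString N → ℝ} {s : Finset (Fin N)} {Ω : PauliString N} {t : X → ℝ}
  {L R : X → LocalUnitary s}

theorem UncorrelatedOn.mono {S S' : Finset (Fin N)} (h : UncorrelatedOn π V S) (hS : S' ⊆ S) :
    UncorrelatedOn π V S' := fun σ σ' q hq => h σ σ' q (hS hq)

variable [IsProbabilityMeasure π]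

/-- The differentiated gate may mix labels on `s`, so decorrelation is carried past it only on `S \
s`; the design `R` then restores it on `s`. -/
theorem sandwich_uncorrelatedOn (hs : Ω.supp ⊆ s)
    (hL : Measurable L) (hLd : IsUnitaryDesign 2 (π.map L))
    (hR : Measurable R) (hRd : IsUnitaryDesign 2 (π.map R))
    (iL : IndepApply π (fun x => transfer (embed s (L x).1)) V)
    (iD : IndepApply π (fun x => rotDeriv Ω (t x))
      fun x => (transfer (embed s (L x).1)).mulVec (V x))
    (iR : IndepApply π (fun x => transfer (embed s (R x).1))
      fun x => (rotDeriv Ω (t x)).mulVec ((transfer (embed s (L x).1)).mulVec (V x)))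
    {S : Finset (Fin N)} (hV : UncorrelatedOn π V S) :
    UncorrelatedOn π (fun x => (transfer (embed s (R x).1)).mulVec
      ((rotDeriv Ω (t x)).mulVec ((transfer (embed s (L x).1)).mulVec (V x)))) (S ∪ s) := by
  have h1 := (design_uncorrelatedOn hL hLd iL hV).mono
    (Finset.sdiff_subset.trans Finset.subset_union_left : S \ s ⊆ S ∪ s)
  have h2 := uncorrelatedOn_mulVec iD (S' := ∅) h1
    (fun x q hq _ σ τ hne => rotDeriv_eq_zero (eq_I_of_notMem hs (Finset.mem_sdiff.1 hq).2) hne _)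
    (by simp)
  refine (design_uncorrelatedOn hR hRd iR h2).mono ?_
  intro q hq
  simp only [Finset.mem_union, Finset.mem_sdiff, Finset.notMem_empty, or_false] at hq ⊢
  tauto

/-- `L` gives every string of the class the same mean square `g`. The derivative yields `4g` on the
`4^|s| / 2` strings anticommuting with `Ω`, and averaging by `R` gives `2 · 4^|s| / (4^|s| - 1) ·
g`, which is at least `2g`. Both designs are used: `L` for uniformity, `R` to reach anticommuting
strings from any nontrivial `σ`. -/
theorem sandwich_sq_ge (h0 : Ω.supp.Nonempty) (hs : Ω.supp ⊆ s)
    (hL : Measurable L) (hLd : IsUnitaryDesign 2 (π.map L))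
    (hR : Measurable R) (hRd : IsUnitaryDesign 2 (π.map R))
    (iL : IndepApply π (fun x => transfer (embed s (L x).1)) V)
    (iD : IndepApply π (fun x => rotDeriv Ω (t x))
      fun x => (transfer (embed s (L x).1)).mulVec (V x))
    (iR : IndepApply π (fun x => transfer (embed s (R x).1))
      fun x => (rotDeriv Ω (t x)).mulVec ((transfer (embed s (L x).1)).mulVec (V x)))
    {S : Finset (Fin N)} (hV : UncorrelatedOn π V S) {σ : PauliString N}
    (hσ : ∃ q ∈ s, σ q ≠ Pauli.I) :
    2 * (((4 : ℝ) ^ s.card - 1)⁻¹ * ∑ τ ∈ nontrivialClass s σ, ∫ x, V x τ ^ 2 ∂π) ≤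
      ∫ x, (transfer (embed s (R x).1)).mulVec
        ((rotDeriv Ω (t x)).mulVec ((transfer (embed s (L x).1)).mulVec (V x))) σ ^ 2 ∂π := by
  set g := ((4 : ℝ) ^ s.card - 1)⁻¹ * ∑ τ ∈ nontrivialClass s σ, ∫ x, V x τ ^ 2 ∂π with hg
  have hone : (1 : ℝ) < 4 ^ s.card :=
    one_lt_pow₀ (by norm_num) (Finset.card_pos.2 (h0.mono hs)).ne'
  have hpos : (0 : ℝ) < 4 ^ s.card - 1 := by linarith
  have hg0 : 0 ≤ g := mul_nonneg (inv_nonneg.2 hpos.le)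
    (Finset.sum_nonneg fun _ _ => integral_nonneg fun _ => sq_nonneg _)
  have hVL := (design_uncorrelatedOn hL hLd iL hV).mono
    (Finset.subset_union_right : s ⊆ S ∪ s)
  have hLsq : ∀ τ ∈ nontrivialClass s σ,
      ∫ x, (transfer (embed s (L x).1)).mulVec (V x) τ ^ 2 ∂π = g := by
    intro τ hτ
    rw [mem_nontrivialClass] at hτ
    rw [design_sq_of_nontrivial hL hLd iL hτ.2, nontrivialClass_congr hτ.1]
  have hD : ∀ α ∈ (nontrivialClass s σ).filter fun τ => PauliString.csign τ Ω = -1,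
      ∫ x, (rotDeriv Ω (t x)).mulVec ((transfer (embed s (L x).1)).mulVec (V x)) α ^ 2 ∂π =
        4 * g := by
    intro α hα
    rw [Finset.mem_filter, mem_nontrivialClass] at hα
    refine rotDeriv_sq hs iD hVL hα.2 fun τ hτ => hLsq τ ?_
    rwa [nontrivialClass_congr hα.1.1] at hτ
  rw [design_sq_of_nontrivial hR hRd iR hσ]
  have hsum : (2 * 4 ^ s.card) * g ≤ ∑ α ∈ nontrivialClass s σ,
      ∫ x, (rotDeriv Ω (t x)).mulVec ((transfer (embed s (L x).1)).mulVec (V x)) α ^ 2 ∂π := by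
    calc (2 * 4 ^ s.card) * g
        = ∑ α ∈ (nontrivialClass s σ).filter fun τ => PauliString.csign τ Ω = -1, 4 * g := by
          rw [Finset.sum_const, nsmul_eq_mul]
          have := card_anticommuting h0 hs σ
          have h2 : (2 : ℝ) * (((nontrivialClass s σ).filter
            fun τ => PauliString.csign τ Ω = -1).card : ℝ) = 4 ^ s.card := by exact_mod_cast this
          rw [← h2]; ring
      _ ≤ _ := by
          rw [← Finset.sum_congr rfl hD]
          exact Finset.sum_le_sum_of_subset_of_nonneg (Finset.filter_subset _ _)
            fun _ _ _ => integral_nonneg fun _ => sq_nonneg _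
  rw [inv_mul_eq_div, le_div_iff₀ hpos]
  -- Only the excess of `4^|s|` over `4^|s| - 1` is discarded here.
  refine le_trans ?_ hsum
  nlinarith

/-- Strings trivial on `s` commute with `Ω`, so the derivative kills them; `R` averages the others
to zero. -/
theorem sandwich_mean_zero (hs : Ω.supp ⊆ s)
    (hR : Measurable R) (hRd : IsUnitaryDesign 2 (π.map R)) {W : X → PauliString N → ℝ}
    (iR : IndepApply π (fun x => transfer (embed s (R x).1))
      fun x => (rotDeriv Ω (t x)).mulVec (W x)) (σ : PauliString N) :
    ∫ x, (transfer (embed s (R x).1)).mulVec ((rotDeriv Ω (t x)).mulVec (W x)) σ ∂π = 0 := by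
  refine design_mean_zero_of_trivial hR hRd iR (fun τ hτ => ?_) σ
  simp [Matrix.mulVec, dotProduct, rotDeriv_of_commute (csign_eq_one_of_trivial hs hτ)]

end Sandwich

/-! ### The Pauli expansion of the cost -/

section InitialState

variable {N : ℕ}

/-- The Pauli components of the initial state. -/
def initialVec (τ : PauliString N) : ℝ := if ∀ q, τ q = Pauli.I ∨ τ q = Pauli.Z then 1 else 0

theorem toOp_zero_zero (τ : PauliString N) : τ.toOp 0 0 = (initialVec τ : ℂ) := by
  rw [PauliString.toOp_apply, initialVec]
  split_ifs with h
  · rw [Finset.prod_eq_one, Complex.ofReal_one]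
    intro q _
    rcases h q with h | h <;> simp [h, Pauli.toMatrix]
  · push Not at h
    obtain ⟨q, hI, hZ⟩ := h
    rw [Complex.ofReal_zero]
    refine Finset.prod_eq_zero (Finset.mem_univ q) ?_
    revert hI hZ
    cases τ q <;> simp [Pauli.toMatrix]

theorem trace_single_mul_conj (U : Op N) (σ : PauliString N) :
    (Matrix.single 0 0 1 * (U.conjTranspose * σ.toOp * U)).trace =
      (((transfer U).mulVec initialVec σ : ℝ) : ℂ) := by
  rw [← sum_transfer_smul, Finset.mul_sum, Matrix.trace_sum, Matrix.mulVec, dotProduct]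
  push_cast
  refine Finset.sum_congr rfl fun τ _ => ?_
  rw [Matrix.mul_smul, Matrix.trace_smul, Matrix.trace_single_mul, smul_eq_mul,
    toOp_zero_zero]
  simp

theorem Circuit.cost_eq_sum {m M : ℕ} (c : Circuit N m M) {J : Type} [Fintype J] (lam : J → ℝ)
    (h : J → PauliString N) (θ : Fin M → ℝ) :
    c.cost (∑ j, (lam j : ℂ) • (h j).toOp) θ =
      ∑ j, lam j * (transfer (c.unitary θ)).mulVec initialVec (h j) := by
  rw [Circuit.cost, Matrix.mul_assoc, Matrix.mul_assoc, ← Matrix.mul_assoc _ _ (c.unitary θ),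
    Finset.mul_sum, Finset.sum_mul, Finset.mul_sum, Matrix.trace_sum, Complex.re_sum]
  refine Finset.sum_congr rfl fun j _ => ?_
  rw [Matrix.mul_smul, Matrix.smul_mul, Matrix.mul_smul, Matrix.trace_smul,
    trace_single_mul_conj, smul_eq_mul, ← Complex.ofReal_mul, Complex.ofReal_re]

end InitialState

/-! ### Random layers of a circuit -/

section CircuitLayers

variable {N m M : ℕ} (c : Circuit N m M) (kμ : Fin m)
  (L R : (Fin M → ℝ) → LocalUnitary (c.s kμ))

/-- The transfer matrices of the blocks other than `kμ`, of the sub-blocks `L`, `R`, and a further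
matrix `K`. -/
noncomputable def layerMat (K : (Fin M → ℝ) → Matrix (PauliString N) (PauliString N) ℝ) :
    {k : Fin m // k ≠ kμ} ⊕ Fin 3 → (Fin M → ℝ) → Matrix (PauliString N) (PauliString N) ℝ
  | .inl k => fun θ => transfer (embed (c.s k) (c.block k θ).1)
  | .inr i => ![fun θ => transfer (embed (c.s kμ) (L θ).1),
      fun θ => transfer (embed (c.s kμ) (R θ).1), K] i

variable {kμ}

/-- The layers of a block, the last one first. -/
def blockLayers {m : ℕ} (kμ k : Fin m) : List ({k : Fin m // k ≠ kμ} ⊕ Fin 3) :=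
  if h : k = kμ then [.inr 1, .inr 2, .inr 0] else [.inl ⟨k, h⟩]

/-- The layers of the first `n` blocks, the last one first. -/
def layersUpTo {m : ℕ} (kμ : Fin m) : ℕ → List ({k : Fin m // k ≠ kμ} ⊕ Fin 3)
  | 0 => []
  | n + 1 => (if h : n < m then blockLayers kμ ⟨n, h⟩ else []) ++ layersUpTo kμ n

theorem layersUpTo_succ {m : ℕ} (kμ k : Fin m) :
    layersUpTo kμ (k + 1) = blockLayers kμ k ++ layersUpTo kμ k := by
  simp [layersUpTo]

theorem blockLayers_of_ne {m : ℕ} {kμ k : Fin m} (h : k ≠ kμ) :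
    blockLayers kμ k = [.inl ⟨k, h⟩] := by simp [blockLayers, h]

theorem blockLayers_self {m : ℕ} (kμ : Fin m) :
    blockLayers kμ kμ = [.inr 1, .inr 2, .inr 0] := by simp [blockLayers]

/-- This shows that the layers of a block are absent from the chain of earlier blocks, which is the
non-membership required for independence. -/
theorem lt_of_mem_layersUpTo {m : ℕ} {kμ : Fin m} {n : ℕ} {i : {k : Fin m // k ≠ kμ} ⊕ Fin 3}
    (hi : i ∈ layersUpTo kμ n) : (Sum.elim (fun k => k.1) (fun _ => kμ) i : Fin m) < n := by
  induction n with
  | zero => simp [layersUpTo] at hi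
  | succ n ih =>
    rw [layersUpTo, List.mem_append] at hi
    rcases hi with hi | hi
    · split_ifs at hi with hn
      · unfold blockLayers at hi
        split_ifs at hi with h
        · have : (kμ : ℕ) = n := by rw [← h]
          simp only [List.mem_cons, List.not_mem_nil, or_false] at hi
          rcases hi with rfl | rfl | rfl <;> simp [this]
        · simp only [List.mem_singleton] at hi
          simp [hi]
      · simp at hi
    · exact (ih hi).trans (Nat.lt_succ_self n)

theorem chain_congr {X ι ι' : Type*} [Fintype ι] {T T' : ι' → X → Matrix ι ι ℝ} {x x' : X}
    {z : ι → ℝ} {l : List ι'} (h : ∀ i ∈ l, T i x = T' i x') :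
    chain T z l x = chain T' z l x' := by
  induction l with
  | nil => rfl
  | cons i l ih =>
    simp only [chain]
    rw [h i (by simp), ih fun j hj => h j (List.mem_cons_of_mem _ hj)]

variable {c L R} {π : Measure (Fin M → ℝ)} {μ : Fin M} {Ω : PauliString N}

theorem chain_layersUpTo_succ_of_ne (K : (Fin M → ℝ) → Matrix (PauliString N) (PauliString N) ℝ)
    (z : PauliString N → ℝ) {k : Fin m} (hk : k ≠ kμ) (θ : Fin M → ℝ) :
    chain (layerMat c kμ L R K) z (layersUpTo kμ (k + 1)) θ =
      (transfer (embed (c.s k) (c.block k θ).1)).mulVec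
        (chain (layerMat c kμ L R K) z (layersUpTo kμ k) θ) := by
  rw [layersUpTo_succ, blockLayers_of_ne hk]
  rfl

theorem chain_layersUpTo_succ_self (K : (Fin M → ℝ) → Matrix (PauliString N) (PauliString N) ℝ)
    (z : PauliString N → ℝ) (θ : Fin M → ℝ) :
    chain (layerMat c kμ L R K) z (layersUpTo kμ (kμ + 1)) θ =
      (transfer (embed (c.s kμ) (R θ).1)).mulVec ((K θ).mulVec
        ((transfer (embed (c.s kμ) (L θ).1)).mulVec
          (chain (layerMat c kμ L R K) z (layersUpTo kμ kμ) θ))) := by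
  rw [layersUpTo_succ, blockLayers_self]
  rfl

theorem transfer_unitary_mulVec
    (hb : ∀ θ, embed (c.s kμ) (c.block kμ θ).1 =
      embed (c.s kμ) (R θ).1 * rotation Ω (θ μ) * embed (c.s kμ) (L θ).1)
    (z : PauliString N → ℝ) (θ : Fin M → ℝ) :
    (transfer (c.unitary θ)).mulVec z =
      chain (layerMat c kμ L R fun θ => transfer (rotation Ω (θ μ))) z (layersUpTo kμ m) θ := by
  have key : ∀ n ≤ m, (transfer ((((List.finRange m).take n).reverse.map
      fun k => embed (c.s k) (c.block k θ).1).prod)).mulVec z =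
      chain (layerMat c kμ L R fun θ => transfer (rotation Ω (θ μ))) z (layersUpTo kμ n) θ := by
    intro n
    induction n with
    | zero => intro _; simp [layersUpTo, chain, transfer_one]
    | succ n ih =>
      intro hn
      have hlt : n < m := hn
      have htake : (List.finRange m).take (n + 1) = (List.finRange m).take n ++ [⟨n, hlt⟩] := by
        rw [List.take_add_one]
        simp [hlt]
      rw [htake, List.reverse_append, List.map_append, List.prod_append, transfer_mul,
        ← Matrix.mulVec_mulVec, ih hlt.le]
      by_cases hk : (⟨n, hlt⟩ : Fin m) = kμ
      · subst hk
        rw [chain_layersUpTo_succ_self]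
        simp only [List.reverse_cons, List.reverse_nil, List.nil_append, List.map_cons,
          List.map_nil, List.prod_cons, List.prod_nil, mul_one, hb, transfer_mul,
          ← Matrix.mulVec_mulVec]
      · rw [chain_layersUpTo_succ_of_ne (k := ⟨n, hlt⟩) _ z hk θ]
        simp
  have h := key m le_rfl
  rwa [List.take_of_length_le (by simp)] at h


theorem IsDesignCircuit.layerMat_update (hc : IsDesignCircuit c π μ kμ Ω L R) (θ : Fin M → ℝ)
    (t : ℝ) (i : {k : Fin m // k ≠ kμ} ⊕ Fin 3) :
    layerMat c kμ L R (fun θ => transfer (rotation Ω (θ μ))) i (Function.update θ μ t) =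
      layerMat c kμ L R (fun _ => transfer (rotation Ω t)) i θ := by
  match i with
  | .inl k => simp only [layerMat, hc.block_param k.1 k.2 θ t]
  | .inr 0 => simp [layerMat, hc.left_param θ t]
  | .inr 1 => simp [layerMat, hc.right_param θ t]
  | .inr 2 => simp [layerMat]

theorem chain_layersUpTo_congr {n : ℕ} (hn : n ≤ kμ)
    (K K' : (Fin M → ℝ) → Matrix (PauliString N) (PauliString N) ℝ) (z : PauliString N → ℝ)
    (θ : Fin M → ℝ) : chain (layerMat c kμ L R K) z (layersUpTo kμ n) θ =
      chain (layerMat c kμ L R K') z (layersUpTo kμ n) θ := by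
  refine chain_congr fun i hi => ?_
  have := lt_of_mem_layersUpTo hi
  match i with
  | .inl k => rfl
  | .inr _ => simp only [Sum.elim_inr] at this; omega

/-! ### Differentiation along the chain of layers. -/

theorem HasDerivAt.mulVec_const {ι : Type*} [Fintype ι] (A : Matrix ι ι ℝ) {v : ℝ → ι → ℝ}
    {v' : ι → ℝ} {t : ℝ} (hv : ∀ i, HasDerivAt (fun t => v t i) (v' i) t) (i : ι) :
    HasDerivAt (fun t => A.mulVec (v t) i) (A.mulVec v' i) t := by
  simp only [Matrix.mulVec, dotProduct]
  exact HasDerivAt.fun_sum fun j _ => (hv j).const_mul _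

theorem HasDerivAt.mulVec_left {ι : Type*} [Fintype ι] {A : ℝ → Matrix ι ι ℝ} (v : ι → ℝ)
    {A' : Matrix ι ι ℝ} {t : ℝ} (hA : ∀ i j, HasDerivAt (fun t => A t i j) (A' i j) t) (i : ι) :
    HasDerivAt (fun t => (A t).mulVec v i) (A'.mulVec v i) t := by
  simp only [Matrix.mulVec, dotProduct]
  exact HasDerivAt.fun_sum fun j _ => (hA i j).mul_const _

/-- The angle occurs in a single layer, so no product rule is needed: blocks before `kμ` give a
constant vector and later ones a constant linear map. -/
theorem hasDerivAt_chain_layersUpTo (Ω : PauliString N) (z : PauliString N → ℝ)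
    (θ : Fin M → ℝ) (t : ℝ) {n : ℕ} (hn : n ≤ m) (hk : (kμ : ℕ) < n) (σ : PauliString N) :
    HasDerivAt (fun t => chain (layerMat c kμ L R fun _ => transfer (rotation Ω t)) z
      (layersUpTo kμ n) θ σ)
      (chain (layerMat c kμ L R fun _ => rotDeriv Ω t) z (layersUpTo kμ n) θ σ) t := by
  induction n generalizing σ with
  | zero => omega
  | succ n ih =>
    have hlt : n < m := hn
    by_cases h : (⟨n, hlt⟩ : Fin m) = kμ
    · subst h
      simp only [chain_layersUpTo_succ_self]
      refine HasDerivAt.mulVec_const _ (fun τ => ?_) σ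
      have hcongr : ∀ t', chain (layerMat c ⟨n, hlt⟩ L R fun _ => transfer (rotation Ω t')) z
          (layersUpTo ⟨n, hlt⟩ n) θ = chain (layerMat c ⟨n, hlt⟩ L R fun _ => rotDeriv Ω t) z
          (layersUpTo ⟨n, hlt⟩ n) θ := fun t' => chain_layersUpTo_congr le_rfl _ _ z θ
      simp only [hcongr]
      exact HasDerivAt.mulVec_left _ (hasDerivAt_transfer_rotation Ω t) τ
    · have hk' : (kμ : ℕ) < n := by
        rcases Nat.lt_succ_iff_lt_or_eq.1 hk with h1 | h1
        · exact h1
        · exact absurd (Fin.ext h1.symm) h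
      have e := fun K => chain_layersUpTo_succ_of_ne (c := c) (L := L) (R := R) (k := ⟨n, hlt⟩)
        K z h θ
      simp only [e]
      exact HasDerivAt.mulVec_const _ (fun τ => ih hlt.le hk' τ) σ

theorem IsDesignCircuit.costDeriv_eq (hc : IsDesignCircuit c π μ kμ Ω L R) {J : Type} [Fintype J]
    (lam : J → ℝ) (h : J → PauliString N) (θ : Fin M → ℝ) :
    c.costDeriv (∑ j, (lam j : ℂ) • (h j).toOp) μ θ =
      ∑ j, lam j * chain (layerMat c kμ L R fun θ => rotDeriv Ω (θ μ)) initialVec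
        (layersUpTo kμ m) θ (h j) := by
  have h1 : ∀ t, c.cost (∑ j, (lam j : ℂ) • (h j).toOp) (Function.update θ μ t) =
      ∑ j, lam j * chain (layerMat c kμ L R fun _ => transfer (rotation Ω t)) initialVec
        (layersUpTo kμ m) θ (h j) := by
    intro t
    rw [Circuit.cost_eq_sum]
    refine Finset.sum_congr rfl fun j _ => ?_
    rw [transfer_unitary_mulVec hc.block_eq, chain_congr fun i _ => hc.layerMat_update θ t i]
  have hd : HasDerivAt (fun t => ∑ j, lam j * chain (layerMat c kμ L R
      fun _ => transfer (rotation Ω t)) initialVec (layersUpTo kμ m) θ (h j))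
      (∑ j, lam j * chain (layerMat c kμ L R fun _ => rotDeriv Ω (θ μ)) initialVec
        (layersUpTo kμ m) θ (h j)) (θ μ) := by
    refine HasDerivAt.fun_sum fun j _ => HasDerivAt.const_mul (lam j) ?_
    exact hasDerivAt_chain_layersUpTo (c := c) (L := L) (R := R) Ω initialVec θ (θ μ) le_rfl
      kμ.2 (h j)
  -- The angle was frozen as a constant for differentiation; at the point `θ` it is again read off
  -- from the parameters, which is the form used for independence.
  have hlayer : ∀ i, layerMat c kμ L R (fun _ => rotDeriv Ω (θ μ)) i θ =
      layerMat c kμ L R (fun θ => rotDeriv Ω (θ μ)) i θ := fun i => by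
    match i with
    | .inl k => rfl
    | .inr 0 => rfl
    | .inr 1 => rfl
    | .inr 2 => rfl
  rw [Circuit.costDeriv]
  simp only [h1]
  rw [hd.deriv, chain_congr fun i _ => hlayer i]

theorem IsDesignCircuit.indepApply [IsProbabilityMeasure π]
    (hc : IsDesignCircuit c π μ kμ Ω L R) (z : PauliString N → ℝ)
    {i : {k : Fin m // k ≠ kμ} ⊕ Fin 3} {l : List ({k : Fin m // k ≠ kμ} ⊕ Fin 3)} (hi : i ∉ l) :
    IndepApply π (layerMat c kμ L R (fun θ => rotDeriv Ω (θ μ)) i)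
      (chain (layerMat c kμ L R fun θ => rotDeriv Ω (θ μ)) z l) := by
  have hmeas : ∀ {s : Finset (Fin N)} (u : (Fin M → ℝ) → LocalUnitary s) (σ τ : PauliString N),
      Measurable[MeasurableSpace.comap u inferInstance]
        fun θ => transfer (embed s (u θ).1) σ τ := fun u σ τ =>
    (continuous_transfer_embed σ τ).measurable.comp (comap_measurable u)
  refine indepApply_chain ?_ hc.indep ?_ ?_ z hi
  · intro i
    match i with
    | .inl k => exact (hc.block_measurable k.1 k.2).comap_le
    | .inr 0 => exact hc.left_measurable.comap_le
    | .inr 1 => exact hc.right_measurable.comap_le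
    | .inr 2 => exact (measurable_pi_apply μ).comap_le
  · intro i σ τ
    match i with
    | .inl k => exact hmeas (c.block k.1) σ τ
    | .inr 0 => exact hmeas L σ τ
    | .inr 1 => exact hmeas R σ τ
    | .inr 2 =>
      exact (measurable_rotDeriv Ω σ τ).comp (comap_measurable fun θ : Fin M → ℝ => θ μ)
  · intro i
    match i with
    | .inl k => exact ⟨1, fun θ σ τ => abs_transfer_le_one (embed_mul_conjTranspose _) σ τ⟩
    | .inr 0 => exact ⟨1, fun θ σ τ => abs_transfer_le_one (embed_mul_conjTranspose _) σ τ⟩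
    | .inr 1 => exact ⟨1, fun θ σ τ => abs_transfer_le_one (embed_mul_conjTranspose _) σ τ⟩
    | .inr 2 => exact ⟨2, fun θ σ τ => abs_rotDeriv_le Ω _ σ τ⟩

/-- The Pauli components after the first `n` blocks, with the rotation replaced by its derivative
in the block `kμ`. -/
noncomputable def derivVec (c : Circuit N m M) (kμ : Fin m)
    (L R : (Fin M → ℝ) → LocalUnitary (c.s kμ)) (Ω : PauliString N) (μ : Fin M) (n : ℕ) :
    (Fin M → ℝ) → PauliString N → ℝ :=
  chain (layerMat c kμ L R fun θ => rotDeriv Ω (θ μ)) initialVec (layersUpTo kμ n)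

theorem derivVec_succ_of_ne {k : Fin m} (hk : k ≠ kμ) :
    derivVec c kμ L R Ω μ (k + 1) = fun θ =>
      (transfer (embed (c.s k) (c.block k θ).1)).mulVec (derivVec c kμ L R Ω μ k θ) :=
  funext fun θ => chain_layersUpTo_succ_of_ne _ _ hk θ

theorem derivVec_succ_self :
    derivVec c kμ L R Ω μ (kμ + 1) = fun θ =>
      (transfer (embed (c.s kμ) (R θ).1)).mulVec ((rotDeriv Ω (θ μ)).mulVec
        ((transfer (embed (c.s kμ) (L θ).1)).mulVec (derivVec c kμ L R Ω μ kμ θ))) :=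
  funext fun θ => chain_layersUpTo_succ_self _ _ θ

/-! ### Means, correlations and second moments along the circuit. -/

section Recursion

theorem integral_derivVec_sq_of_trivial {k : Fin m}
    (hk : k ≠ kμ) {σ : PauliString N} (hσ : ∀ q ∈ c.s k, σ q = Pauli.I) :
    ∫ θ, derivVec c kμ L R Ω μ (k + 1) θ σ ^ 2 ∂π =
      ∫ θ, derivVec c kμ L R Ω μ k θ σ ^ 2 ∂π := by
  simp only [derivVec_succ_of_ne hk, transfer_embed_mulVec_of_trivial _ _ hσ]

variable [IsProbabilityMeasure π]

theorem IsDesignCircuit.indepApply_block (hc : IsDesignCircuit c π μ kμ Ω L R) {k : Fin m}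
    (hk : k ≠ kμ) : IndepApply π (fun θ => transfer (embed (c.s k) (c.block k θ).1))
      (derivVec c kμ L R Ω μ k) :=
  hc.indepApply initialVec (i := .inl ⟨k, hk⟩) fun hi => by
    have := lt_of_mem_layersUpTo hi
    simp at this

theorem inr_notMem_layersUpTo (i : Fin 3) :
    (Sum.inr i : {k : Fin m // k ≠ kμ} ⊕ Fin 3) ∉ layersUpTo kμ kμ := fun hi => by
  have := lt_of_mem_layersUpTo hi
  simp at this

theorem IsDesignCircuit.indepApply_left (hc : IsDesignCircuit c π μ kμ Ω L R) :
    IndepApply π (fun θ => transfer (embed (c.s kμ) (L θ).1)) (derivVec c kμ L R Ω μ kμ) :=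
  hc.indepApply initialVec (i := .inr 0) (inr_notMem_layersUpTo 0)

theorem IsDesignCircuit.indepApply_rotDeriv (hc : IsDesignCircuit c π μ kμ Ω L R) :
    IndepApply π (fun θ => rotDeriv Ω (θ μ)) fun θ =>
      (transfer (embed (c.s kμ) (L θ).1)).mulVec (derivVec c kμ L R Ω μ kμ θ) :=
  hc.indepApply initialVec (i := .inr 2) (l := .inr 0 :: layersUpTo kμ kμ)
    (by simp [inr_notMem_layersUpTo])

theorem IsDesignCircuit.indepApply_right (hc : IsDesignCircuit c π μ kμ Ω L R) :
    IndepApply π (fun θ => transfer (embed (c.s kμ) (R θ).1)) fun θ =>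
      (rotDeriv Ω (θ μ)).mulVec ((transfer (embed (c.s kμ) (L θ).1)).mulVec
        (derivVec c kμ L R Ω μ kμ θ)) :=
  hc.indepApply initialVec (i := .inr 1) (l := .inr 2 :: .inr 0 :: layersUpTo kμ kμ)
    (by simp [inr_notMem_layersUpTo])

theorem IsDesignCircuit.uncorrelatedOn (hc : IsDesignCircuit c π μ kμ Ω L R) {n : ℕ}
    (hn : n ≤ m) : UncorrelatedOn π (derivVec c kμ L R Ω μ n)
      ((Finset.univ.filter fun i : Fin m => (i : ℕ) < n).biUnion c.s) := by
  induction n with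
  | zero => simp [UncorrelatedOn]
  | succ n ih =>
    have hlt : n < m := hn
    have hsub : (Finset.univ.filter fun i : Fin m => (i : ℕ) < n + 1).biUnion c.s ⊆
        (Finset.univ.filter fun i : Fin m => (i : ℕ) < n).biUnion c.s ∪ c.s ⟨n, hlt⟩ := by
      intro q
      simp only [Finset.mem_union, Finset.mem_biUnion, Finset.mem_filter, Finset.mem_univ,
        true_and]
      rintro ⟨i, hi, hq⟩
      rcases Nat.lt_succ_iff_lt_or_eq.1 hi with h | h
      · exact Or.inl ⟨i, h, hq⟩
      · exact Or.inr (by rwa [show (⟨n, hlt⟩ : Fin m) = i from Fin.ext h.symm])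
    refine UncorrelatedOn.mono ?_ hsub
    by_cases h : (⟨n, hlt⟩ : Fin m) = kμ
    · subst h
      have e := derivVec_succ_self (c := c) (L := L) (R := R) (Ω := Ω) (μ := μ)
      simp only at e
      rw [e]
      exact sandwich_uncorrelatedOn hc.generator_supp hc.left_measurable hc.left_design
        hc.right_measurable hc.right_design hc.indepApply_left hc.indepApply_rotDeriv
        hc.indepApply_right (ih hlt.le)
    · have e := derivVec_succ_of_ne (c := c) (L := L) (R := R) (Ω := Ω) (μ := μ) h
      simp only at e
      rw [e]
      exact design_uncorrelatedOn (hc.block_measurable _ h) (hc.block_design _ h)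
        (hc.indepApply_block h) (ih hlt.le)

/-- The differentiated block annihilates all means, and an independent linear layer keeps them zero.
-/
theorem IsDesignCircuit.mean_zero (hc : IsDesignCircuit c π μ kμ Ω L R) {n : ℕ} (hn : n ≤ m)
    (hk : (kμ : ℕ) < n) (σ : PauliString N) : ∫ θ, derivVec c kμ L R Ω μ n θ σ ∂π = 0 := by
  induction n generalizing σ with
  | zero => omega
  | succ n ih =>
    have hlt : n < m := hn
    by_cases h : (⟨n, hlt⟩ : Fin m) = kμ
    · subst h
      have e := derivVec_succ_self (c := c) (L := L) (R := R) (Ω := Ω) (μ := μ)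
      simp only at e
      rw [e]
      exact sandwich_mean_zero hc.generator_supp hc.right_measurable hc.right_design
        hc.indepApply_right σ
    · have e := derivVec_succ_of_ne (c := c) (L := L) (R := R) (Ω := Ω) (μ := μ) h
      simp only at e
      rw [e]
      refine design_mean_zero (hc.indepApply_block h) (fun τ => ih hlt.le ?_ τ) σ
      rcases Nat.lt_succ_iff_lt_or_eq.1 hk with h1 | h1
      · exact h1
      · exact absurd (Fin.ext h1.symm) h

theorem IsDesignCircuit.sq_succ_of_nontrivial (hc : IsDesignCircuit c π μ kμ Ω L R) (k : Fin m)
    {σ : PauliString N} (hσ : ∃ q ∈ c.s k, σ q ≠ Pauli.I) :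
    (if k = kμ then 2 else 1) * (((4 : ℝ) ^ (c.s k).card - 1)⁻¹ *
        ∑ τ ∈ nontrivialClass (c.s k) σ, ∫ θ, derivVec c kμ L R Ω μ k θ τ ^ 2 ∂π) ≤
      ∫ θ, derivVec c kμ L R Ω μ (k + 1) θ σ ^ 2 ∂π := by
  split_ifs with h
  · subst h
    rw [derivVec_succ_self]
    exact sandwich_sq_ge hc.generator_nontrivial hc.generator_supp hc.left_measurable
      hc.left_design hc.right_measurable hc.right_design hc.indepApply_left
      hc.indepApply_rotDeriv hc.indepApply_right (hc.uncorrelatedOn k.2.le) hσ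
  · rw [derivVec_succ_of_ne h, one_mul, design_sq_of_nontrivial (hc.block_measurable k h)
      (hc.block_design k h) (hc.indepApply_block h) hσ]

/-- Mean zero turns the variance into a second moment. Two distinct observables differ on a qubit
supporting one of them, hence on a qubit of the circuit, where the components are uncorrelated. -/
theorem IsDesignCircuit.variance_eq (hc : IsDesignCircuit c π μ kμ Ω L R) {J : Type} [Fintype J]
    (lam : J → ℝ) {h : J → PauliString N} (h_distinct : Function.Injective h)
    (h_supp : ∀ j, (h j).supp ⊆ c.supp) :
    variance (c.costDeriv (∑ j, (lam j : ℂ) • (h j).toOp) μ) π =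
      ∑ j, lam j ^ 2 * ∫ θ, derivVec c kμ L R Ω μ m θ (h j) ^ 2 ∂π := by
  have hV : IsBoundedRandom (derivVec c kμ L R Ω μ m) := by
    obtain ⟨n, rfl⟩ : ∃ n, m = n + 1 := ⟨m - 1, by have := kμ.2; omega⟩
    have hlast : ((Fin.last n : Fin (n + 1)) : ℕ) = n := rfl
    by_cases hk : Fin.last n = kμ
    · subst hk
      have := (hc.indepApply_right).mat.mulVec (hc.indepApply_right).vec
      rwa [← derivVec_succ_self] at this
    · have := (hc.indepApply_block hk).mat.mulVec (hc.indepApply_block hk).vec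
      rwa [← derivVec_succ_of_ne hk] at this
  have hfun : c.costDeriv (∑ j, (lam j : ℂ) • (h j).toOp) μ =
      fun θ => ∑ j, lam j * derivVec c kμ L R Ω μ m θ (h j) :=
    funext fun θ => hc.costDeriv_eq lam h θ
  have hmean : ∫ θ, ∑ j, lam j * derivVec c kμ L R Ω μ m θ (h j) ∂π = 0 := by
    rw [integral_finsetSum _ fun j _ => (hV.integrable (h j)).const_mul (lam j)]
    refine Finset.sum_eq_zero fun j _ => ?_
    rw [integral_const_mul, hc.mean_zero le_rfl kμ.2, mul_zero]
  rw [hfun, variance_of_integral_eq_zero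
    (Finset.measurable_sum _ fun j _ => (hV.apply (h j)).const_mul (lam j)).aemeasurable hmean]
  have hsq : ∀ θ, (∑ j, lam j * derivVec c kμ L R Ω μ m θ (h j)) ^ 2 =
      ∑ j, ∑ j', lam j * lam j' *
        (derivVec c kμ L R Ω μ m θ (h j) * derivVec c kμ L R Ω μ m θ (h j')) := by
    intro θ
    rw [sq, Finset.sum_mul_sum]
    exact Finset.sum_congr rfl fun j _ => Finset.sum_congr rfl fun j' _ => by ring
  have hint : ∀ j j', Integrable (fun θ => lam j * lam j' *
      (derivVec c kμ L R Ω μ m θ (h j) * derivVec c kμ L R Ω μ m θ (h j'))) π := fun j j' =>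
    (hV.integrable_mul hV (h j) (h j')).const_mul _
  simp only [hsq]
  rw [integral_finsetSum _ fun j _ => integrable_finsetSum _ fun j' _ => hint j j']
  refine Finset.sum_congr rfl fun j _ => ?_
  rw [integral_finsetSum _ fun j' _ => hint j j', Finset.sum_eq_single j]
  · rw [integral_const_mul]
    simp only [sq]
  · intro j' _ hne
    obtain ⟨q, hq⟩ := Function.ne_iff.1 (h_distinct.ne hne)
    have hqs : q ∈ c.supp := by
      by_cases hI : h j q = Pauli.I
      · rw [hI] at hq
        exact h_supp j' (by simpa [PauliString.supp] using hq)
      · exact h_supp j (by simpa [PauliString.supp] using hI)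
    rw [integral_const_mul, hc.uncorrelatedOn le_rfl (h j) (h j') q _ (Ne.symm hq), mul_zero]
    simpa [Circuit.supp] using hqs
  · simp

end Recursion

end CircuitLayers

/-! ### Existence of path sets -/

section Paths

variable {N m : ℕ} {s : Fin m → Finset (Fin N)}

theorem mem_connSupp {k k' : Fin m} {q : Fin N} :
    q ∈ connSupp s k k' ↔ q ∈ s k ∧ q ∈ s k' ∧ ∀ i, k < i → i < k' → q ∉ s i := by
  simp [connSupp, and_assoc]

theorem mem_fwdSupp {k : Fin m} {q : Fin N} :
    q ∈ fwdSupp s k ↔ q ∈ s k ∧ ∀ i, i < k → q ∉ s i := by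
  simp [fwdSupp]

theorem mem_bwdSupp {k : Fin m} {q : Fin N} :
    q ∈ bwdSupp s k ↔ q ∈ s k ∧ ∀ i, k < i → q ∉ s i := by
  simp [bwdSupp]

variable (s) in
/-- The relation between adjacent blocks of a path. -/
def Connected (k k' : Fin m) : Prop := k < k' ∧ (connSupp s k k').Nonempty

/-- Consecutive blocks acting on `q` are connected through `q` itself; the induction inserts
intermediate blocks until none is left. -/
theorem reflTransGen_of_mem_mem {q : Fin N} {k k' : Fin m} (hle : k ≤ k') (hk : q ∈ s k)
    (hk' : q ∈ s k') : Relation.ReflTransGen (Connected s) k k' := by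
  induction hn : (k' : ℕ) - k using Nat.strong_induction_on generalizing k k' with
  | _ n ih =>
    rcases hle.eq_or_lt with rfl | hlt
    · exact Relation.ReflTransGen.refl
    by_cases h : ∃ i, k < i ∧ i < k' ∧ q ∈ s i
    · obtain ⟨i, h1, h2, hi⟩ := h
      have h1' : (k : ℕ) < i := h1
      have h2' : (i : ℕ) < k' := h2
      exact (ih _ (by omega) h1.le hk hi rfl).trans (ih _ (by omega) h2.le hi hk' rfl)
    · push Not at h
      exact Relation.ReflTransGen.single ⟨hlt, q, mem_connSupp.2 ⟨hk, hk', h⟩⟩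

theorem exists_bwdSupp {q : Fin N} {k : Fin m} (hk : q ∈ s k) :
    ∃ k', Relation.ReflTransGen (Connected s) k k' ∧ q ∈ bwdSupp s k' := by
  have hne : (Finset.univ.filter fun i => q ∈ s i).Nonempty := ⟨k, by simpa using hk⟩
  have hmem := Finset.max'_mem _ hne
  rw [Finset.mem_filter] at hmem
  refine ⟨_, reflTransGen_of_mem_mem (Finset.le_max' _ k (by simpa using hk)) hk hmem.2,
    mem_bwdSupp.2 ⟨hmem.2, fun i hi hq => ?_⟩⟩
  exact absurd (Finset.le_max' _ i (by simpa using hq)) (not_le.2 hi)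

theorem exists_fwdSupp {q : Fin N} {k : Fin m} (hk : q ∈ s k) :
    ∃ k', Relation.ReflTransGen (Connected s) k' k ∧ q ∈ fwdSupp s k' := by
  have hne : (Finset.univ.filter fun i => q ∈ s i).Nonempty := ⟨k, by simpa using hk⟩
  have hmem := Finset.min'_mem _ hne
  rw [Finset.mem_filter] at hmem
  refine ⟨_, reflTransGen_of_mem_mem (Finset.min'_le _ k (by simpa using hk)) hmem.2 hk,
    mem_fwdSupp.2 ⟨hmem.2, fun i hi hq => ?_⟩⟩
  exact absurd (Finset.min'_le _ i (by simpa using hq)) (not_le.2 hi)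

theorem InCausalCone.exists_bwdSupp {S : Finset (Fin N)} {k : Fin m} (h : InCausalCone s S k) :
    ∃ k', Relation.ReflTransGen (Connected s) k k' ∧ (bwdSupp s k' ∩ S).Nonempty := by
  induction h with
  | base k h =>
    obtain ⟨q, hq⟩ := h
    rw [Finset.mem_inter] at hq
    obtain ⟨k', h1, h2⟩ := PathBound.exists_bwdSupp hq.1
    exact ⟨k', h1, q, Finset.mem_inter.2 ⟨h2, hq.2⟩⟩
  | step k k' hlt hov _ ih =>
    obtain ⟨q, hq⟩ := hov
    rw [Finset.mem_inter] at hq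
    obtain ⟨k'', h1, h2⟩ := ih
    exact ⟨k'', (reflTransGen_of_mem_mem hlt.le hq.1 hq.2).trans h1, h2⟩

theorem le_of_reflTransGen {k k' : Fin m} (h : Relation.ReflTransGen (Connected s) k k') :
    k ≤ k' := by
  induction h with
  | refl => exact le_rfl
  | tail _ h ih => exact ih.trans h.1.le

theorem exists_chain_through {k₀ k k' : Fin m} (h₀ : Relation.ReflTransGen (Connected s) k₀ k)
    (h : Relation.ReflTransGen (Connected s) k k') :
    ∃ l : List (Fin m), (k₀ :: l).IsChain (Connected s) ∧ k ∈ k₀ :: l ∧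
      (k₀ :: l).getLast (List.cons_ne_nil _ _) = k' := by
  induction h₀ using Relation.ReflTransGen.head_induction_on with
  | refl =>
    induction h using Relation.ReflTransGen.head_induction_on with
    | refl => exact ⟨[], by simp⟩
    | head h _ ih =>
      obtain ⟨l, h1, _, h3⟩ := ih
      exact ⟨_ :: l, List.isChain_cons_cons.2 ⟨h, h1⟩, by simp, by simpa using h3⟩
  | head h _ ih =>
    obtain ⟨l, h1, h2, h3⟩ := ih
    exact ⟨_ :: l, List.isChain_cons_cons.2 ⟨h, h1⟩, List.mem_cons_of_mem _ h2, by simpa using h3⟩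

theorem exists_path_through {k k' : Fin m} (hk : (s k).Nonempty)
    (h : Relation.ReflTransGen (Connected s) k k') (hb : (bwdSupp s k').Nonempty) :
    ∃ p : CircuitPath s, k ∈ p.nodes ∧ k' ∈ p.nodes := by
  obtain ⟨q, hq⟩ := hk
  obtain ⟨k₀, h₀, hf⟩ := exists_fwdSupp hq
  obtain ⟨l, h1, h2, h3⟩ := exists_chain_through h₀ h
  refine ⟨⟨k₀ :: l, List.cons_ne_nil _ _, h1, ⟨q, hf⟩, by rwa [h3]⟩, h2, ?_⟩
  exact h3 ▸ List.getLast_mem (List.cons_ne_nil k₀ l)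

/-- One path runs through `k` to the observable by following the causal cone forward. For each qubit
of `S`, a further path passes through the last block acting on it. -/
theorem exists_pathSet {S : Finset (Fin N)} (hS : S ⊆ Finset.univ.biUnion s) {k : Fin m}
    (hk : (s k).Nonempty) (hcone : InCausalCone s S k) :
    ∃ P : PathSet s, P.GoesThroughAndCovers k S := by
  classical
  obtain ⟨k', h1, h2⟩ := hcone.exists_bwdSupp
  obtain ⟨p, hp, hp'⟩ := exists_path_through hk h1 (h2.mono Finset.inter_subset_left)
  have hcov : ∀ q, ∃ r : CircuitPath s, q ∈ S → q ∈ r.bwd := by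
    intro q
    by_cases hq : q ∈ S
    · obtain ⟨i, -, hi⟩ := Finset.mem_biUnion.1 (hS hq)
      obtain ⟨i', h3, h4⟩ := exists_bwdSupp hi
      obtain ⟨r, -, hr⟩ := exists_path_through ⟨q, hi⟩ h3 ⟨q, h4⟩
      exact ⟨r, fun _ => Finset.mem_biUnion.2 ⟨i', by simpa using hr, h4⟩⟩
    · exact ⟨p, fun h => absurd h hq⟩
  choose r hr using hcov
  refine ⟨insert p (S.image r), ⟨p, Finset.mem_insert_self _ _, hp, k', hp',
    le_of_reflTransGen h1, h2⟩, fun q hq => ?_⟩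
  exact Finset.mem_biUnion.2 ⟨r q, Finset.mem_insert_of_mem (Finset.mem_image_of_mem r hq), hr q hq⟩

/-! ### Edges and active blocks of a path set -/

/-- The qubits of an edge. -/
def edgeSupp (s : Fin m → Finset (Fin N)) : Option (Fin m) × Fin m → Finset (Fin N)
  | (none, k) => fwdSupp s k
  | (some i, k) => connSupp s i k

theorem edgeSupp_subset (e : Option (Fin m) × Fin m) : edgeSupp s e ⊆ s e.2 := by
  obtain ⟨_ | i, k⟩ := e
  · exact fun q hq => (mem_fwdSupp.1 hq).1
  · exact fun q hq => (mem_connSupp.1 hq).2.1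

theorem connected_of_mem_zip {R : Fin m → Fin m → Prop} {l : List (Fin m)} (h : l.IsChain R)
    {i k : Fin m} (hik : (i, k) ∈ l.zip l.tail) : R i k := by
  induction l with
  | nil => simp at hik
  | cons x l ih =>
    cases l with
    | nil => simp at hik
    | cons y l =>
      rw [List.isChain_cons_cons] at h
      simp only [List.tail_cons, List.zip_cons_cons, List.mem_cons, Prod.mk.injEq] at hik
      rcases hik with ⟨rfl, rfl⟩ | hik
      · exact h.1
      · exact ih h.2 hik

theorem eq_head_or_mem_zip {l : List (Fin m)} (hl : l ≠ []) {k : Fin m} (hk : k ∈ l) :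
    k = l.head hl ∨ ∃ i, (i, k) ∈ l.zip l.tail := by
  induction l with
  | nil => simp at hk
  | cons x l ih =>
    rcases List.mem_cons.1 hk with rfl | hk
    · exact Or.inl rfl
    · right
      cases l with
      | nil => simp at hk
      | cons y l =>
        rcases ih (List.cons_ne_nil _ _) hk with h | ⟨i, hi⟩
        · exact ⟨x, by simp [h]⟩
        · exact ⟨i, by
            simp only [List.tail_cons, List.zip_cons_cons, List.mem_cons]
            exact Or.inr hi⟩

theorem CircuitPath.mem_edges_none {p : CircuitPath s} {k : Fin m} :
    (none, k) ∈ p.edges ↔ k = p.head := by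
  simp [CircuitPath.edges]

theorem CircuitPath.mem_edges_some {p : CircuitPath s} {i k : Fin m} :
    (some i, k) ∈ p.edges ↔ (i, k) ∈ p.nodes.zip p.nodes.tail := by
  simp [CircuitPath.edges]

theorem CircuitPath.connected_of_mem_edges {p : CircuitPath s} {i k : Fin m}
    (h : (some i, k) ∈ p.edges) : Connected s i k :=
  connected_of_mem_zip p.chain (CircuitPath.mem_edges_some.1 h)

theorem CircuitPath.edgeSupp_nonempty {p : CircuitPath s} {e : Option (Fin m) × Fin m}
    (h : e ∈ p.edges) : (edgeSupp s e).Nonempty := by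
  obtain ⟨_ | i, k⟩ := e
  · rw [CircuitPath.mem_edges_none] at h
    rw [h]
    exact p.head_fwd
  · exact (p.connected_of_mem_edges h).2

theorem CircuitPath.exists_edge {p : CircuitPath s} {k : Fin m} (hk : k ∈ p.nodes) :
    ∃ e ∈ p.edges, e.2 = k := by
  rcases eq_head_or_mem_zip p.ne_nil hk with h | ⟨i, hi⟩
  · exact ⟨(none, k), CircuitPath.mem_edges_none.2 h, rfl⟩
  · exact ⟨(some i, k), CircuitPath.mem_edges_some.2 hi, rfl⟩

/-- The edges of a path set. -/
def PathSet.edges (P : PathSet s) : Finset (Option (Fin m) × Fin m) :=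
  P.biUnion CircuitPath.edges

/-- The blocks of a path set from which its edges lead to a qubit of `S`. -/
inductive IsActive (P : PathSet s) (S : Finset (Fin N)) : Fin m → Prop
  | base (k : Fin m) (p : CircuitPath s) : p ∈ P → k ∈ p.nodes → (bwdSupp s k ∩ S).Nonempty →
      IsActive P S k
  | step (k k' : Fin m) : (some k, k') ∈ P.edges → IsActive P S k' → IsActive P S k

theorem IsActive.exists_edge {P : PathSet s} {S : Finset (Fin N)} {k : Fin m}
    (h : IsActive P S k) : ∃ e ∈ P.edges, e.2 = k := by
  have key : ∃ p ∈ P, k ∈ p.nodes := by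
    rcases h with ⟨_, p, hp, hk, _⟩ | ⟨_, k', he, _⟩
    · exact ⟨p, hp, hk⟩
    · obtain ⟨p, hp, he⟩ := Finset.mem_biUnion.1 he
      exact ⟨p, hp, (List.of_mem_zip (CircuitPath.mem_edges_some.1 he)).1⟩
  obtain ⟨p, hp, hk⟩ := key
  obtain ⟨e, he, rfl⟩ := p.exists_edge hk
  exact ⟨e, Finset.mem_biUnion.2 ⟨p, hp, he⟩, rfl⟩

/-- Activity propagates backwards along the edges of one path. Stating it for lists lets the
induction peel off the earliest block. -/
theorem isActive_of_le {P : PathSet s} {S : Finset (Fin N)} {l : List (Fin m)}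
    (hl : l.Pairwise (· < ·)) (he : ∀ i k, (i, k) ∈ l.zip l.tail → (some i, k) ∈ P.edges)
    {a b : Fin m} (ha : a ∈ l) (hb : b ∈ l) (hab : a ≤ b) (hact : IsActive P S b) :
    IsActive P S a := by
  induction l generalizing a with
  | nil => simp at ha
  | cons x l ih =>
    rw [List.pairwise_cons] at hl
    have hsub : ∀ i k, (i, k) ∈ l.zip l.tail → (some i, k) ∈ P.edges := by
      intro i k hik
      refine he i k ?_
      cases l with
      | nil => simp at hik
      | cons y l =>
        simp only [List.tail_cons, List.zip_cons_cons, List.mem_cons]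
        exact Or.inr hik
    rcases List.mem_cons.1 hb with hbx | hbl
    · rcases List.mem_cons.1 ha with hax | hal
      · rwa [hax, ← hbx]
      · exact absurd hab (not_le.2 (hbx ▸ hl.1 a hal))
    · rcases List.mem_cons.1 ha with hax | hal
      · cases l with
        | nil => simp at hbl
        | cons y l =>
          rw [hax]
          refine IsActive.step x y (he x y (by simp)) (ih hl.2 hsub (a := y) (by simp) hbl ?_)
          rcases List.mem_cons.1 hbl with hby | hbl'
          · exact hby.ge
          · exact ((List.pairwise_cons.1 hl.2).1 b hbl').le
      · exact ih hl.2 hsub hal hbl hab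

theorem PathSet.GoesThroughAndCovers.isActive {P : PathSet s} {S : Finset (Fin N)} {k : Fin m}
    (h : P.GoesThroughAndCovers k S) : IsActive P S k := by
  obtain ⟨⟨p, hp, hk, k', hk', hle, hne⟩, -⟩ := h
  refine isActive_of_le (l := p.nodes) ?_ (fun i j hij => ?_) hk hk' hle
    (IsActive.base k' p hp hk' hne)
  · exact List.isChain_iff_pairwise.1 (p.chain.imp fun _ _ h => h.1)
  · exact Finset.mem_biUnion.2 ⟨p, hp, CircuitPath.mem_edges_some.2 hij⟩

end Paths

/-! ### Counting the strings which follow a path set -/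

section Counting

variable {N m : ℕ} {s : Fin m → Finset (Fin N)}

/-- The nontrivial strings supported in `G` with values in `B`. -/
def supportedStrings (G : Finset (Fin N)) (B : Finset Pauli) : Finset (PauliString N) :=
  (Fintype.piFinset fun q => if q ∈ G then B else {Pauli.I}).erase fun _ => Pauli.I

theorem mem_supportedStrings {G : Finset (Fin N)} {B : Finset Pauli} {ρ : PauliString N}
    (h : ρ ∈ supportedStrings G B) :
    (∀ q, q ∉ G → ρ q = Pauli.I) ∧ (∀ q ∈ G, ρ q ∈ B) ∧ ∃ q ∈ G, ρ q ≠ Pauli.I := by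
  rw [supportedStrings, Finset.mem_erase, Fintype.mem_piFinset] at h
  have hoff : ∀ q, q ∉ G → ρ q = Pauli.I := fun q hq => by simpa [hq] using h.2 q
  refine ⟨hoff, fun q hq => by simpa [hq] using h.2 q, ?_⟩
  obtain ⟨q, hq⟩ := Function.ne_iff.1 h.1
  exact ⟨q, by_contra fun hG => hq (hoff q hG), hq⟩

theorem card_supportedStrings (G : Finset (Fin N)) {B : Finset Pauli} (hB : Pauli.I ∈ B) :
    (supportedStrings G B).card = B.card ^ G.card - 1 := by
  rw [supportedStrings, Finset.card_erase_of_mem, Fintype.card_piFinset]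
  · have : ∀ q, (if q ∈ G then B else {Pauli.I} : Finset Pauli).card =
        if q ∈ G then B.card else 1 := fun q => by split_ifs <;> simp
    simp [this]
  · rw [Fintype.mem_piFinset]
    intro q
    split_ifs <;> simp [hB]

/-- The Pauli labels which are admitted on an edge: only `I` and `Z` have a nonzero expectation in
the initial state. -/
def edgeLabels : Option (Fin m) → Finset Pauli
  | none => {.I, .Z}
  | some _ => Finset.univ

theorem I_mem_edgeLabels (o : Option (Fin m)) : Pauli.I ∈ edgeLabels o := by
  cases o <;> simp [edgeLabels]

variable (s) in
/-- The number of strings which follow an edge. -/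
noncomputable def edgeCount (e : Option (Fin m) × Fin m) : ℝ :=
  ((edgeLabels e.1).card : ℝ) ^ (edgeSupp s e).card - 1

theorem cast_card_supportedStrings (e : Option (Fin m) × Fin m) :
    ((supportedStrings (edgeSupp s e) (edgeLabels e.1)).card : ℝ) = edgeCount s e := by
  have h1 : 1 ≤ (edgeLabels e.1).card := Finset.card_pos.2 ⟨_, I_mem_edgeLabels e.1⟩
  rw [card_supportedStrings _ (I_mem_edgeLabels _), Nat.cast_sub (Nat.one_le_pow _ _ h1)]
  simp [edgeCount]

/-- An edge whose first block, if any, precedes the second one. -/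
def IsForward : Option (Fin m) × Fin m → Prop
  | (none, _) => True
  | (some i, k) => i < k

/-- The origin of `q` is the latest earlier block acting on it, or the initial state if there is
none. Together with `exists_edgeSupp`, the possible incoming edges partition the qubits of a block.
-/
theorem edgeSupp_unique {k : Fin m} {o o' : Option (Fin m)} {q : Fin N}
    (ho : IsForward (o, k)) (ho' : IsForward (o', k)) (h : q ∈ edgeSupp s (o, k))
    (h' : q ∈ edgeSupp s (o', k)) : o = o' := by
  cases o with
  | none =>
    cases o' with
    | none => rfl
    | some i => exact absurd (mem_connSupp.1 h').1 ((mem_fwdSupp.1 h).2 i ho')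
  | some i =>
    cases o' with
    | none => exact absurd (mem_connSupp.1 h).1 ((mem_fwdSupp.1 h').2 i ho)
    | some j =>
      have h1 := mem_connSupp.1 h
      have h2 := mem_connSupp.1 h'
      rcases lt_trichotomy i j with hlt | heq | hlt
      · exact absurd h2.1 (h1.2.2 j hlt ho')
      · rw [heq]
      · exact absurd h1.1 (h2.2.2 i hlt ho)

theorem exists_edgeSupp {k : Fin m} {q : Fin N} (hq : q ∈ s k) :
    ∃ o, IsForward (o, k) ∧ q ∈ edgeSupp s (o, k) := by
  by_cases h : (Finset.univ.filter fun i => i < k ∧ q ∈ s i).Nonempty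
  · have hmem := Finset.max'_mem _ h
    rw [Finset.mem_filter] at hmem
    refine ⟨some _, hmem.2.1, mem_connSupp.2 ⟨hmem.2.2, hq, fun i h1 h2 h3 => ?_⟩⟩
    exact absurd (Finset.le_max' _ i (by simp [h2, h3])) (not_le.2 h1)
  · refine ⟨none, trivial, mem_fwdSupp.2 ⟨hq, fun i h1 h2 => h ⟨i, by simp [h1, h2]⟩⟩⟩

theorem exists_connSupp_next {k : Fin m} {q : Fin N} (hq : q ∈ s k) (hb : q ∉ bwdSupp s k) :
    ∃ k', k < k' ∧ q ∈ connSupp s k k' := by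
  have h : (Finset.univ.filter fun i => k < i ∧ q ∈ s i).Nonempty := by
    by_contra hne
    refine hb (mem_bwdSupp.2 ⟨hq, fun i h1 h2 => hne ⟨i, by simp [h1, h2]⟩⟩)
  have hmem := Finset.min'_mem _ h
  rw [Finset.mem_filter] at hmem
  refine ⟨_, hmem.2.1, mem_connSupp.2 ⟨hq, hmem.2.2, fun i h1 h2 h3 => ?_⟩⟩
  exact absurd (Finset.min'_le _ i (by simp [h1, h3])) (not_le.2 h2)

/-- The strings which agree with `σ` outside the block `k`, follow the edges `(o, k)` with `o ∈ D`,
and are trivial on the other edges into `k`. -/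
noncomputable def followingStrings (s : Fin m → Finset (Fin N)) (k : Fin m)
    (D : Finset (Option (Fin m))) (σ : PauliString N) : Finset (PauliString N) :=
  open Classical in
  Finset.univ.filter fun τ => (∀ q, q ∉ s k → τ q = σ q) ∧
    (∀ o ∈ D, ∃ q ∈ edgeSupp s (o, k), τ q ≠ Pauli.I) ∧
    (∀ o, IsForward (o, k) → o ∉ D → ∀ q ∈ edgeSupp s (o, k), τ q = Pauli.I) ∧
    ∀ q ∈ fwdSupp s k, τ q = Pauli.I ∨ τ q = Pauli.Z

theorem mem_followingStrings {k : Fin m} {D : Finset (Option (Fin m))} {σ τ : PauliString N} :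
    τ ∈ followingStrings s k D σ ↔ (∀ q, q ∉ s k → τ q = σ q) ∧
      (∀ o ∈ D, ∃ q ∈ edgeSupp s (o, k), τ q ≠ Pauli.I) ∧
      (∀ o, IsForward (o, k) → o ∉ D → ∀ q ∈ edgeSupp s (o, k), τ q = Pauli.I) ∧
      ∀ q ∈ fwdSupp s k, τ q = Pauli.I ∨ τ q = Pauli.Z := by
  simp [followingStrings]

/-- Labels on different incoming edges can be chosen independently, since their supports are
disjoint. Gluing one nontrivial string per edge in `D` is injective and produces following strings.
-/
theorem prod_edgeCount_le_card (k : Fin m) {D : Finset (Option (Fin m))}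
    (hD : ∀ o ∈ D, IsForward (o, k)) (σ : PauliString N) :
    ∏ o ∈ D, edgeCount s (o, k) ≤ ((followingStrings s k D σ).card : ℝ) := by
  classical
  -- The origin of each qubit. The value `none` outside the block is a default that the gluing never
  -- reads.
  have hcls : ∀ q, ∃ o, q ∈ s k → IsForward (o, k) ∧ q ∈ edgeSupp s (o, k) := by
    intro q
    by_cases hq : q ∈ s k
    · obtain ⟨o, ho⟩ := exists_edgeSupp hq
      exact ⟨o, fun _ => ho⟩
    · exact ⟨none, fun h => absurd h hq⟩
  choose cls hcls using hcls
  have hcls_eq : ∀ {q o}, IsForward (o, k) → q ∈ edgeSupp s (o, k) → cls q = o := by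
    intro q o ho hq
    have h := hcls q (edgeSupp_subset _ hq)
    exact edgeSupp_unique h.1 ho h.2 hq
  -- Origins outside `D` get the identity string as their only choice: it contributes a factor 1 to
  -- the cardinality and is trivial on those edges.
  let A : Option (Fin m) → Finset (PauliString N) := fun o =>
    if o ∈ D then supportedStrings (edgeSupp s (o, k)) (edgeLabels o) else {fun _ => Pauli.I}
  have hApos : ∀ {o}, o ∈ D → A o = supportedStrings (edgeSupp s (o, k)) (edgeLabels o) :=
    fun ho => if_pos ho
  have hAneg : ∀ {o}, o ∉ D → A o = {fun _ => Pauli.I} := fun ho => if_neg ho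
  have hAD : ∀ {f : Option (Fin m) → PauliString N}, f ∈ Fintype.piFinset A → ∀ o ∈ D,
      f o ∈ supportedStrings (edgeSupp s (o, k)) (edgeLabels o) := by
    intro f hf o ho
    have := Fintype.mem_piFinset.1 hf o
    rwa [hApos ho] at this
  have hAI : ∀ {f : Option (Fin m) → PauliString N}, f ∈ Fintype.piFinset A → ∀ o, o ∉ D →
      f o = fun _ => Pauli.I := by
    intro f hf o ho
    have := Fintype.mem_piFinset.1 hf o
    rwa [hAneg ho, Finset.mem_singleton] at this
  have hcard : ((Fintype.piFinset A).card : ℝ) = ∏ o ∈ D, edgeCount s (o, k) := by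
    rw [Fintype.card_piFinset, Nat.cast_prod, ← Finset.prod_subset (Finset.subset_univ D)]
    · refine Finset.prod_congr rfl fun o ho => ?_
      rw [hApos ho, cast_card_supportedStrings (o, k)]
    · intro o _ ho
      rw [hAneg ho, Finset.card_singleton, Nat.cast_one]
  rw [← hcard]
  refine Nat.cast_le.2 (Finset.card_le_card_of_injOn
    (fun f q => if q ∈ s k then f (cls q) q else σ q) ?_ ?_)
  · intro f hf
    have hval : ∀ {o}, IsForward (o, k) → ∀ q ∈ edgeSupp s (o, k),
        (if q ∈ s k then f (cls q) q else σ q) = f o q := fun {o} ho q hq => by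
      rw [if_pos (edgeSupp_subset _ hq), hcls_eq ho hq]
    refine Finset.mem_coe.2 (mem_followingStrings.2 ⟨fun q hq => if_neg hq, fun o ho => ?_,
      fun o hf' ho q hq => ?_, fun q hq => ?_⟩)
    · obtain ⟨q, hq, hne⟩ := (mem_supportedStrings (hAD hf o ho)).2.2
      exact ⟨q, hq, fun h => hne ((hval (hD o ho) q hq).symm.trans h)⟩
    · simp only [hval hf' q hq, hAI hf o ho]
    · have hq' : q ∈ edgeSupp s (none, k) := hq
      simp only [hval (o := none) trivial q hq']
      by_cases ho : none ∈ D
      · have := (mem_supportedStrings (hAD hf none ho)).2.1 q hq'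
        simpa [edgeLabels] using this
      · simp [hAI hf none ho]
  · intro f hf f' hf' heq
    funext o
    by_cases ho : o ∈ D
    · funext q
      by_cases hq : q ∈ edgeSupp s (o, k)
      · have := congrFun heq q
        simpa only [if_pos (edgeSupp_subset _ hq), hcls_eq (hD o ho) hq] using this
      · rw [(mem_supportedStrings (hAD hf o ho)).1 q hq,
          (mem_supportedStrings (hAD hf' o ho)).1 q hq]
    · rw [hAI hf o ho, hAI hf' o ho]

end Counting

/-! ### The path bound -/

section Bound

variable {N m : ℕ} {s : Fin m → Finset (Fin N)}

theorem PathSet.isForward_of_mem_edges {P : PathSet s} {e : Option (Fin m) × Fin m}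
    (he : e ∈ P.edges) : IsForward e := by
  obtain ⟨p, _, he⟩ := Finset.mem_biUnion.1 he
  obtain ⟨_ | i, k⟩ := e
  · trivial
  · exact (p.connected_of_mem_edges he).1

theorem PathSet.edgeSupp_nonempty {P : PathSet s} {e : Option (Fin m) × Fin m}
    (he : e ∈ P.edges) : (edgeSupp s e).Nonempty := by
  obtain ⟨p, _, he⟩ := Finset.mem_biUnion.1 he
  exact p.edgeSupp_nonempty he

/-- After the blocks with index at least `n` have been undone, the string `σ` has followed the
active part of the path set `P`, starting from `h`. -/
structure Follows (P : PathSet s) (h : PauliString N) (n : ℕ) (σ : PauliString N) : Prop where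
  used : ∀ i k' : Fin m, (i : ℕ) < n → n ≤ k' → (some i, k') ∈ P.edges →
    IsActive P h.supp k' → ∃ q ∈ connSupp s i k', σ q ≠ Pauli.I
  unused : ∀ i k' : Fin m, (i : ℕ) < n → n ≤ k' →
    ¬ ((some i, k') ∈ P.edges ∧ IsActive P h.supp k') → ∀ q ∈ connSupp s i k', σ q = Pauli.I
  fwd : ∀ k' : Fin m, n ≤ k' → ∀ q ∈ fwdSupp s k', σ q = Pauli.I ∨ σ q = Pauli.Z
  bwd : ∀ i : Fin m, (i : ℕ) < n → ∀ q ∈ bwdSupp s i, σ q = h q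
  off : ∀ q, (∀ i, q ∉ s i) → σ q = Pauli.I

theorem PathSet.GoesThroughAndCovers.exists_bwdSupp {P : PathSet s} {h : PauliString N}
    {kμ : Fin m} (hP : P.GoesThroughAndCovers kμ h.supp) {q : Fin N} (hq : h q ≠ Pauli.I) :
    ∃ p ∈ P, ∃ k ∈ p.nodes, q ∈ bwdSupp s k := by
  have hqS : q ∈ h.supp := by simpa [PauliString.supp] using hq
  obtain ⟨p, hp, hqp⟩ := Finset.mem_biUnion.1 (hP.2 hqS)
  obtain ⟨k, hk, hqk⟩ := Finset.mem_biUnion.1 hqp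
  exact ⟨p, hp, k, by simpa using hk, hqk⟩

/-- At `n = m` no edge crosses the cut; only the vanishing of `h` off the circuit has content, and
it comes from the covering condition. -/
theorem follows_initial {P : PathSet s} {h : PauliString N} {kμ : Fin m}
    (hP : P.GoesThroughAndCovers kμ h.supp) : Follows P h m h where
  used i k' _ hk' := absurd k'.2 (not_lt.2 hk')
  unused i k' _ hk' := absurd k'.2 (not_lt.2 hk')
  fwd k' hk' := absurd k'.2 (not_lt.2 hk')
  bwd _ _ _ _ := rfl
  off q hq := by
    by_contra hne
    obtain ⟨_, _, k, _, hk⟩ := hP.exists_bwdSupp hne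
    exact hq k (mem_bwdSupp.1 hk).1

variable {P : PathSet s} {h σ : PauliString N} {kμ k : Fin m}

theorem Follows.nontrivial (hσ : Follows P h (k + 1) σ) (hk : IsActive P h.supp k) :
    ∃ q ∈ s k, σ q ≠ Pauli.I := by
  rcases hk with ⟨_, p, hp, hk, q, hq⟩ | ⟨_, k', he, hk'⟩
  · rw [Finset.mem_inter] at hq
    refine ⟨q, (mem_bwdSupp.1 hq.1).1, ?_⟩
    rw [hσ.bwd k (Nat.lt_succ_self _) q hq.1]
    simpa [PauliString.supp] using hq.2
  · have hlt : k < k' := PathSet.isForward_of_mem_edges he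
    obtain ⟨q, hq, hne⟩ := hσ.used k k' (Nat.lt_succ_self _) hlt he hk'
    exact ⟨q, (mem_connSupp.1 hq).1, hne⟩

/-- If `k` is the last block on `q`, then `σ` equals `h` there, and a nontrivial label would make
`k` active through the path covering `q`. Otherwise `q` leaves along an edge that cannot be in use,
since a used edge would activate `k`. -/
theorem Follows.trivial (hP : P.GoesThroughAndCovers kμ h.supp) (hσ : Follows P h (k + 1) σ)
    (hk : ¬ IsActive P h.supp k) : ∀ q ∈ s k, σ q = Pauli.I := by
  intro q hq
  by_cases hb : q ∈ bwdSupp s k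
  · rw [hσ.bwd k (Nat.lt_succ_self _) q hb]
    by_contra hne
    obtain ⟨p, hp, k', hk', hb'⟩ := hP.exists_bwdSupp hne
    have heq : k' = k := by
      have h1 := mem_bwdSupp.1 hb
      have h2 := mem_bwdSupp.1 hb'
      rcases lt_trichotomy k k' with hlt | heq | hlt
      · exact absurd h2.1 (h1.2 k' hlt)
      · exact heq.symm
      · exact absurd h1.1 (h2.2 k hlt)
    subst heq
    exact hk (IsActive.base k' p hp hk' ⟨q, Finset.mem_inter.2 ⟨hb,
      by simpa [PauliString.supp] using hne⟩⟩)
  · obtain ⟨k', hlt, hq'⟩ := exists_connSupp_next hq hb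
    exact hσ.unused k k' (Nat.lt_succ_self _) hlt (fun hE => hk (IsActive.step k k' hE.1 hE.2))
      q hq'

/-- Every edge that crosses the cut both before and after the step skips the block `k`, so its
support avoids `s k` and the labels there persist. Only edges into `k` need new information. -/
theorem Follows.step_of_agree {τ : PauliString N} (hσ : Follows P h (k + 1) σ)
    (hoff : ∀ q, q ∉ s k → τ q = σ q)
    (hused : ∀ i, (some i, k) ∈ P.edges → IsActive P h.supp k →
      ∃ q ∈ connSupp s i k, τ q ≠ Pauli.I)
    (hunused : ∀ i, i < k → ¬ ((some i, k) ∈ P.edges ∧ IsActive P h.supp k) →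
      ∀ q ∈ connSupp s i k, τ q = Pauli.I)
    (hfwd : ∀ q ∈ fwdSupp s k, τ q = Pauli.I ∨ τ q = Pauli.Z) : Follows P h k τ where
  used i k' hi hk' he hact := by
    rcases eq_or_lt_of_le (show k ≤ k' from hk') with rfl | hlt
    · exact hused i he hact
    · obtain ⟨q, hq, hne⟩ := hσ.used i k' (Nat.lt_succ_of_lt hi) hlt he hact
      exact ⟨q, hq, by rwa [hoff q ((mem_connSupp.1 hq).2.2 k hi hlt)]⟩
  unused i k' hi hk' he q hq := by
    rcases eq_or_lt_of_le (show k ≤ k' from hk') with rfl | hlt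
    · exact hunused i hi he q hq
    · rw [hoff q ((mem_connSupp.1 hq).2.2 k hi hlt)]
      exact hσ.unused i k' (Nat.lt_succ_of_lt hi) hlt he q hq
  fwd k' hk' q hq := by
    rcases eq_or_lt_of_le (show k ≤ k' from hk') with rfl | hlt
    · exact hfwd q hq
    · rw [hoff q ((mem_fwdSupp.1 hq).2 k hlt)]
      exact hσ.fwd k' hlt q hq
  bwd i hi q hq := by
    rw [hoff q ((mem_bwdSupp.1 hq).2 k hi)]
    exact hσ.bwd i (Nat.lt_succ_of_lt hi) q hq
  off q hq := by rw [hoff q (hq k), hσ.off q hq]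

theorem Follows.initialVec_eq_one (hσ : Follows P h 0 σ) : initialVec σ = 1 := by
  refine if_pos fun q => ?_
  by_cases hq : ∃ i, q ∈ s i
  · obtain ⟨i, hi⟩ := hq
    obtain ⟨k', -, hk'⟩ := exists_fwdSupp hi
    exact hσ.fwd k' (Nat.zero_le _) q hk'
  · push Not at hq
    exact Or.inl (hσ.off q hq)

/-- The origins of the edges into a block. -/
def PathSet.origins (P : PathSet s) (k : Fin m) : Finset (Option (Fin m)) :=
  Finset.univ.filter fun o => (o, k) ∈ P.edges

theorem PathSet.mem_origins {P : PathSet s} {o : Option (Fin m)} :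
    o ∈ P.origins k ↔ (o, k) ∈ P.edges := by simp [PathSet.origins]

theorem Follows.step_of_mem {τ : PauliString N} (hσ : Follows P h (k + 1) σ)
    (hk : IsActive P h.supp k) (hτ : τ ∈ followingStrings s k (P.origins k) σ) :
    Follows P h k τ := by
  rw [mem_followingStrings] at hτ
  refine hσ.step_of_agree hτ.1 (fun i hi _ => hτ.2.1 (some i) (PathSet.mem_origins.2 hi))
    (fun i hi hn => hτ.2.2.1 (some i) hi fun ho => hn ⟨PathSet.mem_origins.1 ho, hk⟩) hτ.2.2.2

/-- An active block lies on a path, hence has an incoming edge, and that edge forces a nontrivial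
label. -/
theorem followingStrings_subset (hk : IsActive P h.supp k) :
    followingStrings s k (P.origins k) σ ⊆ nontrivialClass (s k) σ := by
  intro τ hτ
  rw [mem_followingStrings] at hτ
  obtain ⟨⟨o, k'⟩, he, rfl⟩ := hk.exists_edge
  obtain ⟨q, hq, hne⟩ := hτ.2.1 o (PathSet.mem_origins.2 he)
  exact mem_nontrivialClass.2 ⟨hτ.1, q, edgeSupp_subset _ hq, hne⟩

/-- The weight which a block contributes to the lower bound. -/
noncomputable def blockWeight (P : PathSet s) (S : Finset (Fin N)) (kμ k : Fin m) : ℝ :=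
  open Classical in
  if IsActive P S k then
    (if k = kμ then 2 else 1) * (((4 : ℝ) ^ (s k).card - 1)⁻¹ *
      ∏ o ∈ P.origins k, edgeCount s (o, k))
  else 1

theorem edgeCount_nonneg (e : Option (Fin m) × Fin m) : 0 ≤ edgeCount s e := by
  rw [← cast_card_supportedStrings]
  exact Nat.cast_nonneg _

theorem four_pow_sub_one_nonneg (n : ℕ) : (0 : ℝ) ≤ (4 : ℝ) ^ n - 1 :=
  sub_nonneg.2 (one_le_pow₀ (by norm_num))

theorem blockWeight_nonneg (P : PathSet s) (S : Finset (Fin N)) (kμ k : Fin m) :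
    0 ≤ blockWeight P S kμ k := by
  have h1 := four_pow_sub_one_nonneg (s k).card
  have h2 : 0 ≤ ∏ o ∈ P.origins k, edgeCount s (o, k) :=
    Finset.prod_nonneg fun o _ => edgeCount_nonneg _
  unfold blockWeight
  split_ifs <;> positivity

/-- A lower bound for every sequence of functions on Pauli strings which satisfies the recursion
of the second moments. -/
theorem prod_blockWeight_le (hP : P.GoesThroughAndCovers kμ h.supp) {g : ℕ → PauliString N → ℝ}
    (g_nonneg : ∀ n τ, 0 ≤ g n τ) (g_zero : ∀ τ, initialVec τ = 1 → 1 ≤ g 0 τ)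
    (g_trivial : ∀ k : Fin m, k ≠ kμ → ∀ τ, (∀ q ∈ s k, τ q = Pauli.I) → g k τ ≤ g (k + 1) τ)
    (g_nontrivial : ∀ (k : Fin m) (τ), (∃ q ∈ s k, τ q ≠ Pauli.I) →
      (if k = kμ then 2 else 1) * (((4 : ℝ) ^ (s k).card - 1)⁻¹ *
        ∑ ρ ∈ nontrivialClass (s k) τ, g k ρ) ≤ g (k + 1) τ) :
    ∏ k, blockWeight P h.supp kμ k ≤ g m h := by
  -- The bound is proved uniformly over all strings following the path set at cut `n`, because one
  -- active block branches into many such strings at the previous cut.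
  have key : ∀ n : ℕ, n ≤ m → ∀ σ, Follows P h n σ →
      ∏ i ∈ Finset.univ.filter (fun i : Fin m => (i : ℕ) < n), blockWeight P h.supp kμ i ≤ g n σ := by
    intro n
    induction n with
    | zero =>
      intro _ σ hσ
      simpa using g_zero σ hσ.initialVec_eq_one
    | succ n ih =>
      intro hn σ hσ
      have hlt : n < m := hn
      obtain ⟨k, rfl⟩ : ∃ k : Fin m, (k : ℕ) = n := ⟨⟨n, hlt⟩, rfl⟩
      have hins : (Finset.univ.filter fun i : Fin m => (i : ℕ) < k + 1) =
          insert k (Finset.univ.filter fun i : Fin m => (i : ℕ) < k) := by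
        ext i
        simp only [Finset.mem_filter, Finset.mem_univ, true_and, Finset.mem_insert, Fin.ext_iff]
        omega
      rw [hins, Finset.prod_insert (by simp)]
      have hW : 0 ≤ ∏ i ∈ Finset.univ.filter (fun i : Fin m => (i : ℕ) < k), blockWeight P h.supp kμ i :=
        Finset.prod_nonneg fun i _ => blockWeight_nonneg P _ kμ i
      by_cases hk : IsActive P h.supp k
      · refine le_trans ?_ (g_nontrivial k σ (hσ.nontrivial hk))
        rw [blockWeight, if_pos hk, mul_assoc, mul_assoc]
        have hinv : (0 : ℝ) ≤ ((4 : ℝ) ^ (s k).card - 1)⁻¹ :=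
          inv_nonneg.2 (four_pow_sub_one_nonneg _)
        refine mul_le_mul_of_nonneg_left (mul_le_mul_of_nonneg_left ?_ hinv)
          (by split_ifs <;> norm_num)
        calc (∏ o ∈ P.origins k, edgeCount s (o, k)) *
              ∏ i ∈ Finset.univ.filter (fun i : Fin m => (i : ℕ) < k), blockWeight P h.supp kμ i
            ≤ ((followingStrings s k (P.origins k) σ).card : ℝ) *
              ∏ i ∈ Finset.univ.filter (fun i : Fin m => (i : ℕ) < k), blockWeight P h.supp kμ i :=
              mul_le_mul_of_nonneg_right (prod_edgeCount_le_card k (fun o ho =>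
                PathSet.isForward_of_mem_edges (PathSet.mem_origins.1 ho)) σ) hW
          _ = ∑ τ ∈ followingStrings s k (P.origins k) σ,
              ∏ i ∈ Finset.univ.filter (fun i : Fin m => (i : ℕ) < k), blockWeight P h.supp kμ i := by
              rw [Finset.sum_const, nsmul_eq_mul]
          _ ≤ ∑ τ ∈ followingStrings s k (P.origins k) σ, g k τ :=
              Finset.sum_le_sum fun τ hτ => ih hlt.le τ (hσ.step_of_mem hk hτ)
          _ ≤ _ := Finset.sum_le_sum_of_subset_of_nonneg (followingStrings_subset hk)
              fun τ _ _ => g_nonneg k τ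
      -- An inactive block is never `kμ`. This is essential: the differentiated block would
      -- annihilate a trivial string instead of preserving it.
      · have hne : k ≠ kμ := by
          rintro rfl
          exact hk hP.isActive
        have htriv := hσ.trivial hP hk
        rw [blockWeight, if_neg hk, one_mul]
        refine le_trans (ih hlt.le σ ?_) (g_trivial k hne σ htriv)
        exact hσ.step_of_agree (fun _ _ => rfl) (fun i _ hact => absurd hact hk)
          (fun i _ _ q hq => htriv q (mem_connSupp.1 hq).2.1)
          (fun q hq => Or.inl (htriv q (mem_fwdSupp.1 hq).1))
  have := key m le_rfl h (follows_initial hP)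
  simpa using this

/-! ### Comparison with lengths and widths -/

theorem edgeCount_le (e : Option (Fin m) × Fin m) :
    edgeCount s e ≤ (4 : ℝ) ^ (s e.2).card - 1 := by
  have hc : (edgeSupp s e).card ≤ (s e.2).card := Finset.card_le_card (edgeSupp_subset e)
  have h4 : ((edgeLabels e.1).card : ℝ) ≤ 4 := by
    have : (edgeLabels e.1).card ≤ 4 := Finset.card_le_univ _
    exact_mod_cast this
  have h0 : (0 : ℝ) ≤ ((edgeLabels e.1).card : ℝ) := Nat.cast_nonneg _
  exact sub_le_sub_right ((pow_le_pow_left₀ h0 h4 _).trans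
    (pow_le_pow_right₀ (by norm_num) hc)) 1

theorem one_le_four_pow_sub_one {n : ℕ} (hn : 0 < n) : (1 : ℝ) ≤ (4 : ℝ) ^ n - 1 := by
  have : (4 : ℝ) ^ 1 ≤ 4 ^ n := pow_le_pow_right₀ (by norm_num) hn
  linarith

theorem two_rpow_neg_two_mul_logb {x : ℝ} (hx : 0 < x) :
    (2 : ℝ) ^ (-(2 * Real.logb 4 x)) = x⁻¹ := by
  rw [Real.rpow_neg (by norm_num), Real.rpow_mul (by norm_num)]
  norm_num
  exact Real.rpow_logb (by norm_num) (by norm_num) hx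

/-- The factor which an edge contributes to the bound, where the edges from the initial state
include the width of the head. -/
theorem edge_factor {P : PathSet s} {e : Option (Fin m) × Fin m} (he : e ∈ P.edges) :
    (2 : ℝ) ^ (-(2 * edgeLength s e)) *
      (if e.1 = none then (2 : ℝ) ^ (-fwdWidth s e.2) else 1) =
        edgeCount s e / ((4 : ℝ) ^ (s e.2).card - 1) := by
  have hne := PathSet.edgeSupp_nonempty he
  have hc : 0 < (edgeSupp s e).card := Finset.card_pos.2 hne
  have hs : 0 < (s e.2).card := Finset.card_pos.2 (hne.mono (edgeSupp_subset e))
  have h1 : (0 : ℝ) < (4 : ℝ) ^ (edgeSupp s e).card - 1 := by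
    linarith [one_le_four_pow_sub_one hc]
  have h2 : (0 : ℝ) < (4 : ℝ) ^ (s e.2).card - 1 := by
    linarith [one_le_four_pow_sub_one hs]
  obtain ⟨_ | i, k⟩ := e
  · have h3 : (0 : ℝ) < (2 : ℝ) ^ (fwdSupp s k).card - 1 :=
      sub_pos.2 (one_lt_pow₀ (by norm_num) hc.ne')
    have h1' : (0 : ℝ) < (4 : ℝ) ^ (fwdSupp s k).card - 1 := h1
    have h2' : (0 : ℝ) < (4 : ℝ) ^ (s k).card - 1 := h2
    have hcount : edgeCount s (none, k) = (2 : ℝ) ^ (fwdSupp s k).card - 1 := by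
      simp [edgeCount, edgeLabels, edgeSupp]
    rw [if_pos rfl, hcount, edgeLength, fwdWidth, two_rpow_neg_two_mul_logb (div_pos h2' h1'),
      Real.rpow_neg (by norm_num), Real.rpow_logb (by norm_num) (by norm_num) (div_pos h1' h3)]
    simp only
    field_simp
  · have hcount : edgeCount s (some i, k) = (4 : ℝ) ^ (connSupp s i k).card - 1 := by
      simp [edgeCount, edgeLabels, edgeSupp, Pauli.card_eq]
    have h1' : (0 : ℝ) < (4 : ℝ) ^ (connSupp s i k).card - 1 := h1
    rw [if_neg (by simp), mul_one, edgeLength, two_rpow_neg_two_mul_logb (div_pos h2 h1'), hcount,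
      inv_div]

/-- Distinct heads correspond to distinct edges from the initial state, so each width joins the
length of its edge. There it replaces the count `4^f - 1` by `2^f - 1`, the number of nontrivial
strings in `I` and `Z`. -/
theorem PathSet.rpow_eq_prod (P : PathSet s) :
    (2 : ℝ) ^ (1 - 2 * P.length - P.headWidth) =
      2 * ∏ e ∈ P.edges, edgeCount s e / ((4 : ℝ) ^ (s e.2).card - 1) := by
  have hheads : ∏ k ∈ P.image CircuitPath.head, (2 : ℝ) ^ (-fwdWidth s k) =
      ∏ e ∈ P.edges, if e.1 = none then (2 : ℝ) ^ (-fwdWidth s e.2) else 1 := by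
    rw [← Finset.prod_filter]
    refine Finset.prod_bij (fun k _ => (none, k)) ?_ ?_ ?_ ?_
    · intro k hk
      obtain ⟨p, hp, rfl⟩ := Finset.mem_image.1 hk
      exact Finset.mem_filter.2
        ⟨Finset.mem_biUnion.2 ⟨p, hp, CircuitPath.mem_edges_none.2 rfl⟩, rfl⟩
    · intro k _ k' _ heq
      exact congrArg Prod.snd heq
    · rintro ⟨o, k⟩ he
      obtain ⟨he, ho⟩ := Finset.mem_filter.1 he
      simp only at ho
      subst ho
      obtain ⟨p, hp, he⟩ := Finset.mem_biUnion.1 he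
      exact ⟨k, Finset.mem_image.2 ⟨p, hp, (CircuitPath.mem_edges_none.1 he).symm⟩, rfl⟩
    · intro k _
      rfl
  have hsplit : 1 - 2 * P.length - P.headWidth =
      1 + (∑ e ∈ P.edges, -(2 * edgeLength s e) + ∑ k ∈ P.image CircuitPath.head,
        -fwdWidth s k) := by
    rw [PathSet.length, PathSet.headWidth, PathSet.edges, Finset.sum_neg_distrib,
      Finset.sum_neg_distrib, Finset.mul_sum]
    ring
  rw [hsplit, Real.rpow_add (by norm_num), Real.rpow_add (by norm_num), Real.rpow_one,
    Real.rpow_sum_of_pos (by norm_num), Real.rpow_sum_of_pos (by norm_num), hheads,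
    ← Finset.prod_mul_distrib]
  congr 1
  exact Finset.prod_congr rfl fun e he => edge_factor he

theorem PathSet.prod_edges (P : PathSet s) (f : Option (Fin m) × Fin m → ℝ) :
    ∏ e ∈ P.edges, f e = ∏ k, ∏ o ∈ P.origins k, f (o, k) := by
  rw [Finset.prod_sigma']
  refine Finset.prod_bij (fun e _ => ⟨e.2, e.1⟩) ?_ ?_ ?_ ?_
  · intro e he
    simpa [PathSet.mem_origins] using he
  · rintro ⟨o, k⟩ _ ⟨o', k'⟩ _ heq
    simp only [Sigma.mk.injEq, heq_eq_eq] at heq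
    rw [heq.1, heq.2]
  · rintro ⟨k, o⟩ ho
    exact ⟨(o, k), by simpa [PathSet.mem_origins] using ho, rfl⟩
  · intro e _
    rfl

/-- The comparison is made block by block. At an active block the left side carries the denominator
once per incoming edge, the right side only once; at an inactive block the right side is 1 and every
edge factor is at most 1. -/
theorem rpow_le_prod_blockWeight (hP : P.GoesThroughAndCovers kμ h.supp) :
    (2 : ℝ) ^ (1 - 2 * P.length - P.headWidth) ≤ ∏ k, blockWeight P h.supp kμ k := by
  -- The global factor 2 is attached to the block `kμ`, which is active and whose weight contains
  -- it.
  have htwo : (2 : ℝ) = ∏ k : Fin m, if k = kμ then 2 else 1 := by simp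
  have hdiv : ∀ e : Option (Fin m) × Fin m,
      0 ≤ edgeCount s e / ((4 : ℝ) ^ (s e.2).card - 1) := fun e =>
    div_nonneg (edgeCount_nonneg e) (four_pow_sub_one_nonneg _)
  have hone : ∀ e : Option (Fin m) × Fin m,
      edgeCount s e / ((4 : ℝ) ^ (s e.2).card - 1) ≤ 1 := fun e =>
    div_le_one_of_le₀ (edgeCount_le e) (four_pow_sub_one_nonneg _)
  rw [PathSet.rpow_eq_prod, PathSet.prod_edges]
  nth_rewrite 1 [htwo]
  rw [← Finset.prod_mul_distrib]
  refine Finset.prod_le_prod (fun k _ => mul_nonneg (by split_ifs <;> norm_num)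
    (Finset.prod_nonneg fun o _ => hdiv (o, k))) fun k _ => ?_
  unfold blockWeight
  by_cases hk : IsActive P h.supp k
  · rw [if_pos hk]
    refine mul_le_mul_of_nonneg_left ?_ (by split_ifs <;> norm_num)
    obtain ⟨⟨o, k'⟩, he, rfl⟩ := hk.exists_edge
    simp only
    have hs : 0 < (s k').card :=
      Finset.card_pos.2 ((PathSet.edgeSupp_nonempty he).mono (edgeSupp_subset _))
    have h1 := one_le_four_pow_sub_one hs
    rw [Finset.prod_div_distrib, Finset.prod_const, div_eq_inv_mul]
    refine mul_le_mul_of_nonneg_right ?_ (Finset.prod_nonneg fun o _ => edgeCount_nonneg _)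
    refine inv_anti₀ (by linarith) (le_self_pow₀ h1 ?_)
    exact (Finset.card_pos.2 ⟨o, PathSet.mem_origins.2 he⟩).ne'
  · have hne : k ≠ kμ := by
      rintro rfl
      exact hk hP.isActive
    rw [if_neg hk, if_neg hne, one_mul]
    exact Finset.prod_le_one (fun o _ => hdiv (o, k)) fun o _ => hone (o, k)

end Bound

end PathBound

/-! ### Assembly of the variance formula and the path bound. -/

theorem theorem1 {N m M : ℕ} (c : PathBound.Circuit N m M)
    (π : MeasureTheory.Measure (Fin M → ℝ)) [MeasureTheory.IsProbabilityMeasure π]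
    (μ : Fin M) (kμ : Fin m) (Ω : PathBound.PauliString N)
    (L R : (Fin M → ℝ) → PathBound.LocalUnitary (c.s kμ))
    (hc : PathBound.IsDesignCircuit c π μ kμ Ω L R)
    {J : Type} [Fintype J] (lam : J → ℝ) (h : J → PathBound.PauliString N)
    (h_distinct : Function.Injective h)
    (H : PathBound.Op N) (hH : H = ∑ j, (lam j : ℂ) • (h j).toOp)
    (h_supp : ∀ j, (h j).supp ⊆ c.supp) :
    (∀ j, PathBound.InCausalCone c.s (h j).supp kμ →
      ∃ P : PathBound.PathSet c.s, P.GoesThroughAndCovers kμ (h j).supp) ∧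
    ∀ P : J → PathBound.PathSet c.s,
      (∀ j, PathBound.InCausalCone c.s (h j).supp kμ →
        (P j).GoesThroughAndCovers kμ (h j).supp) →
      ∑ j ∈ PathBound.coneTerms c.s h kμ,
          lam j ^ 2 * (2 : ℝ) ^ (1 - 2 * (P j).length - (P j).headWidth) ≤
        ProbabilityTheory.variance (c.costDeriv H μ) π := by
  refine ⟨fun j hj => PathBound.exists_pathSet (h_supp j)
    (hc.generator_nontrivial.mono hc.generator_supp) hj, fun P hP => ?_⟩
  rw [hH, hc.variance_eq lam h_distinct h_supp]
  have hnonneg : ∀ n σ,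
      0 ≤ ∫ θ, PathBound.derivVec c kμ L R Ω μ n θ σ ^ 2 ∂π := fun n σ =>
    MeasureTheory.integral_nonneg fun _ => sq_nonneg _
  refine le_trans (Finset.sum_le_sum (g := fun j => lam j ^ 2 *
    ∫ θ, PathBound.derivVec c kμ L R Ω μ m θ (h j) ^ 2 ∂π) fun j hj => ?_)
    -- Terms whose causal cone misses `kμ` are dropped from the exact variance; they are
    -- nonnegative.
    (Finset.sum_le_sum_of_subset_of_nonneg (Finset.subset_univ _)
      fun j _ _ => mul_nonneg (sq_nonneg _) (hnonneg m (h j)))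
  have hcone : PathBound.InCausalCone c.s (h j).supp kμ := by
    simpa [PathBound.coneTerms] using hj
  refine mul_le_mul_of_nonneg_left ?_ (sq_nonneg _)
  refine (PathBound.rpow_le_prod_blockWeight (hP j hcone)).trans
    (PathBound.prod_blockWeight_le (hP j hcone)
      (g := fun n σ => ∫ θ, PathBound.derivVec c kμ L R Ω μ n θ σ ^ 2 ∂π) hnonneg ?_ ?_ ?_)
  · intro τ hτ
    simp [PathBound.derivVec, PathBound.layersUpTo, PathBound.chain, hτ]
  · exact fun k hk τ hτ => (PathBound.integral_derivVec_sq_of_trivial hk hτ).ge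
  · exact fun k τ hτ => hc.sq_succ_of_nontrivial k hτ
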